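/- **Setting.** Let $d,T\ge 1$, let $r,R,G>0$, and let $K\subseteq\mathbb R^d$ be closed and convex with $\mathbb B(r)\subseteq K\subseteq\mathbb B(R)$, where $\mathbb B(\rho)$ is the closed Euclidean ball of radius $\rho$ centred at $0$. Put $\kappa=R/r$. A *separation oracle* for $K$ is a map $w\mapsto(b,v)\in\{0,1\}\times\mathbb B(1)$ with $(b,v)=(0,0)$ if $w\in K$, and $b=1$ and $\langle v,w\rangle>\langle v,u\rangle$ for all $u\in K$ if $w\notin K$. One call costs $C_{\rm sep}$ elementary steps. **GaugeDist$(w;K,\varepsilon,r)$.** Query the oracle at $w$. If $w\in K$, return $(S,s)=(0,0)$. Otherwise let $v$ be the returned vector, set $\alpha=0$, $\beta=1$, and while $\beta-\alpha>\frac{r^2\varepsilon}{2\|w\|^2}$ query the oracle at $\mu w$, $\mu=\frac{\alpha+\beta}2$; if $\mu w\in K$ set $\alpha\leftarrow\mu$, otherwise set $\beta\leftarrow\mu$ and let $v$ be the returned vector. Return $S=\alpha^{-1}-1$ and $s=\frac{v}{\beta\langle v,w\rangle}$. **Barrier-ONS** over $\mathbb B(R)$ with parameters $(T,\eta,\nu,c)$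 and expansion order $m=\lceil\mathfrak c\,\log_{1/c}(dT)\rceil$. Start with $u_1=z_1=0$. In round $t$ output $u_t$, receive $\tilde g_t$, and set $$\Sigma_t=\Big(\tfrac{2\nu}{R^2-\|z_t\|^2}I+\tfrac{4\nu\,u_tu_t^\top}{(R^2-\|u_t\|^2)^2}+\eta\sum_{s\le t}\tilde g_s\tilde g_s^\top\Big)^{-1},\qquad \gamma_t=\tfrac{2\nu}{R^2-\|z_t\|^2}-\tfrac{2\nu}{R^2-\|u_t\|^2},$$ $$u_{t+1}=u_t-\sum_{k=1}^{m+1}\gamma_t^{k-1}\Sigma_t^k\,\nabla\Phi_{t+1}(u_t),$$ $$\Phi_{t+1}(x)=-\nu\log(R^2-\|x\|^2)+\tfrac\eta2\sum_{s\le t}\langle\tilde g_s,x-u_s\rangle^2+\Big\langle x,\sum_{s\le t}\tilde g_s\Big\rangle .$$ If $\big|\|u_{t+1}\|^2-\|z_t\|^2\big|\le c\,(R^2-\|u_{t+1}\|^2)$ put $z_{t+1}=z_t$, and otherwise $z_{t+1}=u_{t+1}$. **Gauge-projection reduction.** In round $t=1,\dots,T$, let $u_t$ be the current output of Barrier-ONS,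 compute $(S_t,s_t)=\mathrm{GaugeDist}(u_t;K,1/T,r)$, play $w_t=u_t/(1+S_t)$, observe $g_t$, and send Barrier-ONS the loss vector $\tilde g_t=g_t-\mathbb I\{\langle g_t,u_t\rangle<0\}\,\langle g_t,w_t\rangle\,s_t$. The observed $g_t$ is a subgradient at $w_t$ of an arbitrary (possibly adversarially chosen) convex loss $f_t:K\to\mathbb R$, and $\|g_t\|\le G$. Barrier-ONS is run with $$c=\tfrac12,\quad \eta=\tfrac1{GR}\min\Big(\tfrac1{10\kappa},\sqrt{\tfrac{2d\log(1+T/d)}{T}}\Big),\quad \nu=GR\max\Big(20\kappa d,\sqrt{\tfrac{dT}{\log(1+T/d)}}\Big).$$ **Theorem.** There is a universal constant $\mathfrak c_0$ such that for every $\mathfrak c\ge\mathfrak c_0$ the following holds. (1) For all data as above, $w_t\in K$ for all $t\le T$, and for every $w\in K$ $$\sum_{t=1}^T\langle g_t,w_t-w\rangle\le 5GR\sqrt{2dT\log(1+T/d)}+66\,GR\,\kappa\, d\log(1+T/d).$$ (2) Count every arithmetic operation and comparison of real numbers as one step and every oracle call as $C_{\rm sep}$ steps. Let $\omega\ge2$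 be any exponent such that $n\times n$ real matrices can be multiplied by arithmetic straight-line programs of length $O(n^\omega)$. Then there are constants $C,p$, depending only on $\omega$ and $\mathfrak c$, and for each $d$ an arithmetic straight-line program inverting $d\times d$ positive definite matrices, such that the following implementation of the algorithm plays the same points $w_1,\dots,w_T$ for all data as above. It maintains $\big(\frac{2\nu}{R^2-\|z_t\|^2}I+\eta\sum_{s}\tilde g_s\tilde g_s^\top\big)^{-1}$, starting from $\frac{R^2}{2\nu}I$, by rank-one updates; it evaluates $u_{t+1}$ by $O(m)$ matrix-vector products; and it executes the inversion program only when the test fails and $z_{t+1}$ is set to $u_{t+1}$. Its total number of steps is at most $$C\,\big(1+\log(dT\kappa)\big)^p\,\big(C_{\rm sep}\,T+d^2\,T+d^\omega\sqrt T\big),$$ that is, $\tilde O(C_{\rm sep}T+d^2T+d^\omega\sqrt T)$, where the logarithmic factors also involve $\kappa$. -/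

import Mathlib

open scoped RealInnerProductSpace

noncomputable section

namespace GaugeOCO

/-- Euclidean space `ℝ^d`. -/
abbrev Vec (d : ℕ) := EuclideanSpace ℝ (Fin d)

/-- Real `d × d` matrices. -/
abbrev Mat (d : ℕ) := Matrix (Fin d) (Fin d) ℝ

/-! ### Arithmetic straight-line programs and the matrix multiplication exponent -/

/-- The four arithmetic operations. -/
inductive ArithOp
  | add | sub | mul | div

/-- An operand: an input, a real constant, or the result of an earlier step. -/
inductive Operand (ι : Type)
  | input (i : ι)
  | const (c : ℝ)
  | step (k : ℕ)

/-- One instruction of a straight-line program. -/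
structure Instr (ι : Type) where
  op : ArithOp
  lhs : Operand ι
  rhs : Operand ι

/-- A straight-line arithmetic program with inputs indexed by `ι` and outputs indexed by `κ`. -/
structure ArithProg (ι κ : Type) where
  instrs : List (Instr ι)
  out : κ → Operand ι

/-- Value of an operand, given the inputs `x` and the results `mem` of the steps done so far. -/
def Operand.read {ι : Type} (x : ι → ℝ) (mem : List ℝ) : Operand ι → Option ℝ
  | .input i => some (x i)
  | .const c => some c
  | .step k => mem[k]?

/-- An arithmetic operation; division by zero is undefined. -/
def ArithOp.eval : ArithOp → ℝ → ℝ → Option ℝ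
  | .add, a, b => some (a + b)
  | .sub, a, b => some (a - b)
  | .mul, a, b => some (a * b)
  | .div, a, b => open Classical in if b = 0 then none else some (a / b)

/-- Result of one instruction. -/
def Instr.eval {ι : Type} (x : ι → ℝ) (mem : List ℝ) (I : Instr ι) : Option ℝ :=
  (I.lhs.read x mem).bind fun a => (I.rhs.read x mem).bind fun b => I.op.eval a b

/-- Execute a list of instructions, appending each result to the memory. -/
def runInstrs {ι : Type} (x : ι → ℝ) : List (Instr ι) → List ℝ → Option (List ℝ)
  | [], mem => some mem
  | I :: Is, mem => (I.eval x mem).bind fun v => runInstrs x Is (mem ++ [v])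

/-- The `k`-th output of the program on input `x` (undefined if some step is undefined). -/
def ArithProg.output {ι κ : Type} (P : ArithProg ι κ) (x : ι → ℝ) (k : κ) : Option ℝ :=
  (runInstrs x P.instrs []).bind fun mem => (P.out k).read x mem

/-- Number of arithmetic operations of the program. -/
def ArithProg.size {ι κ : Type} (P : ArithProg ι κ) : ℕ := P.instrs.length

/-- `P` multiplies `n × n` matrices. -/
def ArithProg.Multiplies {n : ℕ}
    (P : ArithProg ((Fin n × Fin n) ⊕ (Fin n × Fin n)) (Fin n × Fin n)) : Prop :=
  ∀ (A B : Mat n) (k : Fin n × Fin n),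
    P.output (Sum.elim (fun p => A p.1 p.2) (fun p => B p.1 p.2)) k = some ((A * B) k.1 k.2)

/-- `P` inverts positive definite symmetric `n × n` matrices. -/
def ArithProg.InvertsPosDef {n : ℕ} (P : ArithProg (Fin n × Fin n) (Fin n × Fin n)) : Prop :=
  ∀ A : Mat n, A.PosDef → ∀ k : Fin n × Fin n,
    P.output (fun p => A p.1 p.2) k = some (A⁻¹ k.1 k.2)

/-- `ω ≥ 2` is an admissible exponent of matrix multiplication: `n × n` matrices can be
multiplied with `O(n ^ ω)` arithmetic operations. -/
def IsMatMulExponent (ω : ℝ) : Prop :=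
  2 ≤ ω ∧ ∃ C : ℝ, ∀ n : ℕ, 1 ≤ n →
    ∃ P : ArithProg ((Fin n × Fin n) ⊕ (Fin n × Fin n)) (Fin n × Fin n),
      P.Multiplies ∧ (P.size : ℝ) ≤ C * (n : ℝ) ^ ω

/-! ### Computations with a step count -/

/-- The result of a computation, with the number of elementary steps that were spent. -/
structure Costed (α : Type) where
  val : α
  cost : ℕ

instance : Monad Costed where
  pure a := ⟨a, 0⟩
  bind x f := ⟨(f x.val).val, x.cost + (f x.val).cost⟩

/-! Elementary operations on real numbers, of cost one each. -/

def addC (x y : ℝ) : Costed ℝ := ⟨x + y, 1⟩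
def subC (x y : ℝ) : Costed ℝ := ⟨x - y, 1⟩
def mulC (x y : ℝ) : Costed ℝ := ⟨x * y, 1⟩
def divC (x y : ℝ) : Costed ℝ := ⟨x / y, 1⟩
def absC (x : ℝ) : Costed ℝ := ⟨|x|, 1⟩
open Classical in
def leC (x y : ℝ) : Costed Bool := ⟨decide (x ≤ y), 1⟩
open Classical in
def ltC (x y : ℝ) : Costed Bool := ⟨decide (x < y), 1⟩

/-- A loop over the coordinates that builds a vector. -/
def vecOf {d : ℕ} (f : Fin d → Costed ℝ) : Costed (Vec d) :=
  ⟨WithLp.toLp 2 fun i => (f i).val, ∑ i, (f i).cost⟩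

/-- A loop over all entries that builds a matrix. -/
def matOf {d : ℕ} (f : Fin d → Fin d → Costed ℝ) : Costed (Mat d) :=
  ⟨Matrix.of fun i j => (f i j).val, ∑ i, ∑ j, (f i j).cost⟩

/-- A loop over the coordinates that accumulates a sum, with one addition per coordinate. -/
def sumOf {d : ℕ} (f : Fin d → Costed ℝ) : Costed ℝ :=
  ⟨∑ i, (f i).val, ∑ i, ((f i).cost + 1)⟩

def dotC {d : ℕ} (x y : Vec d) : Costed ℝ := sumOf fun i => mulC (x i) (y i)
def addVecC {d : ℕ} (x y : Vec d) : Costed (Vec d) := vecOf fun i => addC (x i) (y i)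
def subVecC {d : ℕ} (x y : Vec d) : Costed (Vec d) := vecOf fun i => subC (x i) (y i)
def smulVecC {d : ℕ} (a : ℝ) (x : Vec d) : Costed (Vec d) := vecOf fun i => mulC a (x i)
def divVecC {d : ℕ} (x : Vec d) (a : ℝ) : Costed (Vec d) := vecOf fun i => divC (x i) a
def mulVecC {d : ℕ} (A : Mat d) (x : Vec d) : Costed (Vec d) :=
  vecOf fun i => sumOf fun j => mulC (A i j) (x j)
def outerC {d : ℕ} (x y : Vec d) : Costed (Mat d) := matOf fun i j => mulC (x i) (y j)
def addMatC {d : ℕ} (A B : Mat d) : Costed (Mat d) := matOf fun i j => addC (A i j) (B i j)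
def subMatC {d : ℕ} (A B : Mat d) : Costed (Mat d) := matOf fun i j => subC (A i j) (B i j)
def smulMatC {d : ℕ} (a : ℝ) (A : Mat d) : Costed (Mat d) := matOf fun i j => mulC a (A i j)
/-- The scalar matrix `a I`. -/
def scalarMatC {d : ℕ} (a : ℝ) : Costed (Mat d) :=
  matOf fun i j => if i = j then mulC a 1 else mulC a 0

/-- Execute a straight-line program on the entries of a matrix, paying its number of steps. -/
def execC {d : ℕ} (P : ArithProg (Fin d × Fin d) (Fin d × Fin d)) (A : Mat d) : Costed (Mat d) :=
  ⟨Matrix.of fun i j => (P.output (fun p => A p.1 p.2) (i, j)).getD 0, P.size⟩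

/-- `for k = 1, …, n do s ← body s`. -/
def forC {σ : Type} (body : σ → Costed σ) : ℕ → σ → Costed σ
  | 0, s => pure s
  | n + 1, s => do
      let s' ← body s
      forC body n s'

open Classical in
/-- `while guard s do s ← body s`: iterate the body until the guard fails for the first time
(the initial state is returned if this never happens). -/
def whileLoop {σ : Type} (guard : σ → Prop) (body : σ → σ) (s : σ) : σ :=
  if h : ∃ n : ℕ, ¬ guard (body^[n] s) then body^[Nat.find h] s else s

/-- A while loop that pays for every evaluation of the guard and of the body. -/
def whileC {σ : Type} (guard : σ → Costed Bool) (body : σ → Costed σ) (s : σ) : Costed σ :=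
  let e : Costed σ := whileLoop (fun c : Costed σ => (guard c.val).val = true)
    (fun c => ⟨(body c.val).val, c.cost + (guard c.val).cost + (body c.val).cost⟩) ⟨s, 0⟩
  ⟨e.val, e.cost + (guard e.val).cost⟩

/-! ### Separation oracles and approximate gauge distance -/

/-- A separation oracle for `K`: the answer is `(false, 0)` on points `w ∈ K`, and otherwise
`(true, v)` with `v` in the unit ball strictly separating `w` from `K`. -/
def IsSeparationOracle {d : ℕ} (K : Set (Vec d)) (sep : Vec d → Bool × Vec d) : Prop :=
  ∀ w : Vec d, ‖(sep w).2‖ ≤ 1 ∧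
    (w ∈ K → sep w = (false, 0)) ∧
    (w ∉ K → (sep w).1 = true ∧ ∀ u ∈ K, ⟪(sep w).2, u⟫ < ⟪(sep w).2, w⟫)

/-- `GaugeDist(w; K, ε, r)`: bisection for the gauge of `K` at `w`. The state is `(α, β, v)`, where
`v` is the vector returned by the oracle at the infeasible point `β w`. The output is
`(S, s)`, an approximate value and subgradient of the gauge distance to `K` at `w`.
One oracle call costs `Csep`. -/
def gaugeDist {d : ℕ} (sep : Vec d → Bool × Vec d) (Csep : ℕ) (ε r : ℝ) (w : Vec d) :
    Costed (ℝ × Vec d) := do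
  let a ← (⟨sep w, Csep⟩ : Costed (Bool × Vec d))
  if a.1 = false then
    pure (0, 0)
  else
    let num ← mulC (r * r) ε
    let ww ← dotC w w
    let den ← mulC 2 ww
    let τ ← divC num den
    let fin ← whileC
      (fun s : ℝ × ℝ × Vec d => do
        let gap ← subC s.2.1 s.1
        ltC τ gap)
      (fun s : ℝ × ℝ × Vec d => do
        let sm ← addC s.1 s.2.1
        let μ ← divC sm 2
        let μw ← smulVecC μ w
        let b ← (⟨sep μw, Csep⟩ : Costed (Bool × Vec d))
        if b.1 = false then pure (μ, s.2.1, s.2.2) else pure (s.1, μ, b.2))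
      ((0 : ℝ), (1 : ℝ), a.2)
    let ia ← divC 1 fin.1
    let S ← subC ia 1
    let vw ← dotC fin.2.2 w
    let c ← mulC fin.2.1 vw
    let s ← divVecC fin.2.2 c
    pure (S, s)

/-! ### The reduction with gauge projections -/

/-- An online algorithm with state space `σ`: initial state, point output in a state, and
update of the state when a loss vector is received. -/
structure OnlineAlgorithm (d : ℕ) (σ : Type) where
  init : Costed σ
  output : σ → Vec d
  update : σ → Vec d → Costed σ

section Reduction

variable {d : ℕ} {σ : Type} (A : OnlineAlgorithm d σ)
  (sep : Vec d → Bool × Vec d) (Csep : ℕ) (r : ℝ) (T : ℕ)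

/-- The point `w = u / (1 + S)` played when the subroutine outputs `u`, together with `s`, where
`(S, s)` is the output of `GaugeDist(u; K, 1/T, r)`. -/
def reductionPlay (st : σ) : Costed (Vec d × Vec d) := do
  let p ← gaugeDist sep Csep (1 / (T : ℝ)) r (A.output st)
  let c ← addC 1 p.1
  let w ← divVecC (A.output st) c
  pure (w, p.2)

/-- One round, in which the subgradient `g` is observed; the subroutine is sent
`g - 𝟙{⟨g, u⟩ < 0} ⟨g, w⟩ s`. -/
def reductionRound (st : σ) (g : Vec d) : Costed σ := do
  let p ← reductionPlay A sep Csep r T st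
  let gu ← dotC g (A.output st)
  let neg ← ltC gu 0
  if neg = true then
    let gw ← dotC g p.1
    let x ← smulVecC gw p.2
    let g' ← subVecC g x
    A.update st g'
  else
    A.update st g

/-- State of the subroutine, and total cost, after `t` rounds with observed subgradients
`g 0, g 1, …` (rounds are numbered from `0`). -/
def reductionState (g : ℕ → Vec d) : ℕ → Costed σ
  | 0 => A.init
  | t + 1 => do
      let st ← reductionState g t
      reductionRound A sep Csep r T st (g t)

/-- The point played in round `t` (rounds are numbered from `0`). -/
def play (g : ℕ → Vec d) (t : ℕ) : Vec d :=
  (reductionPlay A sep Csep r T (reductionState A sep Csep r T g t).val).val.1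

/-- Total cost of `T` rounds. -/
def totalCost (g : ℕ → Vec d) : ℕ := (reductionState A sep Csep r T g T).cost

end Reduction

/-! ### Barrier-ONS -/

section BarrierONS

variable {d : ℕ} (R η ν c : ℝ) (m : ℕ)

/-- The objective `Φ` for a history of pairs `(u_s, g_s)`:
`-ν log (R² - ‖x‖²) + (η/2) ∑ ⟨g_s, x - u_s⟩² + ⟨x, ∑ g_s⟩`. -/
def objective (hist : List (Vec d × Vec d)) (x : Vec d) : ℝ :=
  -ν * Real.log (R ^ 2 - ‖x‖ ^ 2)
    + η / 2 * (hist.map fun p => ⟪p.2, x - p.1⟫ ^ 2).sum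
    + ⟪x, (hist.map Prod.snd).sum⟫

/-- State of Barrier-ONS: current iterate `u`, Taylor expansion point `z`, history. -/
structure OnsState (d : ℕ) where
  u : Vec d
  z : Vec d
  hist : List (Vec d × Vec d)

/-- The matrix `Σ_t`, for the history including round `t`. -/
def sigmaMat (u z : Vec d) (hist : List (Vec d × Vec d)) : Mat d :=
  ((2 * ν / (R ^ 2 - ‖z‖ ^ 2)) • (1 : Mat d)
    + (4 * ν / (R ^ 2 - ‖u‖ ^ 2) ^ 2) • Matrix.vecMulVec u u
    + η • (hist.map fun p => Matrix.vecMulVec p.2 p.2).sum)⁻¹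

/-- `γ_t = 2ν/(R² - ‖z_t‖²) - 2ν/(R² - ‖u_t‖²)`. -/
def gammaOf (u z : Vec d) : ℝ := 2 * ν / (R ^ 2 - ‖z‖ ^ 2) - 2 * ν / (R ^ 2 - ‖u‖ ^ 2)

/-- `H_t = ∑_{k=1}^{m+1} γ_t^{k-1} Σ_t^k`. -/
def taylorMat (u z : Vec d) (hist : List (Vec d × Vec d)) : Mat d :=
  ∑ k ∈ Finset.range (m + 1), gammaOf R ν u z ^ k • sigmaMat R η ν u z hist ^ (k + 1)

open Classical in
/-- One round of Barrier-ONS with loss vector `g`. -/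
def onsUpdate (st : OnsState d) (g : Vec d) : OnsState d :=
  let hist := st.hist ++ [(st.u, g)]
  let u' := st.u - Matrix.toEuclideanLin (taylorMat R η ν m st.u st.z hist)
    (gradient (objective R η ν hist) st.u)
  { u := u'
    z := if |‖u'‖ ^ 2 - ‖st.z‖ ^ 2| ≤ c * (R ^ 2 - ‖u'‖ ^ 2) then st.z else u'
    hist := hist }

/-- Barrier-ONS in its mathematical form (its own steps are not counted here). -/
def barrierONS (d : ℕ) : OnlineAlgorithm d (OnsState d) where
  init := pure ⟨0, 0, []⟩
  output st := st.u
  update st g := pure (onsUpdate R η ν c m st g)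

/-- State of the implementation of Barrier-ONS: the iterate `u`, the expansion point `z`,
`sig = (2ν/(R² - ‖z‖²) I + η V)⁻¹`, `V = ∑ g_s g_sᵀ`, `S = ∑ ⟨g_s, u_s⟩ g_s` and `G = ∑ g_s`. -/
structure FastState (d : ℕ) where
  u : Vec d
  z : Vec d
  sig : Mat d
  V : Mat d
  S : Vec d
  G : Vec d

/-- Rank-one update of an inverse: from `A = M⁻¹` (symmetric) compute
`A - a A x xᵀ A / (b + a xᵀ A x)`, which is `(M + (a/b) x xᵀ)⁻¹`. -/
def rankOneC (A : Mat d) (x : Vec d) (a b : ℝ) : Costed (Mat d) := do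
  let y ← mulVecC A x
  let q ← dotC x y
  let aq ← mulC a q
  let den ← addC b aq
  let e ← divC a den
  let yy ← outerC y y
  let B ← smulMatC e yy
  subMatC A B

/-- One round of the implementation of Barrier-ONS; `inv` is the subroutine for matrix inversion,
which is executed only when the expansion point changes. -/
def fastUpdate (inv : ArithProg (Fin d × Fin d) (Fin d × Fin d)) (st : FastState d) (g : Vec d) :
    Costed (FastState d) := do
  let G ← addVecC st.G g
  let gu ← dotC g st.u
  let gug ← smulVecC gu g
  let S ← addVecC st.S gug
  let gg ← outerC g g
  let V ← addMatC st.V gg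
  -- the gradient `2ν u/(R² - ‖u‖²) + η V u - η S + G`
  let RR ← mulC R R
  let uu ← dotC st.u st.u
  let zz ← dotC st.z st.z
  let bu ← subC RR uu
  let bz ← subC RR zz
  let ν2 ← mulC 2 ν
  let hu ← divC ν2 bu
  let hz ← divC ν2 bz
  let x1 ← smulVecC hu st.u
  let Vu ← mulVecC V st.u
  let x2 ← subVecC Vu S
  let x3 ← smulVecC η x2
  let x4 ← addVecC x1 x3
  let grad ← addVecC x4 G
  -- rank-one updates of the inverse
  let sig' ← rankOneC st.sig g η 1
  let bu2 ← mulC bu bu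
  let ν4 ← mulC 4 ν
  let Sig ← rankOneC sig' st.u ν4 bu2
  -- the Taylor expansion applied to the gradient
  let γ ← subC hz hu
  let δ0 ← mulVecC Sig grad
  let δ ← forC
    (fun p : Vec d × Vec d => do
      let y ← mulVecC Sig p.1
      let y' ← smulVecC γ y
      let s ← addVecC p.2 y'
      pure (y', s))
    m (δ0, δ0)
  let u' ← subVecC st.u δ.2
  -- does the expansion point change?
  let uu' ← dotC u' u'
  let df ← subC uu' zz
  let adf ← absC df
  let bu' ← subC RR uu'
  let thr ← mulC c bu'
  let keep ← leC adf thr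
  if keep = true then
    pure ⟨u', st.z, sig', V, S, G⟩
  else
    let hu' ← divC ν2 bu'
    let I' ← scalarMatC hu'
    let ηV ← smulMatC η V
    let M ← addMatC I' ηV
    let sig'' ← execC inv M
    pure ⟨u', u', sig'', V, S, G⟩

/-- The implementation of Barrier-ONS as an online algorithm. -/
def fastBarrierONS (inv : ArithProg (Fin d × Fin d) (Fin d × Fin d)) :
    OnlineAlgorithm d (FastState d) where
  init := do
    let RR ← mulC R R
    let ν2 ← mulC 2 ν
    let a ← divC RR ν2
    let sig ← scalarMatC a
    pure ⟨0, 0, sig, 0, 0, 0⟩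
  output st := st.u
  update st g := fastUpdate R η ν c m inv st g

end BarrierONS

/-! ### Parameters and assumptions -/

/-- `η = (1/(GR)) min (1/(10κ)) √(2 d log(1 + T/d) / T)`. -/
def etaParam (d T : ℕ) (G R κ : ℝ) : ℝ :=
  1 / (G * R) * min (1 / (10 * κ)) (√(2 * d * Real.log (1 + T / d) / T))

/-- `ν = G R max (20 κ d) √(d T / log(1 + T/d))`. -/
def nuParam (d T : ℕ) (G R κ : ℝ) : ℝ :=
  G * R * max (20 * κ * d) (√(d * T / Real.log (1 + T / d)))

/-- Order of the Taylor expansion: `a log_{1/c}(d T)`, rounded up. -/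
def taylorOrder (a c : ℝ) (d T : ℕ) : ℕ := ⌈a * Real.logb c⁻¹ (d * T)⌉₊

/-- Barrier-ONS over the ball of radius `R` with the tuned parameters, `c = 1/2`, and
Taylor expansions of order `⌈a log₂(d T)⌉`. -/
def tunedONS (a : ℝ) (d T : ℕ) (G R κ : ℝ) : OnlineAlgorithm d (OnsState d) :=
  barrierONS R (etaParam d T G R κ) (nuParam d T G R κ) (1 / 2) (taylorOrder a (1 / 2) d T) d

/-- The implementation of `tunedONS` that uses the matrix inversion program `inv`. -/
def tunedFastONS (a : ℝ) {d : ℕ} (T : ℕ) (G R κ : ℝ)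
    (inv : ArithProg (Fin d × Fin d) (Fin d × Fin d)) : OnlineAlgorithm d (FastState d) :=
  fastBarrierONS R (etaParam d T G R κ) (nuParam d T G R κ) (1 / 2) (taylorOrder a (1 / 2) d T) inv

/-- `K` is closed and convex, with `B(r) ⊆ K ⊆ B(R)`. -/
structure SetAssumption {d : ℕ} (K : Set (Vec d)) (r R : ℝ) : Prop where
  isClosed : IsClosed K
  convex : Convex ℝ K
  r_pos : 0 < r
  R_pos : 0 < R
  ball_subset : Metric.closedBall 0 r ⊆ K
  subset_ball : K ⊆ Metric.closedBall 0 R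

/-- `g` is a subgradient at `w` of `f`, regarded as a function on `K`. -/
def IsSubgradientOn {d : ℕ} (K : Set (Vec d)) (f : Vec d → ℝ) (w g : Vec d) : Prop :=
  ∀ y ∈ K, f w + ⟪g, y - w⟫ ≤ f y

/-- In each of the `T` rounds the loss is convex on `K` and the observed vector is a subgradient
of it at the played point, of norm at most `G`. -/
structure LossAssumption {d : ℕ} (K : Set (Vec d)) (G : ℝ) (T : ℕ) (f : ℕ → Vec d → ℝ)
    (w g : ℕ → Vec d) : Prop where
  G_pos : 0 < G
  convex : ∀ t < T, ConvexOn ℝ K (f t)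
  subgradient : ∀ t < T, IsSubgradientOn K (f t) (w t) (g t)
  norm_le : ∀ t < T, ‖g t‖ ≤ G

end GaugeOCO

end

/-!
The proof has three layers: regret of Barrier-ONS, the reduction to it, and the implementation.

*Barrier-ONS as an approximate Newton method.* Let `A` be the Hessian of `Φ` at `u`. The matrix
`Σ` is `(A + γ)⁻¹`, and the update is `-∑ γ^k Σ^(k+1) ∇Φ`, a truncated Neumann series for
`-A⁻¹ ∇Φ`. The test on the expansion point keeps `γ` between `-1/3` and `1` times a lower bound of
the spectrum of `A` (`gamma_bounds`), so that `γ Σ` halves the norm given by `A`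
(`inner_map_smul_resolvent_le`), and five terms, which the expansion order provides as soon as
`𝔠 ≥ 4` and `d T ≥ 2`, suffice for a Newton step that is exact up to the factor `1 / 32`
(`neumann_step`). As the barrier is self-concordant (`sq_barrier_remainder_le`), one such step turns
a Newton decrement `λ` into a residual of at most `λ / 5` (`ons_step`). The decrement after a new
loss is at most the old residual plus the dual norm of the loss, so the squared decrements sum up to
a multiple of the sum of the squared dual norms, which is logarithmic by the elliptical potential
argument (`sum_dual_norm_le`). The objective at the iterates grows in each round by the loss
`⟨g̃_t, u_t⟩`, up to a multiple of the squared decrement, and this gives the regret bound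
`onsSeq_regret` without a comparison of the iterates with the exact minimizers.

*The reduction.* With a gauge distance that is accurate up to `1 / T`, the regret of the surrogate
loss at `u_t` exceeds that of the true loss at `w_t` by a quantity between `-G R / (2 T)` and
`2 κ G R` (`lossVec_regret`), and the surrogate gradients have norm at most a multiple of `κ G`
(`norm_lossVec_le`). The choice of `η` makes the excess pay for its own contribution to the
quadratic term in the regret of Barrier-ONS (`absorb_quadratic`), so only the contribution of the
true losses remains, and `κ` enters only the logarithmic term of the final bound (`tuned_regret`).

*The cost.* The expansion point changes only after `log (R² - ‖u‖²)` has moved by at least `1 / 3`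
since the last change, while one round moves it by a multiple of the decrement divided by `√ν`. By
the Cauchy–Schwarz inequality there are `O(√T)` changes up to logarithms (`switchCount_sq_le`). In
between, the Sherman–Morrison formula keeps the inverse exact (`rankOneC_val`), so that the
implementation goes through the states of Barrier-ONS (`fastUpdate_represents`). At a change, the
inverse is computed by recursive block elimination, with Schur complements, in `O(d ^ ω)` operations
(`exists_inversion_program`). The bisection for the gauge takes logarithmically many oracle calls
(`gaugePlay_cost_le`), and the sum over the rounds is `fast_totalCost_le`.
-/

open scoped RealInnerProductSpace

noncomputable section

namespace GaugeOCO

/-! ### Positive semidefinite forms and truncated Neumann series -/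

section Neumann

variable {E : Type*} [NormedAddCommGroup E] [InnerProductSpace ℝ E]

/-- The Cauchy–Schwarz inequality for the quadratic form of a symmetric positive semidefinite
operator. -/
lemma inner_map_sq_le {A : E →ₗ[ℝ] E} (hs : A.IsSymmetric) (hp : ∀ x, 0 ≤ ⟪A x, x⟫) (x y : E) :
    ⟪A x, y⟫ ^ 2 ≤ ⟪A x, x⟫ * ⟪A y, y⟫ := by
  have h : ∀ t : ℝ, 0 ≤ ⟪A y, y⟫ * (t * t) + 2 * ⟪A x, y⟫ * t + ⟪A x, x⟫ := by
    intro t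
    have := hp (x + t • y)
    have e : ⟪A y, x⟫ = ⟪A x, y⟫ := by rw [hs y x, real_inner_comm]
    simp only [map_add, map_smul, inner_add_left, inner_add_right, inner_smul_left,
      inner_smul_right, e, conj_trivial] at this
    linarith
  have := discrim_le_zero h
  unfold discrim at this
  nlinarith

/-- The triangle inequality for the seminorm of a symmetric positive semidefinite operator. -/
lemma sqrt_inner_map_sub_le {A : E →ₗ[ℝ] E} (hs : A.IsSymmetric) (hp : ∀ x, 0 ≤ ⟪A x, x⟫)
    (x y : E) : √⟪A (x - y), x - y⟫ ≤ √⟪A x, x⟫ + √⟪A y, y⟫ := by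
  have h1 := hp x
  have h2 := hp y
  apply Real.sqrt_le_iff.2
  refine ⟨by positivity, ?_⟩
  have e : ⟪A y, x⟫ = ⟪A x, y⟫ := by rw [hs y x, real_inner_comm]
  have hc : -⟪A x, y⟫ ≤ √⟪A x, x⟫ * √⟪A y, y⟫ := by
    rw [← Real.sqrt_mul h1]
    apply Real.le_sqrt_of_sq_le
    have := inner_map_sq_le hs hp x y
    nlinarith
  simp only [map_sub, inner_sub_left, inner_sub_right, e]
  nlinarith [Real.sq_sqrt h1, Real.sq_sqrt h2]

lemma abs_inner_map_le {A : E →ₗ[ℝ] E} (hs : A.IsSymmetric) (hp : ∀ x, 0 ≤ ⟪A x, x⟫)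
    (x y : E) : |⟪A x, y⟫| ≤ √⟪A x, x⟫ * √⟪A y, y⟫ := by
  rw [← Real.sqrt_mul (hp x)]
  exact Real.abs_le_sqrt (inner_map_sq_le hs hp x y)

/-- If `S = (A + γ)⁻¹` and the spectrum of `A` lies in `[a, ∞)`, where `-a/3 ≤ γ ≤ a`, then `γ S`
contracts the seminorm of `A` by the factor `1/2`. -/
lemma inner_map_smul_resolvent_le {A S : E →ₗ[ℝ] E} (hs : A.IsSymmetric) {a γ : ℝ} (ha : 0 < a)
    (hlow : ∀ x, a * ‖x‖ ^ 2 ≤ ⟪A x, x⟫) (hγ1 : γ ≤ a) (hγ2 : -3 * γ ≤ a)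
    (hS : ∀ x, A (S x) + γ • S x = x) (v : E) :
    ⟪A (γ • S v), γ • S v⟫ ≤ ⟪A v, v⟫ / 4 := by
  set w := S v with hw
  have hv : v = A w + γ • w := (hS v).symm
  have hp : ∀ x, 0 ≤ ⟪A x, x⟫ := fun x => le_trans (by positivity) (hlow x)
  have e1 : ⟪A (A w), w⟫ = ‖A w‖ ^ 2 := by rw [hs (A w) w, real_inner_self_eq_norm_sq]
  have e2 : ⟪A w, A w⟫ = ‖A w‖ ^ 2 := real_inner_self_eq_norm_sq _
  have h3 := hlow (A w)
  -- `a ⟪A w, w⟫ ≤ ‖A w‖ ^ 2`, since `a ‖w‖ ^ 2 ≤ ⟪A w, w⟫ ≤ ‖A w‖ ‖w‖`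
  have h2 : a * ⟪A w, w⟫ ≤ ‖A w‖ ^ 2 := by
    have h1 := hlow w
    have hc := real_inner_le_norm (A w) w
    have hn : 0 ≤ ‖w‖ := norm_nonneg _
    have hn' : 0 ≤ ‖A w‖ := norm_nonneg _
    rcases hn.eq_or_lt with h0 | h0
    · rw [← h0] at hc
      nlinarith [hp w]
    · have h4 : a * ‖w‖ ≤ ‖A w‖ := by
        by_contra hcon
        push Not at hcon
        nlinarith
      nlinarith
  have hw0 := hp w
  have hq0 : 0 ≤ ‖A w‖ ^ 2 := by positivity
  rw [hv]
  simp only [map_add, map_smul, inner_add_left, inner_add_right, inner_smul_left,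
    inner_smul_right, conj_trivial, e1, e2]
  have key : 3 * γ ^ 2 * ⟪A w, w⟫ ≤ ⟪A (A w), A w⟫ + 2 * γ * ‖A w‖ ^ 2 := by
    rcases le_total 0 γ with h | h
    · have : γ * (γ * ⟪A w, w⟫) ≤ γ * ‖A w‖ ^ 2 :=
        mul_le_mul_of_nonneg_left (le_trans (mul_le_mul_of_nonneg_right hγ1 hw0) h2) h
      nlinarith [mul_le_mul_of_nonneg_right hγ1 hq0]
    · have : (-γ) * (-3 * γ * ⟪A w, w⟫) ≤ (-γ) * ‖A w‖ ^ 2 :=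
        mul_le_mul_of_nonneg_left (le_trans (mul_le_mul_of_nonneg_right hγ2 hw0) h2) (by linarith)
      nlinarith [mul_le_mul_of_nonneg_right hγ2 hq0]
  nlinarith

/-- The truncated Neumann series `∑_{k<m} γ^k S^{k+1}` inverts `A` up to the error `(γ S)^m`. -/
lemma sum_resolvent_pow_apply {A S : E →ₗ[ℝ] E} {γ : ℝ}
    (hS : ∀ x, S (A x + γ • x) = x) (e : E) (m : ℕ) :
    ∑ k ∈ Finset.range m, γ ^ k • (S ^ (k + 1)) (A e) = e - ((γ • S) ^ m) e := by
  induction m with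
  | zero => simp
  | succ m ih =>
    rw [Finset.sum_range_succ, ih]
    have h : S (A e) = e - γ • S e := by
      have := hS e
      rw [map_add, map_smul] at this
      exact eq_sub_of_add_eq this
    have h2 : γ ^ m • (S ^ (m + 1)) (A e) = ((γ • S) ^ m) e - ((γ • S) ^ (m + 1)) e := by
      rw [pow_succ S m, Module.End.mul_apply, h, map_sub, map_smul, smul_pow, smul_pow,
        LinearMap.smul_apply, LinearMap.smul_apply, smul_sub, smul_smul, pow_succ γ m,
        pow_succ S m, Module.End.mul_apply]
    rw [h2]
    abel

/-- Properties of the step `δ = -H n`, where `H` is a truncated Neumann series for `A⁻¹`, relative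
to the Newton decrement `λ ^ 2 = ⟪n, A⁻¹ n⟫`. The error of a series with `m` terms is
`(γ S) ^ m A⁻¹ n`; each factor halves the norm given by `A`, so five terms leave at
most `λ / 32`. -/
lemma neumann_step {A S : E →ₗ[ℝ] E} (hs : A.IsSymmetric) {a γ : ℝ} (ha : 0 < a)
    (hlow : ∀ x, a * ‖x‖ ^ 2 ≤ ⟪A x, x⟫) (hγ1 : γ ≤ a) (hγ2 : -3 * γ ≤ a)
    (hS : ∀ x, A (S x) + γ • S x = x) (hS' : ∀ x, S (A x + γ • x) = x)
    {n e δ : E} (hn : A e = n) {m : ℕ} (hm : 5 ≤ m)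
    (hδ : δ = -∑ k ∈ Finset.range m, γ ^ k • (S ^ (k + 1)) n) :
    √⟪A δ, δ⟫ ≤ 33 / 32 * √⟪n, e⟫ ∧ -⟪n, δ⟫ ≤ 33 / 32 * ⟪n, e⟫ ∧
      ∀ x, |⟪n + A δ, x⟫| ≤ 1 / 32 * √⟪n, e⟫ * √⟪A x, x⟫ := by
  have hp : ∀ x, 0 ≤ ⟪A x, x⟫ := fun x => le_trans (by positivity) (hlow x)
  subst hn
  have hpow : ∀ k : ℕ, ⟪A (((γ • S) ^ k) e), ((γ • S) ^ k) e⟫ ≤ (1 / 4) ^ k * ⟪A e, e⟫ := by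
    intro k
    induction k with
    | zero => simp
    | succ k ih =>
      have := inner_map_smul_resolvent_le hs ha hlow hγ1 hγ2 hS (((γ • S) ^ k) e)
      rw [pow_succ', Module.End.mul_apply, LinearMap.smul_apply, pow_succ]
      linarith
  set f := ((γ • S) ^ m) e with hf
  have hf1 : √⟪A f, f⟫ ≤ 1 / 32 * √⟪A e, e⟫ := by
    apply Real.sqrt_le_iff.2
    refine ⟨by positivity, ?_⟩
    rw [mul_pow, Real.sq_sqrt (hp e)]
    refine (hpow m).trans (mul_le_mul_of_nonneg_right ?_ (hp e))
    calc (1 / 4 : ℝ) ^ m ≤ (1 / 4) ^ 5 := pow_le_pow_of_le_one (by norm_num) (by norm_num) hm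
      _ = (1 / 32) ^ 2 := by norm_num
  have hd : δ = f - e := by
    rw [hδ, sum_resolvent_pow_apply hS', neg_sub]
  have hne := abs_inner_map_le hs hp e f
  refine ⟨?_, ?_, ?_⟩
  · rw [hd]
    have := sqrt_inner_map_sub_le hs hp f e
    linarith
  · rw [hd, inner_sub_right]
    have h1 : √⟪A e, e⟫ * √⟪A f, f⟫ ≤ 1 / 32 * ⟪A e, e⟫ := by
      nlinarith [Real.sqrt_nonneg ⟪A e, e⟫, Real.mul_self_sqrt (hp e)]
    have := neg_abs_le ⟪A e, f⟫
    linarith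
  · intro x
    have : A e + A δ = A f := by rw [hd, map_sub]; abel
    rw [this]
    exact (abs_inner_map_le hs hp f x).trans
      (mul_le_mul_of_nonneg_right hf1 (Real.sqrt_nonneg _))

end Neumann

/-! ### The logarithmic barrier of the ball -/

section Barrier

variable {E : Type*} [NormedAddCommGroup E] [InnerProductSpace ℝ E]

/-- The Hessian of the barrier `-log (R² - ‖x‖²)` at `u`, as a quadratic form: the square of the
local norm at `u`. -/
def barrierHess (R : ℝ) (u x : E) : ℝ :=
  2 / (R ^ 2 - ‖u‖ ^ 2) * ‖x‖ ^ 2 + (2 * ⟪u, x⟫ / (R ^ 2 - ‖u‖ ^ 2)) ^ 2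

/-- The relative decrease of `R² - ‖·‖²` between `u` and `u + δ`. -/
def gapDecrease (R : ℝ) (u δ : E) : ℝ :=
  2 * ⟪u, δ⟫ / (R ^ 2 - ‖u‖ ^ 2) + ‖δ‖ ^ 2 / (R ^ 2 - ‖u‖ ^ 2)

lemma barrierHess_nonneg {R : ℝ} {u : E} (hu : 0 < R ^ 2 - ‖u‖ ^ 2) (x : E) :
    0 ≤ barrierHess R u x := by
  unfold barrierHess; positivity

lemma gap_add_eq {R : ℝ} {u : E} (hu : 0 < R ^ 2 - ‖u‖ ^ 2) (δ : E) :
    R ^ 2 - ‖u + δ‖ ^ 2 = (R ^ 2 - ‖u‖ ^ 2) * (1 - gapDecrease R u δ) := by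
  unfold gapDecrease
  rw [norm_add_sq_real]
  field_simp
  ring

lemma abs_gapDecrease_le {R : ℝ} {u δ : E} (hu : 0 < R ^ 2 - ‖u‖ ^ 2) {s : ℝ} (hs0 : 0 ≤ s)
    (hs : s ≤ 1 / 10) (h : barrierHess R u δ ≤ s ^ 2) : |gapDecrease R u δ| ≤ 105 / 100 * s := by
  unfold gapDecrease
  unfold barrierHess at h
  set p := 2 * ⟪u, δ⟫ / (R ^ 2 - ‖u‖ ^ 2)
  have hq0 : 0 ≤ ‖δ‖ ^ 2 / (R ^ 2 - ‖u‖ ^ 2) := by positivity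
  have hq : 2 / (R ^ 2 - ‖u‖ ^ 2) * ‖δ‖ ^ 2 = 2 * (‖δ‖ ^ 2 / (R ^ 2 - ‖u‖ ^ 2)) := by ring
  rw [hq] at h
  set q := ‖δ‖ ^ 2 / (R ^ 2 - ‖u‖ ^ 2)
  have hp : |p| ≤ s := abs_le_of_sq_le_sq (by linarith) hs0
  have hq1 : q ≤ s / 20 := by nlinarith [sq_nonneg p]
  rw [abs_le] at hp ⊢
  constructor <;> linarith [hp.1, hp.2]

/-- The logarithm of `R² - ‖·‖²` moves by at most a multiple of the local norm of a step. -/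
lemma abs_log_gap_le {R : ℝ} {u δ : E} (hu : 0 < R ^ 2 - ‖u‖ ^ 2) {s : ℝ} (hs0 : 0 ≤ s)
    (hs : s ≤ 1 / 10) (h : barrierHess R u δ ≤ s ^ 2) :
    |Real.log (R ^ 2 - ‖u + δ‖ ^ 2) - Real.log (R ^ 2 - ‖u‖ ^ 2)| ≤ 13 / 10 * s := by
  have hy := abs_gapDecrease_le hu hs0 hs h
  rw [gap_add_eq hu]
  set y := gapDecrease R u δ
  rw [abs_le] at hy
  have h1 : 0 < 1 - y := by linarith
  rw [Real.log_mul hu.ne' h1.ne', add_sub_cancel_left, abs_le]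
  constructor
  · have := Real.log_le_sub_one_of_pos (inv_pos.2 h1)
    rw [Real.log_inv] at this
    have h2 : (1 - y)⁻¹ - 1 ≤ 13 / 10 * s := by
      rw [sub_le_iff_le_add, inv_le_comm₀ h1 (by positivity), inv_eq_one_div,
        div_le_iff₀ (by positivity)]
      nlinarith
    linarith
  · have := Real.log_le_sub_one_of_pos h1
    linarith

lemma sq_two_inner_div_le {b : ℝ} (hb : 0 < b) (δ x : E) :
    (2 * ⟪δ, x⟫ / b) ^ 2 ≤ (2 * (‖δ‖ ^ 2 / b)) * (2 / b * ‖x‖ ^ 2) := by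
  have h : ⟪δ, x⟫ ^ 2 ≤ ‖δ‖ ^ 2 * ‖x‖ ^ 2 := by
    rw [← mul_pow]
    exact sq_le_sq' (by linarith [neg_abs_le ⟪δ, x⟫, abs_real_inner_le_norm δ x])
      (real_inner_le_norm δ x)
  have e1 : (2 * ⟪δ, x⟫ / b) ^ 2 = 4 / b ^ 2 * ⟪δ, x⟫ ^ 2 := by ring
  have e2 : (2 * (‖δ‖ ^ 2 / b)) * (2 / b * ‖x‖ ^ 2) = 4 / b ^ 2 * (‖δ‖ ^ 2 * ‖x‖ ^ 2) := by ring
  rw [e1, e2]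
  exact mul_le_mul_of_nonneg_left h (by positivity)

/-- The Cauchy–Schwarz inequality in the plane, with `D` bounded through `D² ≤ 2 q N`. -/
lemma sq_add_mul_le_of_sq_le {P D N q A B : ℝ} (hq0 : 0 ≤ q) (hN0 : 0 ≤ N)
    (hD : D ^ 2 ≤ 2 * q * N) :
    (P * A + D * B) ^ 2 ≤ (A ^ 2 + 2 * q * B ^ 2) * (N + P ^ 2) := by
  have h1 : D ^ 2 * B ^ 2 ≤ 2 * q * N * B ^ 2 := mul_le_mul_of_nonneg_right hD (sq_nonneg _)
  have h2 : 2 * (P * A) * (D * B) ≤ A ^ 2 * N + 2 * q * B ^ 2 * P ^ 2 := by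
    have h4 : (P * D * B) ^ 2 ≤ (2 * q * B ^ 2 * P ^ 2) * N := by
      have := mul_le_mul_of_nonneg_right h1 (sq_nonneg P)
      linarith [(by ring : (P * D * B) ^ 2 = D ^ 2 * B ^ 2 * P ^ 2)]
    have h5 : |P * D * B| ≤ √(2 * q * B ^ 2 * P ^ 2) * √N := by
      rw [← Real.sqrt_mul (by positivity)]
      exact Real.abs_le_sqrt h4
    have h6 : 2 * (P * A) * (D * B) ≤ 2 * (|A| * |P * D * B|) := by
      rw [← abs_mul]
      linarith [le_abs_self (A * (P * D * B))]
    have h7 := mul_le_mul_of_nonneg_left h5 (abs_nonneg A)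
    have h8 := Real.sq_sqrt (by positivity : (0 : ℝ) ≤ 2 * q * B ^ 2 * P ^ 2)
    have h9 := Real.sq_sqrt hN0
    have h10 := two_mul_le_add_sq (|A| * √N) (√(2 * q * B ^ 2 * P ^ 2))
    rw [mul_pow, h8, h9, sq_abs] at h10
    linarith
  linarith [(by ring : (P * A + D * B) ^ 2
    = P ^ 2 * A ^ 2 + 2 * (P * A) * (D * B) + D ^ 2 * B ^ 2)]

/-- The scalar inequality behind the self-concordance of the barrier: `y = p + q` is the relative
decrease of `R² - ‖x‖²`, with linear part `p` and quadratic part `q`, and `p ^ 2 + 2 * q` is the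
squared local norm of the step. -/
lemma remainder_coeff_le {p q y : ℝ} (hyd : y = p + q) (hq0 : 0 ≤ q)
    (h : p ^ 2 + 2 * q ≤ 1 / 100) :
    (q + y ^ 2 / (1 - y)) ^ 2 + 2 * q * (y / (1 - y)) ^ 2
      ≤ (128 / 100) ^ 2 * (p ^ 2 + 2 * q) ^ 2 := by
  have hpa : |p| ≤ 1 / 10 := abs_le_of_sq_le_sq (by linarith) (by norm_num)
  have hq1 : q ≤ 1 / 200 := by linarith [sq_nonneg p]
  rw [abs_le] at hpa
  have hy1 : 1 / (1118 / 1000) ≤ 1 - y := by linarith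
  have hyy : y ^ 2 ≤ p ^ 2 + 205 / 1000 * q := by
    have h1 : p * q ≤ 1 / 10 * q := mul_le_mul_of_nonneg_right hpa.2 hq0
    have h2 : q * q ≤ 1 / 200 * q := mul_le_mul_of_nonneg_right hq1 hq0
    linarith [(by rw [hyd]; ring : y ^ 2 = p ^ 2 + 2 * (p * q) + q * q)]
  have hinv : (1 - y)⁻¹ ≤ 1118 / 1000 := inv_le_of_inv_le₀ (by norm_num) (by linarith)
  have hinv0 : 0 ≤ (1 - y)⁻¹ := inv_nonneg.2 (le_trans (by norm_num) hy1)
  rw [div_eq_mul_inv, div_eq_mul_inv]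
  generalize (1 - y)⁻¹ = i at hinv hinv0
  have hp2 := sq_nonneg p
  have ha : q + y ^ 2 * i ≤ 1118 / 1000 * (p ^ 2 + 2 * q) := by
    have := mul_le_mul hyy hinv hinv0 (by positivity)
    linarith
  have ha2 : (q + y ^ 2 * i) ^ 2 ≤ (1118 / 1000 * (p ^ 2 + 2 * q)) ^ 2 :=
    pow_le_pow_left₀ (by positivity) ha 2
  have hb : 2 * q * (y * i) ^ 2 ≤ 3844 / 10000 * (p ^ 2 + 2 * q) ^ 2 := by
    have h1 : (y * i) ^ 2 ≤ (p ^ 2 + 205 / 1000 * q) * (1118 / 1000) ^ 2 := by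
      rw [mul_pow]
      exact mul_le_mul hyy (pow_le_pow_left₀ hinv0 hinv 2) (by positivity) (by positivity)
    have h2 := mul_le_mul_of_nonneg_left h1 (by positivity : 0 ≤ 2 * q)
    have h3 : 0 ≤ p ^ 2 * q := by positivity
    linarith [sq_nonneg (p ^ 2 - 13 / 10 * q), sq_nonneg q,
      (by ring : (p ^ 2 - 13 / 10 * q) ^ 2
        = (p ^ 2) ^ 2 - 26 / 10 * (p ^ 2 * q) + 169 / 100 * q ^ 2),
      (by ring : (p ^ 2 + 2 * q) ^ 2 = (p ^ 2) ^ 2 + 4 * (p ^ 2 * q) + 4 * q ^ 2),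
      (by ring : 2 * q * ((p ^ 2 + 205 / 1000 * q) * (1118 / 1000) ^ 2)
        = (1118 / 1000) ^ 2 * (2 * (p ^ 2 * q) + 410 / 1000 * q ^ 2))]
  rw [mul_pow] at ha2
  linarith [sq_nonneg (p ^ 2 + 2 * q)]

/-- Self-concordance of the barrier: the second-order remainder of its gradient, in the dual of the
local norm. -/
lemma sq_barrier_remainder_le {R : ℝ} {u δ : E} (hu : 0 < R ^ 2 - ‖u‖ ^ 2) {s : ℝ} (hs0 : 0 ≤ s)
    (hs : s ≤ 1 / 10) (h : barrierHess R u δ ≤ s ^ 2) (x : E) :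
    (2 / (R ^ 2 - ‖u + δ‖ ^ 2) * ⟪u + δ, x⟫ - 2 / (R ^ 2 - ‖u‖ ^ 2) * ⟪u, x⟫
      - (2 / (R ^ 2 - ‖u‖ ^ 2) * ⟪δ, x⟫ + 4 / (R ^ 2 - ‖u‖ ^ 2) ^ 2 * ⟪u, δ⟫ * ⟪u, x⟫)) ^ 2
      ≤ (128 / 100 * s ^ 2) ^ 2 * barrierHess R u x := by
  have hy := abs_gapDecrease_le hu hs0 hs h
  rw [gap_add_eq hu, inner_add_left]
  have hyd : gapDecrease R u δ = 2 * ⟪u, δ⟫ / (R ^ 2 - ‖u‖ ^ 2) + ‖δ‖ ^ 2 / (R ^ 2 - ‖u‖ ^ 2) := rfl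
  have hD := sq_two_inner_div_le hu δ x
  unfold barrierHess at h ⊢
  set b := R ^ 2 - ‖u‖ ^ 2
  set y := gapDecrease R u δ
  have hq : 2 / b * ‖δ‖ ^ 2 = 2 * (‖δ‖ ^ 2 / b) := by ring
  have hq0 : 0 ≤ ‖δ‖ ^ 2 / b := by positivity
  have hN0 : 0 ≤ 2 / b * ‖x‖ ^ 2 := by positivity
  rw [hq] at h
  have hs2 : s ^ 2 ≤ 1 / 100 := by nlinarith
  rw [abs_le] at hy
  have hy1 : 0 < 1 - y := by linarith
  have e1 : 2 / (b * (1 - y)) * (⟪u, x⟫ + ⟪δ, x⟫) - 2 / b * ⟪u, x⟫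
      - (2 / b * ⟪δ, x⟫ + 4 / b ^ 2 * ⟪u, δ⟫ * ⟪u, x⟫)
      = (2 * ⟪u, x⟫ / b) * (y / (1 - y) - 2 * ⟪u, δ⟫ / b) + (2 * ⟪δ, x⟫ / b) * (y / (1 - y)) := by
    field_simp
    ring
  rw [e1]
  set p := 2 * ⟪u, δ⟫ / b
  set q := ‖δ‖ ^ 2 / b
  set P := 2 * ⟪u, x⟫ / b
  set D := 2 * ⟪δ, x⟫ / b
  set N := 2 / b * ‖x‖ ^ 2
  have hyi : y / (1 - y) - p = q + y ^ 2 / (1 - y) := by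
    rw [(by linarith : p = y - q)]
    field_simp
    ring
  rw [hyi]
  refine (sq_add_mul_le_of_sq_le hq0 hN0 hD).trans (mul_le_mul_of_nonneg_right ?_ (by positivity))
  refine (remainder_coeff_le hyd hq0 (by linarith)).trans ?_
  have hs4 : (p ^ 2 + 2 * q) ^ 2 ≤ (s ^ 2) ^ 2 := pow_le_pow_left₀ (by positivity) (by linarith) 2
  linarith [(by ring : (128 / 100 * s ^ 2) ^ 2 = (128 / 100) ^ 2 * (s ^ 2) ^ 2)]

/-- Nearby points have comparable local norms. -/
lemma barrierHess_le_add {R : ℝ} {u δ : E} (hu : 0 < R ^ 2 - ‖u‖ ^ 2) {s : ℝ} (hs0 : 0 ≤ s)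
    (hs : s ≤ 1 / 10) (h : barrierHess R u δ ≤ s ^ 2) (x : E) :
    barrierHess R u x ≤ (123 / 100) ^ 2 * barrierHess R (u + δ) x := by
  have hy := abs_gapDecrease_le hu hs0 hs h
  have hD := sq_two_inner_div_le hu δ x
  unfold barrierHess at h ⊢
  rw [gap_add_eq hu, inner_add_left]
  set b := R ^ 2 - ‖u‖ ^ 2
  set y := gapDecrease R u δ
  have hq : 2 / b * ‖δ‖ ^ 2 = 2 * (‖δ‖ ^ 2 / b) := by ring
  have hq0 : 0 ≤ ‖δ‖ ^ 2 / b := by positivity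
  rw [hq] at h
  rw [abs_le] at hy
  have hy1 : 0 < 1 - y := by linarith
  have e1 : 2 / b * ‖x‖ ^ 2 = (1 - y) * (2 / (b * (1 - y)) * ‖x‖ ^ 2) := by field_simp
  have e2 : 2 * ⟪u, x⟫ / b
      = (1 - y) * (2 * (⟪u, x⟫ + ⟪δ, x⟫) / (b * (1 - y))) - 2 * ⟪δ, x⟫ / b := by
    field_simp
    ring
  have hN0 : 0 ≤ 2 / (b * (1 - y)) * ‖x‖ ^ 2 := by positivity
  rw [e1] at hD ⊢
  rw [e2]
  set N := 2 / (b * (1 - y)) * ‖x‖ ^ 2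
  set P := 2 * (⟪u, x⟫ + ⟪δ, x⟫) / (b * (1 - y))
  set D := 2 * ⟪δ, x⟫ / b
  set q := ‖δ‖ ^ 2 / b
  have hq1 : 2 * q ≤ 1 / 100 := by nlinarith [sq_nonneg (2 * ⟪u, δ⟫ / b)]
  have hD2 : D ^ 2 ≤ 1 / 100 * ((1 - y) * N) :=
    hD.trans (mul_le_mul_of_nonneg_right hq1 (by positivity))
  have h1 : ((1 - y) * P - D) ^ 2 ≤ 11 / 10 * ((1 - y) * P) ^ 2 + 11 * D ^ 2 := by
    nlinarith [sq_nonneg ((1 - y) * P + 10 * D)]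
  have h2 : (1 - y) ^ 2 ≤ (1105 / 1000) ^ 2 := pow_le_pow_left₀ hy1.le (by linarith) 2
  have h3 : ((1 - y) * P) ^ 2 ≤ (1105 / 1000) ^ 2 * P ^ 2 := by
    rw [mul_pow]; exact mul_le_mul_of_nonneg_right h2 (sq_nonneg _)
  have h4 : (1 - y) * N ≤ 1105 / 1000 * N := mul_le_mul_of_nonneg_right (by linarith) hN0
  nlinarith [sq_nonneg P]

/-- A lower bound for the Bregman divergence of the barrier, linear in the local norm. For `θ = 0`
this is convexity. -/
lemma barrier_bregman_lower {R : ℝ} {u δ : E} (hu : 0 < R ^ 2 - ‖u‖ ^ 2)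
    (hx : 0 < R ^ 2 - ‖u + δ‖ ^ 2) {θ : ℝ} (hθ0 : 0 ≤ θ) (hθ : θ ≤ 1 / 10) :
    θ * √(barrierHess R u δ) - 5 / 2 * θ ^ 2 ≤
      Real.log (R ^ 2 - ‖u‖ ^ 2) - Real.log (R ^ 2 - ‖u + δ‖ ^ 2)
        - 2 * ⟪u, δ⟫ / (R ^ 2 - ‖u‖ ^ 2) := by
  rw [gap_add_eq hu] at hx ⊢
  have hyd : gapDecrease R u δ = 2 * ⟪u, δ⟫ / (R ^ 2 - ‖u‖ ^ 2) + ‖δ‖ ^ 2 / (R ^ 2 - ‖u‖ ^ 2) := rfl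
  unfold barrierHess
  set b := R ^ 2 - ‖u‖ ^ 2
  set y := gapDecrease R u δ
  have hq : 2 / b * ‖δ‖ ^ 2 = 2 * (‖δ‖ ^ 2 / b) := by ring
  have hq0 : 0 ≤ ‖δ‖ ^ 2 / b := by positivity
  rw [hq]
  set p := 2 * ⟪u, δ⟫ / b
  set q := ‖δ‖ ^ 2 / b
  have hy1 : 0 < 1 - y := pos_of_mul_pos_right hx hu.le
  rw [Real.log_mul hu.ne' hy1.ne']
  -- the tangent of `log` at `1 / (1 + t)`
  have key : ∀ t : ℝ, |t| ≤ 1 / 10 → y + t * y - 10 / 9 * t ^ 2 ≤ -Real.log (1 - y) := by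
    intro t ht
    rw [abs_le] at ht
    have ht1 : 0 < 1 + t := by linarith
    have h1 := Real.log_le_sub_one_of_pos (mul_pos ht1 hy1)
    rw [Real.log_mul ht1.ne' hy1.ne'] at h1
    have h2 := Real.log_le_sub_one_of_pos (inv_pos.2 ht1)
    rw [Real.log_inv] at h2
    have h3 : (1 + t)⁻¹ - 1 ≤ -t + 10 / 9 * t ^ 2 := by
      rw [sub_le_iff_le_add, inv_eq_one_div, div_le_iff₀ ht1]
      nlinarith [mul_nonneg (sq_nonneg t) (by linarith : 0 ≤ 1 + 10 * t)]
    nlinarith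
  have habs : y + θ * |y| - 10 / 9 * θ ^ 2 ≤ -Real.log (1 - y) := by
    have hθa : |θ| ≤ 1 / 10 := by rwa [abs_of_nonneg hθ0]
    rcases le_total 0 y with h | h
    · rw [abs_of_nonneg h]; exact key θ hθa
    · rw [abs_of_nonpos h]
      have := key (-θ) (by rwa [abs_neg])
      linarith [this, (by ring : -θ * y = θ * -y), (by ring : (-θ) ^ 2 = θ ^ 2)]
  have hsq : √(2 * q + p ^ 2) ≤ √(2 * q) + |p| := by
    apply Real.sqrt_le_iff.2
    refine ⟨by positivity, ?_⟩
    have := Real.sq_sqrt (by positivity : (0 : ℝ) ≤ 2 * q)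
    nlinarith [sq_abs p, mul_nonneg (Real.sqrt_nonneg (2 * q)) (abs_nonneg p)]
  have hp : |p| ≤ |y| + q := by
    have : p = y - q := by rw [hyd]; ring
    rw [this]
    exact (abs_sub _ _).trans (by rw [abs_of_nonneg hq0])
  have h5 : θ * √(2 * q) ≤ q / 2 + θ ^ 2 := by
    have := Real.sq_sqrt (by positivity : (0 : ℝ) ≤ 2 * q)
    nlinarith [sq_nonneg (√(2 * q) / 2 - θ)]
  have h6 : θ * √(2 * q + p ^ 2) ≤ θ * (√(2 * q) + (|y| + q)) :=
    mul_le_mul_of_nonneg_left (by linarith) hθ0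
  have h7 : θ * q ≤ 1 / 10 * q := mul_le_mul_of_nonneg_right hθ hq0
  nlinarith

end Barrier

/-! ### The elliptical potential -/

section EllipticalPotential

open Matrix

lemma posSemidef_vecMulVec_self {n : Type*} [Fintype n] (x : n → ℝ) :
    (vecMulVec x x).PosSemidef := by
  simpa using posSemidef_vecMulVec_self_star x

variable {n : Type*} [Fintype n] [DecidableEq n]

/-- The determinant of a positive definite matrix is at most `(tr / n)ⁿ`, in logarithmic form. -/
lemma log_det_le_of_trace_le [Nonempty n] {A : Matrix n n ℝ} (hA : A.PosDef) {μ : ℝ}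
    (hμ : 0 < μ) (h : A.trace ≤ Fintype.card n * μ) :
    Real.log A.det ≤ Fintype.card n * Real.log μ := by
  have hp := hA.eigenvalues_pos
  rw [hA.isHermitian.det_eq_prod_eigenvalues]
  simp only [RCLike.ofReal_real_eq_id, id_eq]
  rw [Real.log_prod (fun i _ => (hp i).ne')]
  have h1 : ∀ i, Real.log (hA.isHermitian.eigenvalues i)
      ≤ hA.isHermitian.eigenvalues i / μ - 1 + Real.log μ := by
    intro i
    have := Real.log_le_sub_one_of_pos (div_pos (hp i) hμ)
    rw [Real.log_div (hp i).ne' hμ.ne'] at this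
    linarith
  refine (Finset.sum_le_sum fun i _ => h1 i).trans ?_
  rw [hA.isHermitian.trace_eq_sum_eigenvalues] at h
  simp only [RCLike.ofReal_real_eq_id, id_eq] at h
  rw [Finset.sum_add_distrib, Finset.sum_sub_distrib, ← Finset.sum_div]
  simp only [Finset.sum_const, Finset.card_univ, nsmul_eq_mul, mul_one]
  have : (∑ i, hA.isHermitian.eigenvalues i) / μ ≤ Fintype.card n := (div_le_iff₀ hμ).2 h
  linarith

/-- One rank-one update increases `log det` by at least the dual norm of the new vector. -/
lemma dual_norm_le_log_det_sub {W : Matrix n n ℝ} (hW : W.PosDef) {η : ℝ} (hη : 0 < η)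
    (x : n → ℝ) :
    η * (x ⬝ᵥ ((W + η • vecMulVec x x)⁻¹ *ᵥ x)) ≤
      Real.log (W + η • vecMulVec x x).det - Real.log W.det := by
  have hW' : (W + η • vecMulVec x x).PosDef :=
    hW.add_posSemidef ((posSemidef_vecMulVec_self x).smul hη.le)
  set W' := W + η • vecMulVec x x with hdef
  have hd : W.det = W'.det * (1 - η * (x ⬝ᵥ (W'⁻¹ *ᵥ x))) := by
    have e : W = W' + replicateCol Unit ((-η) • x) * replicateRow Unit x := by
      rw [← vecMulVec_eq, smul_vecMulVec, hdef, neg_smul]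
      abel
    conv_lhs => rw [e]
    rw [det_add_replicateCol_mul_replicateRow ((isUnit_iff_isUnit_det _).1 hW'.isUnit),
      Matrix.mul_assoc, ← replicateCol_mulVec,
      det_unique (n := Unit), Matrix.add_apply, Matrix.one_apply_eq,
      replicateRow_mul_replicateCol_apply, mulVec_smul, dotProduct_smul, smul_eq_mul]
    ring
  have hpos := hW.det_pos
  have hpos' := hW'.det_pos
  have h1 : 0 < 1 - η * (x ⬝ᵥ (W'⁻¹ *ᵥ x)) := by
    rw [hd] at hpos
    exact pos_of_mul_pos_right hpos hpos'.le
  rw [hd, Real.log_mul hpos'.ne' h1.ne']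
  have := Real.log_le_sub_one_of_pos h1
  linarith

/-- The elliptical potential lemma. -/
lemma sum_dual_norm_le [Nonempty n] {w η γ : ℝ} (hw : 0 < w) (hη : 0 < η) (g : ℕ → n → ℝ) (T : ℕ)
    (hg : ∀ t < T, g t ⬝ᵥ g t ≤ γ) :
    η * ∑ t ∈ Finset.range T,
      (g t ⬝ᵥ ((w • (1 : Matrix n n ℝ)
        + η • ∑ s ∈ Finset.range (t + 1), vecMulVec (g s) (g s))⁻¹ *ᵥ g t)) ≤
      Fintype.card n * Real.log (1 + T * (η * γ / (w * Fintype.card n))) := by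
  set W : ℕ → Matrix n n ℝ := fun t =>
    w • (1 : Matrix n n ℝ) + η • ∑ s ∈ Finset.range t, vecMulVec (g s) (g s) with hWdef
  have hW : ∀ t, (W t).PosDef := fun t =>
    (PosDef.one.smul hw).add_posSemidef
      ((posSemidef_sum _ fun s _ => posSemidef_vecMulVec_self (g s)).smul hη.le)
  have hstep : ∀ t, W (t + 1) = W t + η • vecMulVec (g t) (g t) := by
    intro t
    simp only [hWdef, Finset.sum_range_succ, smul_add, add_assoc]
  have h1 : ∀ t, η * (g t ⬝ᵥ ((W (t + 1))⁻¹ *ᵥ g t)) ≤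
      Real.log (W (t + 1)).det - Real.log (W t).det := by
    intro t
    rw [hstep]
    exact dual_norm_le_log_det_sub (hW t) hη (g t)
  rw [Finset.mul_sum]
  refine (Finset.sum_le_sum fun t _ => h1 t).trans ?_
  rw [Finset.sum_range_sub (fun t => Real.log (W t).det)]
  have hN : (0 : ℝ) < Fintype.card n := by exact_mod_cast Fintype.card_pos
  have h0 : Real.log (W 0).det = Fintype.card n * Real.log w := by
    simp [hWdef, Real.log_pow]
  rcases Nat.eq_zero_or_pos T with rfl | hT
  · simp
  have hγ : 0 ≤ γ := by
    refine le_trans ?_ (hg 0 hT)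
    simpa using dotProduct_star_self_nonneg (g 0)
  set q := 1 + T * (η * γ / (w * Fintype.card n)) with hq
  have hq0 : 0 < q := by positivity
  have htr : (W T).trace ≤ Fintype.card n * (w * q) := by
    have : (W T).trace = w * Fintype.card n + η * ∑ s ∈ Finset.range T, g s ⬝ᵥ g s := by
      simp [hWdef, trace_add, trace_smul, trace_sum, trace_vecMulVec]
    rw [this]
    have h2 : ∑ s ∈ Finset.range T, g s ⬝ᵥ g s ≤ T * γ := by
      refine (Finset.sum_le_sum fun s hs => hg s (Finset.mem_range.1 hs)).trans ?_
      simp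
    have h3 : Fintype.card n * (w * q) = w * Fintype.card n + η * (T * γ) := by
      rw [hq]; field_simp
    rw [h3]
    linarith [mul_le_mul_of_nonneg_left h2 hη.le]
  have h4 := log_det_le_of_trace_le (hW T) (mul_pos hw hq0) htr
  rw [Real.log_mul hw.ne' hq0.ne'] at h4
  rw [h0]
  linarith

end EllipticalPotential

/-! ### Gradient and Hessian of the objective -/

section Objective

variable {d : ℕ}

lemma inner_toEuclideanLin_vecMulVec (w x y : Vec d) :
    ⟪Matrix.toEuclideanLin (Matrix.vecMulVec w w) x, y⟫ = ⟪w, x⟫ * ⟪w, y⟫ := by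
  have : Matrix.toEuclideanLin (Matrix.vecMulVec w w) x = ⟪w, x⟫ • w := by
    ext i
    simp [Matrix.vecMulVec_mulVec, EuclideanSpace.inner_eq_star_dotProduct, dotProduct_comm,
      mul_comm]
  rw [this, inner_smul_left]
  simp

/-- The form `∑ ⟨g_s, x⟩ ⟨g_s, y⟩` of the loss vectors of a history. -/
def histForm (hist : List (Vec d × Vec d)) (x y : Vec d) : ℝ :=
  (hist.map fun p => ⟪p.2, x⟫ * ⟪p.2, y⟫).sum

lemma histForm_self_nonneg (hist : List (Vec d × Vec d)) (x : Vec d) :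
    0 ≤ histForm hist x x := by
  refine List.sum_nonneg fun a ha => ?_
  obtain ⟨p, -, rfl⟩ := List.mem_map.1 ha
  exact mul_self_nonneg _

lemma histForm_append (hist : List (Vec d × Vec d)) (u g x y : Vec d) :
    histForm (hist ++ [(u, g)]) x y = histForm hist x y + ⟪g, x⟫ * ⟪g, y⟫ := by
  simp [histForm]

/-- The Gram matrix `∑ g_s g_sᵀ` of a history. -/
def gramMat (hist : List (Vec d × Vec d)) : Mat d :=
  (hist.map fun p => Matrix.vecMulVec p.2 p.2).sum

lemma gramMat_append (hist : List (Vec d × Vec d)) (u g : Vec d) :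
    gramMat (hist ++ [(u, g)]) = gramMat hist + Matrix.vecMulVec g g := by
  simp [gramMat]

lemma gramMat_posSemidef (hist : List (Vec d × Vec d)) : (gramMat hist).PosSemidef := by
  induction hist with
  | nil => exact Matrix.PosSemidef.zero
  | cons p l ih =>
    have : gramMat (p :: l) = Matrix.vecMulVec p.2 p.2 + gramMat l := by simp [gramMat]
    rw [this]
    exact (posSemidef_vecMulVec_self _).add ih

lemma inner_gramMat (hist : List (Vec d × Vec d)) (x y : Vec d) :
    ⟪Matrix.toEuclideanLin (gramMat hist) x, y⟫ = histForm hist x y := by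
  induction hist with
  | nil => simp [gramMat, histForm]
  | cons p l ih =>
    have h1 : gramMat (p :: l) = Matrix.vecMulVec p.2 p.2 + gramMat l := by simp [gramMat]
    have h2 : histForm (p :: l) x y = ⟪p.2, x⟫ * ⟪p.2, y⟫ + histForm l x y := by simp [histForm]
    rw [h1, h2, map_add, LinearMap.add_apply, inner_add_left, ih, inner_toEuclideanLin_vecMulVec]

variable (R η ν : ℝ)

/-- The gradient of the objective at a point of the open ball. -/
def objGrad (hist : List (Vec d × Vec d)) (x : Vec d) : Vec d :=
  (2 * ν / (R ^ 2 - ‖x‖ ^ 2)) • x + η • (hist.map fun p => ⟪p.2, x - p.1⟫ • p.2).sum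
    + (hist.map Prod.snd).sum

/-- The Hessian of the objective. -/
def hessMat (u : Vec d) (hist : List (Vec d × Vec d)) : Mat d :=
  (2 * ν / (R ^ 2 - ‖u‖ ^ 2)) • (1 : Mat d)
    + (4 * ν / (R ^ 2 - ‖u‖ ^ 2) ^ 2) • Matrix.vecMulVec u u + η • gramMat hist

/-- The Hessian of the objective, as a quadratic form. -/
def hessForm (u : Vec d) (hist : List (Vec d × Vec d)) (x : Vec d) : ℝ :=
  ν * barrierHess R u x + η * histForm hist x x

variable {R η ν}

lemma inner_hessMat (u : Vec d) (hist : List (Vec d × Vec d)) (x y : Vec d) :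
    ⟪Matrix.toEuclideanLin (hessMat R η ν u hist) x, y⟫ =
      ν * (2 / (R ^ 2 - ‖u‖ ^ 2) * ⟪x, y⟫
        + 4 / (R ^ 2 - ‖u‖ ^ 2) ^ 2 * ⟪u, x⟫ * ⟪u, y⟫) + η * histForm hist x y := by
  simp only [hessMat, map_add, map_smul, LinearMap.add_apply, LinearMap.smul_apply, inner_add_left,
    inner_smul_left, inner_gramMat, inner_toEuclideanLin_vecMulVec, conj_trivial,
    Matrix.toLpLin_one, LinearMap.id_apply]
  ring

lemma inner_hessMat_self (u : Vec d) (hist : List (Vec d × Vec d)) (x : Vec d) :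
    ⟪Matrix.toEuclideanLin (hessMat R η ν u hist) x, x⟫ = hessForm R η ν u hist x := by
  rw [inner_hessMat, hessForm, barrierHess, real_inner_self_eq_norm_sq]
  generalize R ^ 2 - ‖u‖ ^ 2 = b
  ring

lemma hessForm_nonneg (hη : 0 ≤ η) (hν : 0 ≤ ν) {u : Vec d} (hu : 0 < R ^ 2 - ‖u‖ ^ 2)
    (hist : List (Vec d × Vec d)) (x : Vec d) : 0 ≤ hessForm R η ν u hist x :=
  add_nonneg (mul_nonneg hν (barrierHess_nonneg hu x)) (mul_nonneg hη (histForm_self_nonneg _ _))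

lemma hessMat_posDef (hη : 0 ≤ η) (hν : 0 < ν) {u : Vec d} (hu : 0 < R ^ 2 - ‖u‖ ^ 2)
    (hist : List (Vec d × Vec d)) : (hessMat R η ν u hist).PosDef :=
  ((Matrix.PosDef.one.smul (by positivity)).add_posSemidef
    ((posSemidef_vecMulVec_self _).smul (by positivity))).add_posSemidef
    ((gramMat_posSemidef _).smul hη)

lemma inner_list_sum (l : List (Vec d)) (x : Vec d) : ⟪l.sum, x⟫ = (l.map fun v => ⟪v, x⟫).sum := by
  induction l with
  | nil => simp
  | cons v l ih => simp [inner_add_left, ih]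

lemma inner_objGrad (hist : List (Vec d × Vec d)) (u x : Vec d) :
    ⟪objGrad R η ν hist u, x⟫ = 2 * ν / (R ^ 2 - ‖u‖ ^ 2) * ⟪u, x⟫
      + η * (hist.map fun p => ⟪p.2, u - p.1⟫ * ⟪p.2, x⟫).sum + ⟪(hist.map Prod.snd).sum, x⟫ := by
  simp only [objGrad, inner_add_left, inner_smul_left, conj_trivial]
  congr 3
  rw [inner_list_sum, List.map_map]
  congr 1
  refine List.map_congr_left fun p _ => ?_
  simp [inner_smul_left]

/-- Expansion of the objective around `u`: the Bregman divergence of the barrier and a quadratic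
form make up the remainder. -/
lemma objective_add (hist : List (Vec d × Vec d)) (u δ : Vec d) :
    objective R η ν hist (u + δ) = objective R η ν hist u + ⟪objGrad R η ν hist u, δ⟫
      + ν * (Real.log (R ^ 2 - ‖u‖ ^ 2) - Real.log (R ^ 2 - ‖u + δ‖ ^ 2)
        - 2 * ⟪u, δ⟫ / (R ^ 2 - ‖u‖ ^ 2)) + η / 2 * histForm hist δ δ := by
  have h : (hist.map fun p => ⟪p.2, u + δ - p.1⟫ ^ 2).sum
      = (hist.map fun p => ⟪p.2, u - p.1⟫ ^ 2).sum
        + 2 * (hist.map fun p => ⟪p.2, u - p.1⟫ * ⟪p.2, δ⟫).sum + histForm hist δ δ := by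
    induction hist with
    | nil => simp [histForm]
    | cons p l ih =>
      have e : u + δ - p.1 = (u - p.1) + δ := by abel
      simp only [List.map_cons, List.sum_cons, histForm, ih, e, inner_add_right] at ih ⊢
      ring
  rw [inner_objGrad, objective, objective, h, inner_add_left, real_inner_comm _ δ]
  ring

/-- Expansion of the gradient around `u`. -/
lemma inner_objGrad_add (hist : List (Vec d × Vec d)) (u δ x : Vec d) :
    ⟪objGrad R η ν hist (u + δ), x⟫
      = ⟪objGrad R η ν hist u + Matrix.toEuclideanLin (hessMat R η ν u hist) δ, x⟫
        + ν * (2 / (R ^ 2 - ‖u + δ‖ ^ 2) * ⟪u + δ, x⟫ - 2 / (R ^ 2 - ‖u‖ ^ 2) * ⟪u, x⟫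
          - (2 / (R ^ 2 - ‖u‖ ^ 2) * ⟪δ, x⟫
            + 4 / (R ^ 2 - ‖u‖ ^ 2) ^ 2 * ⟪u, δ⟫ * ⟪u, x⟫)) := by
  have h : (hist.map fun p => ⟪p.2, u + δ - p.1⟫ * ⟪p.2, x⟫).sum
      = (hist.map fun p => ⟪p.2, u - p.1⟫ * ⟪p.2, x⟫).sum + histForm hist δ x := by
    induction hist with
    | nil => simp [histForm]
    | cons p l ih =>
      have e : u + δ - p.1 = (u - p.1) + δ := by abel
      simp only [List.map_cons, List.sum_cons, histForm, ih, e, inner_add_right] at ih ⊢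
      ring
  rw [inner_add_left (objGrad R η ν hist u), inner_hessMat, inner_objGrad, inner_objGrad, h]
  ring

lemma hasGradientAt_objective (hist : List (Vec d × Vec d)) {u : Vec d}
    (hu : 0 < R ^ 2 - ‖u‖ ^ 2) :
    HasGradientAt (objective R η ν hist) (objGrad R η ν hist u) u := by
  have hq : HasFDerivAt (fun x : Vec d => (hist.map fun p => ⟪p.2, x - p.1⟫ ^ 2).sum)
      (2 • InnerProductSpace.toDual ℝ (Vec d) (hist.map fun p => ⟪p.2, u - p.1⟫ • p.2).sum) u := by
    induction hist with
    | nil => simpa using hasFDerivAt_const (0 : ℝ) u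
    | cons p l ih =>
      have h1 : HasFDerivAt (fun x : Vec d => ⟪p.2, x - p.1⟫)
          (InnerProductSpace.toDual ℝ (Vec d) p.2) u := by
        have := (InnerProductSpace.toDual ℝ (Vec d) p.2).hasFDerivAt.comp u
          ((hasFDerivAt_id u).sub_const p.1)
        simpa [Function.comp_def] using this
      have h2 := (h1.pow 2).add ih
      simp only [List.map_cons, List.sum_cons]
      refine h2.congr_fderiv ?_
      ext x
      simp
      ring
  have hb : HasFDerivAt (fun x : Vec d => Real.log (R ^ 2 - ‖x‖ ^ 2))
      ((R ^ 2 - ‖u‖ ^ 2)⁻¹ • -(2 • innerSL ℝ u : Vec d →L[ℝ] ℝ)) u :=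
    ((hasStrictFDerivAt_norm_sq u).hasFDerivAt.const_sub (R ^ 2)).log hu.ne'
  have hl : HasFDerivAt (fun x : Vec d => ⟪x, (hist.map Prod.snd).sum⟫)
      (InnerProductSpace.toDual ℝ (Vec d) (hist.map Prod.snd).sum) u := by
    have e : (fun x : Vec d => ⟪x, (hist.map Prod.snd).sum⟫)
        = InnerProductSpace.toDual ℝ (Vec d) (hist.map Prod.snd).sum := by
      funext x
      simp only [InnerProductSpace.toDual_apply_apply]
      exact real_inner_comm _ _
    rw [e]
    exact (InnerProductSpace.toDual ℝ (Vec d) (hist.map Prod.snd).sum).hasFDerivAt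
  have h := ((hb.const_mul (-ν)).add (hq.const_mul (η / 2))).add hl
  rw [hasGradientAt_iff_hasFDerivAt]
  refine h.congr_fderiv ?_
  ext x
  simp [objGrad]
  ring

lemma gradient_objective (hist : List (Vec d × Vec d)) {u : Vec d} (hu : 0 < R ^ 2 - ‖u‖ ^ 2) :
    gradient (objective R η ν hist) u = objGrad R η ν hist u :=
  (hasGradientAt_objective hist hu).gradient

lemma objGrad_append (hist : List (Vec d × Vec d)) (u g : Vec d) :
    objGrad R η ν (hist ++ [(u, g)]) u = objGrad R η ν hist u + g := by
  simp [objGrad, add_assoc]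

lemma objective_append (hist : List (Vec d × Vec d)) (u g x : Vec d) :
    objective R η ν (hist ++ [(u, g)]) x
      = objective R η ν hist x + η / 2 * ⟪g, x - u⟫ ^ 2 + ⟪g, x⟫ := by
  simp [objective, inner_add_right, real_inner_comm]
  ring

/-- A point where the dual norm `ρ` of the gradient is small almost minimizes the objective. -/
lemma objective_lower (hη : 0 ≤ η) (hν : 0 < ν) {hist : List (Vec d × Vec d)} {u x : Vec d}
    (hu : 0 < R ^ 2 - ‖u‖ ^ 2) (hx : 0 < R ^ 2 - ‖x‖ ^ 2) {ρ : ℝ} (hρ0 : 0 ≤ ρ)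
    (hρ : ρ ≤ √ν / 10)
    (h : ∀ y, |⟪objGrad R η ν hist u, y⟫| ≤ ρ * √(hessForm R η ν u hist y)) :
    objective R η ν hist u - 3 * ρ ^ 2 ≤ objective R η ν hist x := by
  obtain ⟨δ, rfl⟩ : ∃ δ, x = u + δ := ⟨x - u, by abel⟩
  rw [objective_add]
  have hsν : 0 < √ν := Real.sqrt_pos.2 hν
  have hb0 := barrierHess_nonneg hu δ
  have hf0 := histForm_self_nonneg hist δ
  have hB := barrier_bregman_lower hu hx (θ := ρ / √ν) (by positivity)
    ((div_le_iff₀ hsν).2 (by linarith))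
  have h1 := mul_le_mul_of_nonneg_left hB hν.le
  have hsq : √ν ^ 2 = ν := Real.sq_sqrt hν.le
  have e1 : ν * (ρ / √ν * √(barrierHess R u δ) - 5 / 2 * (ρ / √ν) ^ 2)
      = ρ * (√ν * √(barrierHess R u δ)) - 5 / 2 * ρ ^ 2 := by
    have key : ∀ s X : ℝ, 0 < s →
        s ^ 2 * (ρ / s * X - 5 / 2 * (ρ / s) ^ 2) = ρ * (s * X) - 5 / 2 * ρ ^ 2 := by
      intro s X hs
      field_simp
    have := key (√ν) (√(barrierHess R u δ)) hsν
    rwa [hsq] at this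
  rw [e1, ← Real.sqrt_mul hν.le] at h1
  have h2 : √(hessForm R η ν u hist δ)
      ≤ √(ν * barrierHess R u δ) + √(η * histForm hist δ δ) := by
    unfold hessForm
    have h1 : 0 ≤ ν * barrierHess R u δ := by positivity
    have h2 : 0 ≤ η * histForm hist δ δ := by positivity
    refine Real.sqrt_le_iff.2 ⟨by positivity, ?_⟩
    rw [add_sq, Real.sq_sqrt h1, Real.sq_sqrt h2]
    have := mul_nonneg (Real.sqrt_nonneg (ν * barrierHess R u δ))
      (Real.sqrt_nonneg (η * histForm hist δ δ))
    linarith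
  have h3 : ρ * √(η * histForm hist δ δ) ≤ ρ ^ 2 / 2 + η * histForm hist δ δ / 2 := by
    have := Real.sq_sqrt (by positivity : 0 ≤ η * histForm hist δ δ)
    nlinarith [sq_nonneg (ρ - √(η * histForm hist δ δ))]
  have h4 := (abs_le.1 (h δ)).1
  have h5 := mul_le_mul_of_nonneg_left h2 hρ0
  nlinarith

end Objective

/-! ### One round of Barrier-ONS -/

section OneRound

variable {d : ℕ} {R η ν : ℝ}

/-- The Newton decrement at the iterate `u`, for a history including the current round. -/
def decrement (R η ν : ℝ) (u : Vec d) (hist : List (Vec d × Vec d)) : ℝ :=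
  √⟪objGrad R η ν hist u,
    Matrix.toEuclideanLin (hessMat R η ν u hist)⁻¹ (objGrad R η ν hist u)⟫

/-- The state invariants of Barrier-ONS: the iterate and the expansion point lie in the open ball,
they are close to each other, and the gradient of the objective at the iterate has dual norm at
most `ρ`. -/
structure OnsInvariant (R η ν ρ : ℝ) (st : OnsState d) : Prop where
  gap_u : 0 < R ^ 2 - ‖st.u‖ ^ 2
  gap_z : 0 < R ^ 2 - ‖st.z‖ ^ 2
  close : |‖st.u‖ ^ 2 - ‖st.z‖ ^ 2| ≤ 1 / 2 * (R ^ 2 - ‖st.u‖ ^ 2)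
  residual : ∀ x, |⟪objGrad R η ν st.hist st.u, x⟫| ≤ ρ * √(hessForm R η ν st.u st.hist x)

/-- The matrix `2ν/R² I + η ∑ g_s g_sᵀ`, a lower bound for all Hessians. -/
def baseMat (R η ν : ℝ) (hist : List (Vec d × Vec d)) : Mat d :=
  (2 * ν / R ^ 2) • (1 : Mat d) + η • gramMat hist

/-- The squared dual norm `⟨g, W⁻¹ g⟩` with respect to `W = baseMat`. -/
def dualSq (R η ν : ℝ) (hist : List (Vec d × Vec d)) (g : Vec d) : ℝ :=
  ⟪g, Matrix.toEuclideanLin (baseMat R η ν hist)⁻¹ g⟫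

lemma toEuclideanLin_mul_inv_apply {A : Mat d} (hA : IsUnit A) (x : Vec d) :
    Matrix.toEuclideanLin A (Matrix.toEuclideanLin A⁻¹ x) = x := by
  have h := Matrix.toLpLin_mul_same 2 A A⁻¹
  rw [Matrix.mul_nonsing_inv _ ((Matrix.isUnit_iff_isUnit_det _).1 hA), Matrix.toLpLin_one] at h
  exact (LinearMap.congr_fun h x).symm

lemma toEuclideanLin_inv_mul_apply {A : Mat d} (hA : IsUnit A) (x : Vec d) :
    Matrix.toEuclideanLin A⁻¹ (Matrix.toEuclideanLin A x) = x := by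
  have h := Matrix.toLpLin_mul_same 2 A⁻¹ A
  rw [Matrix.nonsing_inv_mul _ ((Matrix.isUnit_iff_isUnit_det _).1 hA), Matrix.toLpLin_one] at h
  exact (LinearMap.congr_fun h x).symm

lemma toEuclideanLin_isSymmetric {A : Mat d} (hA : A.PosDef) :
    (Matrix.toEuclideanLin A).IsSymmetric :=
  (Matrix.isPositive_toEuclideanLin_iff.2 hA.posSemidef).isSymmetric

lemma inner_toEuclideanLin_self_nonneg {A : Mat d} (hA : A.PosDef) (x : Vec d) :
    0 ≤ ⟪Matrix.toEuclideanLin A x, x⟫ := by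
  simpa using (Matrix.isPositive_toEuclideanLin_iff.2 hA.posSemidef).re_inner_nonneg_left x

lemma baseMat_posDef (hR : 0 < R) (hη : 0 ≤ η) (hν : 0 < ν) (hist : List (Vec d × Vec d)) :
    (baseMat R η ν hist).PosDef :=
  (Matrix.PosDef.one.smul (by positivity)).add_posSemidef ((gramMat_posSemidef _).smul hη)

lemma inner_baseMat_self (hist : List (Vec d × Vec d)) (x : Vec d) :
    ⟪Matrix.toEuclideanLin (baseMat R η ν hist) x, x⟫
      = 2 * ν / R ^ 2 * ‖x‖ ^ 2 + η * histForm hist x x := by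
  simp only [baseMat, map_add, map_smul, LinearMap.add_apply, LinearMap.smul_apply, inner_add_left,
    inner_smul_left, inner_gramMat, conj_trivial, Matrix.toLpLin_one, LinearMap.id_apply,
    real_inner_self_eq_norm_sq]

lemma baseMat_le_hessForm (hν : 0 < ν) {u : Vec d} (hu : 0 < R ^ 2 - ‖u‖ ^ 2)
    (hist : List (Vec d × Vec d)) (x : Vec d) :
    ⟪Matrix.toEuclideanLin (baseMat R η ν hist) x, x⟫ ≤ hessForm R η ν u hist x := by
  rw [inner_baseMat_self, hessForm, barrierHess]
  have h1 : 2 * ν / R ^ 2 * ‖x‖ ^ 2 ≤ 2 * ν / (R ^ 2 - ‖u‖ ^ 2) * ‖x‖ ^ 2 := by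
    apply mul_le_mul_of_nonneg_right _ (sq_nonneg _)
    exact div_le_div_of_nonneg_left (by positivity) hu (by linarith [sq_nonneg ‖u‖])
  have h2 : 0 ≤ ν * (2 * ⟪u, x⟫ / (R ^ 2 - ‖u‖ ^ 2)) ^ 2 := by positivity
  have h3 : ν * (2 / (R ^ 2 - ‖u‖ ^ 2) * ‖x‖ ^ 2) = 2 * ν / (R ^ 2 - ‖u‖ ^ 2) * ‖x‖ ^ 2 := by ring
  linarith

lemma dualSq_nonneg (hR : 0 < R) (hη : 0 ≤ η) (hν : 0 < ν) (hist : List (Vec d × Vec d))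
    (g : Vec d) : 0 ≤ dualSq R η ν hist g := by
  rw [dualSq, real_inner_comm]
  exact inner_toEuclideanLin_self_nonneg (baseMat_posDef hR hη hν hist).inv g

lemma abs_inner_le_dualSq (hR : 0 < R) (hη : 0 ≤ η) (hν : 0 < ν) {u : Vec d}
    (hu : 0 < R ^ 2 - ‖u‖ ^ 2) (hist : List (Vec d × Vec d)) (g x : Vec d) :
    |⟪g, x⟫| ≤ √(dualSq R η ν hist g) * √(hessForm R η ν u hist x) := by
  have hW := baseMat_posDef hR hη hν hist
  have h := abs_inner_map_le (toEuclideanLin_isSymmetric hW) (inner_toEuclideanLin_self_nonneg hW)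
    (Matrix.toEuclideanLin (baseMat R η ν hist)⁻¹ g) x
  rw [toEuclideanLin_mul_inv_apply hW.isUnit] at h
  exact h.trans (mul_le_mul_of_nonneg_left
    (Real.sqrt_le_sqrt (baseMat_le_hessForm hν hu hist x)) (Real.sqrt_nonneg _))

/-- A crude bound for the dual norm, from the isotropic part of `baseMat`. -/
lemma dualSq_le (hR : 0 < R) (hη : 0 ≤ η) (hν : 0 < ν) (hist : List (Vec d × Vec d)) (g : Vec d) :
    dualSq R η ν hist g ≤ ‖g‖ ^ 2 * (R ^ 2 / (2 * ν)) := by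
  have hW := baseMat_posDef hR hη hν hist
  have h1 := inner_baseMat_self (R := R) (η := η) (ν := ν) hist
    (Matrix.toEuclideanLin (baseMat R η ν hist)⁻¹ g)
  rw [toEuclideanLin_mul_inv_apply hW.isUnit] at h1
  change dualSq R η ν hist g = _ at h1
  have h2 : dualSq R η ν hist g ≤ ‖g‖ * ‖Matrix.toEuclideanLin (baseMat R η ν hist)⁻¹ g‖ :=
    real_inner_le_norm _ _
  have h3 := mul_nonneg hη
    (histForm_self_nonneg hist (Matrix.toEuclideanLin (baseMat R η ν hist)⁻¹ g))
  have h0 := dualSq_nonneg hR hη hν hist g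
  set y := ‖Matrix.toEuclideanLin (baseMat R η ν hist)⁻¹ g‖
  set D := dualSq R η ν hist g
  have h4 : 2 * ν / R ^ 2 * y ^ 2 ≤ D := by linarith
  have h5 : D ^ 2 ≤ ‖g‖ ^ 2 * y ^ 2 := by
    rw [← mul_pow]; exact pow_le_pow_left₀ h0 h2 2
  have h6 : y ^ 2 ≤ D * (R ^ 2 / (2 * ν)) := by
    have : y ^ 2 = (2 * ν / R ^ 2 * y ^ 2) * (R ^ 2 / (2 * ν)) := by field_simp
    rw [this]
    exact mul_le_mul_of_nonneg_right h4 (by positivity)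
  rcases h0.eq_or_lt with h | h
  · rw [← h]; positivity
  · have h7 : D * D ≤ D * (‖g‖ ^ 2 * (R ^ 2 / (2 * ν))) := by
      nlinarith [mul_le_mul_of_nonneg_left h6 (sq_nonneg ‖g‖)]
    exact le_of_mul_le_mul_left h7 h

/-- The Newton decrement is at most the previous residual plus the dual norm of the new loss
vector. -/
lemma decrement_le (hR : 0 < R) (hη : 0 ≤ η) (hν : 0 < ν) {ρ : ℝ} (hρ : 0 ≤ ρ) {st : OnsState d}
    (h : OnsInvariant R η ν ρ st) (g : Vec d) :
    decrement R η ν st.u (st.hist ++ [(st.u, g)])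
      ≤ ρ + √(dualSq R η ν (st.hist ++ [(st.u, g)]) g) := by
  set hist' := st.hist ++ [(st.u, g)] with hh
  have hA := hessMat_posDef hη hν h.gap_u hist'
  set n := objGrad R η ν hist' st.u with hn
  set e := Matrix.toEuclideanLin (hessMat R η ν st.u hist')⁻¹ n with he
  have hQ : hessForm R η ν st.u hist' e = ⟪n, e⟫ := by
    rw [← inner_hessMat_self, he, toEuclideanLin_mul_inv_apply hA.isUnit]
  have hnn : 0 ≤ ⟪n, e⟫ := by
    rw [← hQ]; exact hessForm_nonneg hη hν.le h.gap_u hist' e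
  have h1 : ⟪n, e⟫ = ⟪objGrad R η ν st.hist st.u, e⟫ + ⟪g, e⟫ := by
    rw [← inner_add_left, hn, hh, objGrad_append]
  have h2 : |⟪objGrad R η ν st.hist st.u, e⟫| ≤ ρ * √⟪n, e⟫ := by
    refine (h.residual e).trans (mul_le_mul_of_nonneg_left (Real.sqrt_le_sqrt ?_) hρ)
    rw [← hQ, hessForm, hessForm, hh, histForm_append]
    nlinarith [mul_nonneg hη (mul_self_nonneg ⟪g, e⟫)]
  have h3 := abs_inner_le_dualSq hR hη hν h.gap_u hist' g e
  rw [hQ] at h3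
  change √⟪n, e⟫ ≤ _
  have h4 := Real.mul_self_sqrt hnn
  have h5 : √⟪n, e⟫ * √⟪n, e⟫ ≤ (ρ + √(dualSq R η ν hist' g)) * √⟪n, e⟫ := by
    rw [h4]
    nlinarith [le_abs_self ⟪objGrad R η ν st.hist st.u, e⟫, le_abs_self ⟪g, e⟫]
  rcases (Real.sqrt_nonneg ⟪n, e⟫).eq_or_lt with h6 | h6
  · rw [← h6]; positivity
  · exact le_of_mul_le_mul_right h5 h6

lemma sigmaMat_eq (u z : Vec d) (hist : List (Vec d × Vec d)) :
    sigmaMat R η ν u z hist = (hessMat R η ν u hist + gammaOf R ν u z • (1 : Mat d))⁻¹ := by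
  rw [sigmaMat, hessMat, gammaOf, gramMat, sub_smul]
  congr 1
  abel

lemma toEuclideanLin_taylorMat (m : ℕ) (u z : Vec d) (hist : List (Vec d × Vec d)) (n : Vec d) :
    Matrix.toEuclideanLin (taylorMat R η ν m u z hist) n
      = ∑ k ∈ Finset.range (m + 1), gammaOf R ν u z ^ k •
        (Matrix.toEuclideanLin (sigmaMat R η ν u z hist) ^ (k + 1)) n := by
  rw [taylorMat, map_sum, LinearMap.sum_apply]
  refine Finset.sum_congr rfl fun k _ => ?_
  rw [map_smul, LinearMap.smul_apply, Matrix.toLpLin_pow]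

/-- As long as the expansion point `z` passes the test, `γ` lies between `-1/3` and `1` times the
lower bound `2ν/(R² - ‖u‖²)` of the spectrum of the Hessian at `u`, the range in which the Neumann
series converges. -/
lemma gamma_bounds (hν : 0 < ν) {u z : Vec d} (hu : 0 < R ^ 2 - ‖u‖ ^ 2)
    (hz : 0 < R ^ 2 - ‖z‖ ^ 2) (hc : |‖u‖ ^ 2 - ‖z‖ ^ 2| ≤ 1 / 2 * (R ^ 2 - ‖u‖ ^ 2)) :
    gammaOf R ν u z ≤ 2 * ν / (R ^ 2 - ‖u‖ ^ 2) ∧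
      -3 * gammaOf R ν u z ≤ 2 * ν / (R ^ 2 - ‖u‖ ^ 2) := by
  rw [abs_le] at hc
  have hbz : R ^ 2 - ‖z‖ ^ 2 = (R ^ 2 - ‖u‖ ^ 2) + (‖u‖ ^ 2 - ‖z‖ ^ 2) := by ring
  unfold gammaOf
  rw [hbz] at hz ⊢
  generalize R ^ 2 - ‖u‖ ^ 2 = b at *
  generalize ‖u‖ ^ 2 - ‖z‖ ^ 2 = e at *
  constructor
  · have : 2 * ν / (b + e) ≤ 2 * ν / (b / 2) :=
      div_le_div_of_nonneg_left (by positivity) (by positivity) (by linarith)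
    have h2 : 2 * ν / (b / 2) = 2 * (2 * ν / b) := by field_simp
    linarith
  · have : 2 * ν / (3 / 2 * b) ≤ 2 * ν / (b + e) :=
      div_le_div_of_nonneg_left (by positivity) hz (by linarith)
    have h2 : 2 * ν / (3 / 2 * b) = 2 / 3 * (2 * ν / b) := by field_simp
    linarith

/-- One round of Barrier-ONS with a small Newton decrement: the iterate stays in the ball, the new
residual is at most a fifth of the decrement, and the objective changes by at most a multiple of
the squared decrement. -/
lemma ons_step (hη : 0 ≤ η) (hν : 0 < ν) {ρ : ℝ} {st : OnsState d} (h : OnsInvariant R η ν ρ st)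
    (g : Vec d) {m : ℕ} (hm : 4 ≤ m) {lam : ℝ}
    (hlam : lam = decrement R η ν st.u (st.hist ++ [(st.u, g)])) (hsmall : lam ≤ √ν / 11) :
    OnsInvariant R η ν (lam / 5) (onsUpdate R η ν (1 / 2) m st g) ∧
    objective R η ν st.hist st.u + ⟪g, st.u⟫ - 33 / 32 * lam ^ 2
      ≤ objective R η ν (st.hist ++ [(st.u, g)]) (onsUpdate R η ν (1 / 2) m st g).u ∧
    |Real.log (R ^ 2 - ‖(onsUpdate R η ν (1 / 2) m st g).u‖ ^ 2) - Real.log (R ^ 2 - ‖st.u‖ ^ 2)|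
      ≤ 7 / 5 * (lam / √ν) := by
  set hist' := st.hist ++ [(st.u, g)] with hh
  have hb := h.gap_u
  have hA := hessMat_posDef hη hν hb hist'
  set Am := Matrix.toEuclideanLin (hessMat R η ν st.u hist') with hAm
  set n := objGrad R η ν hist' st.u with hn
  set e := Matrix.toEuclideanLin (hessMat R η ν st.u hist')⁻¹ n with he
  set γ := gammaOf R ν st.u st.z with hγ
  set S := Matrix.toEuclideanLin (sigmaMat R η ν st.u st.z hist') with hS
  set δ := -∑ k ∈ Finset.range (m + 1), γ ^ k • (S ^ (k + 1)) n with hδ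
  have hlam0 : 0 ≤ lam := hlam ▸ Real.sqrt_nonneg _
  have hu' : (onsUpdate R η ν (1 / 2) m st g).u = st.u + δ := by
    simp only [onsUpdate]
    rw [gradient_objective _ hb, toEuclideanLin_taylorMat, sub_eq_add_neg]
  have hist_eq : (onsUpdate R η ν (1 / 2) m st g).hist = hist' := rfl
  have hQ : ∀ x, ⟪Am x, x⟫ = hessForm R η ν st.u hist' x := inner_hessMat_self st.u hist'
  obtain ⟨hγ1, hγ2⟩ := gamma_bounds hν hb h.gap_z h.close
  -- the matrix inverted by `sigmaMat` is positive definite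
  have hM : (hessMat R η ν st.u hist' + γ • (1 : Mat d)).PosDef := by
    have : hessMat R η ν st.u hist' + γ • (1 : Mat d)
        = (2 * ν / (R ^ 2 - ‖st.z‖ ^ 2)) • (1 : Mat d)
          + (4 * ν / (R ^ 2 - ‖st.u‖ ^ 2) ^ 2) • Matrix.vecMulVec st.u st.u
          + η • gramMat hist' := by
      rw [hessMat, hγ, gammaOf, sub_smul]
      abel
    rw [this]
    have hz := h.gap_z
    exact ((Matrix.PosDef.one.smul (by positivity)).add_posSemidef
      ((posSemidef_vecMulVec_self _).smul (by positivity))).add_posSemidef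
      ((gramMat_posSemidef _).smul hη)
  have hS1 : ∀ x, Am (S x) + γ • S x = x := by
    intro x
    have := toEuclideanLin_mul_inv_apply hM.isUnit x
    rw [← sigmaMat_eq] at this
    simpa only [map_add, map_smul, LinearMap.add_apply, LinearMap.smul_apply, Matrix.toLpLin_one,
      LinearMap.id_apply] using this
  have hS2 : ∀ x, S (Am x + γ • x) = x := by
    intro x
    have := toEuclideanLin_inv_mul_apply hM.isUnit x
    rw [← sigmaMat_eq] at this
    simpa only [map_add, map_smul, LinearMap.add_apply, LinearMap.smul_apply, Matrix.toLpLin_one,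
      LinearMap.id_apply] using this
  have hlow : ∀ x, 2 * ν / (R ^ 2 - ‖st.u‖ ^ 2) * ‖x‖ ^ 2 ≤ ⟪Am x, x⟫ := by
    intro x
    rw [hQ, hessForm, barrierHess]
    have h1 := mul_nonneg hη (histForm_self_nonneg hist' x)
    have h2 : 0 ≤ ν * (2 * ⟪st.u, x⟫ / (R ^ 2 - ‖st.u‖ ^ 2)) ^ 2 := by positivity
    have h3 : ν * (2 / (R ^ 2 - ‖st.u‖ ^ 2) * ‖x‖ ^ 2)
        = 2 * ν / (R ^ 2 - ‖st.u‖ ^ 2) * ‖x‖ ^ 2 := by ring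
    linarith
  obtain ⟨hs1, hs2, hs3⟩ := neumann_step (toEuclideanLin_isSymmetric hA) (by positivity) hlow hγ1
    hγ2 hS1 hS2 (toEuclideanLin_mul_inv_apply hA.isUnit n) (by omega : 5 ≤ m + 1) hδ
  have hlam' : √⟪n, e⟫ = lam := hlam.symm
  have hne : ⟪n, e⟫ = lam ^ 2 := by
    rw [← hlam', Real.sq_sqrt]
    have := hessForm_nonneg hη hν.le hb hist' e
    rwa [← hQ, hAm, he, toEuclideanLin_mul_inv_apply hA.isUnit] at this
  rw [hlam', hQ] at hs1
  rw [hne] at hs2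
  rw [hlam'] at hs3
  -- the local norm of the step
  have hsν : 0 < √ν := Real.sqrt_pos.2 hν
  have hsq : √ν ^ 2 = ν := Real.sq_sqrt hν.le
  set s := 33 / 32 * (lam / √ν) with hs
  have hlν : lam / √ν ≤ 1 / 11 := by rw [div_le_iff₀ hsν]; linarith
  have hs0 : 0 ≤ s := by positivity
  have hsle : s ≤ 3 / 32 := by linarith
  have hBs : barrierHess R st.u δ ≤ s ^ 2 := by
    have h1 : hessForm R η ν st.u hist' δ ≤ (33 / 32 * lam) ^ 2 :=
      (Real.sqrt_le_left (by positivity)).1 hs1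
    have h2 := mul_nonneg hη (histForm_self_nonneg hist' δ)
    unfold hessForm at h1
    have h3 : s ^ 2 = (33 / 32 * lam) ^ 2 / ν := by rw [hs, mul_pow, div_pow lam, hsq]; ring
    rw [h3, le_div_iff₀ hν]
    linarith
  have hlog := abs_log_gap_le hb hs0 (by linarith) hBs
  have hgap' : 0 < R ^ 2 - ‖st.u + δ‖ ^ 2 := by
    have hy := abs_le.1 (abs_gapDecrease_le hb hs0 (by linarith) hBs)
    rw [gap_add_eq hb]
    exact mul_pos hb (by linarith [hy.2])
  have hcomp := barrierHess_le_add hb hs0 (by linarith) hBs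
  have hrem := sq_barrier_remainder_le hb hs0 (by linarith) hBs
  have hres : ∀ x, |⟪objGrad R η ν hist' (st.u + δ), x⟫|
      ≤ lam / 5 * √(hessForm R η ν (st.u + δ) hist' x) := by
    intro x
    have hB0 := barrierHess_nonneg hb x
    have hF0 := mul_nonneg hη (histForm_self_nonneg hist' x)
    rw [inner_objGrad_add]
    have h1 := hs3 x
    rw [hQ] at h1
    have h2 := Real.abs_le_sqrt (hrem x)
    rw [Real.sqrt_mul (by positivity), Real.sqrt_sq (by positivity)] at h2
    have h3 : √(hessForm R η ν st.u hist' x)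
        ≤ 123 / 100 * √(hessForm R η ν (st.u + δ) hist' x) := by
      refine Real.sqrt_le_iff.2 ⟨by positivity, ?_⟩
      rw [mul_pow, Real.sq_sqrt (hessForm_nonneg hη hν.le hgap' hist' x), hessForm, hessForm]
      linarith [mul_le_mul_of_nonneg_left (hcomp x) hν.le]
    have h4 : √ν * √(barrierHess R st.u x) ≤ √(hessForm R η ν st.u hist' x) := by
      rw [← Real.sqrt_mul hν.le]
      exact Real.sqrt_le_sqrt (by rw [hessForm]; linarith)
    -- `ν s² = (33/32) s (√ν λ) ≤ (33/32) (3/32) √ν λ`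
    have h5 : ν * (128 / 100 * s ^ 2 * √(barrierHess R st.u x))
        ≤ 128 / 100 * (3 / 32) * (33 / 32) * lam * √(hessForm R η ν st.u hist' x) := by
      have e1 : ν * (128 / 100 * s ^ 2 * √(barrierHess R st.u x))
          = 128 / 100 * s * (√ν * s) * (√ν * √(barrierHess R st.u x)) := by
        nth_rewrite 1 [← hsq]; ring
      have e2 : √ν * s = 33 / 32 * lam := by rw [hs]; field_simp
      rw [e1, e2]
      have h6 : 128 / 100 * s * (33 / 32 * lam) ≤ 128 / 100 * (3 / 32) * (33 / 32) * lam := by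
        nlinarith
      exact mul_le_mul h6 h4 (by positivity) (by positivity)
    refine (abs_add_le _ _).trans ?_
    rw [abs_mul, abs_of_pos hν]
    have h7 := mul_le_mul_of_nonneg_left h2 hν.le
    have h8 := mul_le_mul_of_nonneg_left h3 hlam0
    have h9 : 0 ≤ lam * √(hessForm R η ν (st.u + δ) hist' x) := by positivity
    linarith
  refine ⟨⟨?_, ?_, ?_, ?_⟩, ?_, ?_⟩
  · rw [hu']; exact hgap'
  · by_cases hk : |‖(onsUpdate R η ν (1 / 2) m st g).u‖ ^ 2 - ‖st.z‖ ^ 2|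
        ≤ 1 / 2 * (R ^ 2 - ‖(onsUpdate R η ν (1 / 2) m st g).u‖ ^ 2)
    · have : (onsUpdate R η ν (1 / 2) m st g).z = st.z := if_pos hk
      rw [this]; exact h.gap_z
    · have : (onsUpdate R η ν (1 / 2) m st g).z = (onsUpdate R η ν (1 / 2) m st g).u := if_neg hk
      rw [this, hu']; exact hgap'
  · by_cases hk : |‖(onsUpdate R η ν (1 / 2) m st g).u‖ ^ 2 - ‖st.z‖ ^ 2|
        ≤ 1 / 2 * (R ^ 2 - ‖(onsUpdate R η ν (1 / 2) m st g).u‖ ^ 2)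
    · have : (onsUpdate R η ν (1 / 2) m st g).z = st.z := if_pos hk
      rw [this]; exact hk
    · have : (onsUpdate R η ν (1 / 2) m st g).z = (onsUpdate R η ν (1 / 2) m st g).u := if_neg hk
      rw [this, hu', sub_self, abs_zero]; positivity
  · rw [hu', hist_eq]; exact hres
  · rw [hu', objective_add]
    have hconv := barrier_bregman_lower hb hgap' (le_refl (0 : ℝ)) (by norm_num)
    have h1 : objective R η ν hist' st.u = objective R η ν st.hist st.u + ⟪g, st.u⟫ := by
      rw [hh, objective_append, sub_self]; simp
    have h2 := histForm_self_nonneg hist' δ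
    have h3 : 0 ≤ ν * (Real.log (R ^ 2 - ‖st.u‖ ^ 2) - Real.log (R ^ 2 - ‖st.u + δ‖ ^ 2)
        - 2 * ⟪st.u, δ⟫ / (R ^ 2 - ‖st.u‖ ^ 2)) := mul_nonneg hν.le (by simpa using hconv)
    have h4 : 0 ≤ η / 2 * histForm hist' δ δ := by positivity
    rw [h1]
    linarith
  · rw [hu']
    refine hlog.trans ?_
    have : 0 ≤ lam / √ν := by positivity
    linarith

end OneRound

/-! ### Regret and number of expansion points of Barrier-ONS -/

section Sequence

variable {d : ℕ}

/-- The states of Barrier-ONS, with `c = 1/2`, on a sequence of loss vectors. -/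
def onsSeq (R η ν : ℝ) (m : ℕ) (g : ℕ → Vec d) : ℕ → OnsState d
  | 0 => ⟨0, 0, []⟩
  | t + 1 => onsUpdate R η ν (1 / 2) m (onsSeq R η ν m g t) (g t)

/-- The Newton decrement in round `t`. -/
def decrementSeq (R η ν : ℝ) (m : ℕ) (g : ℕ → Vec d) (t : ℕ) : ℝ :=
  decrement R η ν (onsSeq R η ν m g t).u (onsSeq R η ν m g (t + 1)).hist

/-- The bound for the residual at the beginning of round `t`. -/
def residualSeq (R η ν : ℝ) (m : ℕ) (g : ℕ → Vec d) : ℕ → ℝ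
  | 0 => 0
  | t + 1 => decrementSeq R η ν m g t / 5

/-- The squared dual norm of the loss vector of round `t`. -/
def dualSqSeq (R η ν : ℝ) (m : ℕ) (g : ℕ → Vec d) (t : ℕ) : ℝ :=
  dualSq R η ν (onsSeq R η ν m g (t + 1)).hist (g t)

/-- The expansion point is replaced at the end of round `t`. -/
def Switches (R η ν : ℝ) (m : ℕ) (g : ℕ → Vec d) (t : ℕ) : Prop :=
  ¬ |‖(onsSeq R η ν m g (t + 1)).u‖ ^ 2 - ‖(onsSeq R η ν m g t).z‖ ^ 2|
    ≤ 1 / 2 * (R ^ 2 - ‖(onsSeq R η ν m g (t + 1)).u‖ ^ 2)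

open Classical in
/-- The number of replacements of the expansion point in the first `n` rounds. -/
def switchCount (R η ν : ℝ) (m : ℕ) (g : ℕ → Vec d) (n : ℕ) : ℕ :=
  ((Finset.range n).filter (Switches R η ν m g)).card

variable {R η ν : ℝ} {m : ℕ} {g : ℕ → Vec d}

lemma onsSeq_hist_succ (t : ℕ) : (onsSeq R η ν m g (t + 1)).hist
    = (onsSeq R η ν m g t).hist ++ [((onsSeq R η ν m g t).u, g t)] := rfl

lemma onsSeq_z_of_switches {t : ℕ} (h : Switches R η ν m g t) :
    (onsSeq R η ν m g (t + 1)).z = (onsSeq R η ν m g (t + 1)).u := if_neg h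

lemma onsSeq_z_of_not_switches {t : ℕ} (h : ¬ Switches R η ν m g t) :
    (onsSeq R η ν m g (t + 1)).z = (onsSeq R η ν m g t).z := if_pos (not_not.1 h)

lemma switchCount_succ_of_switches {n : ℕ} (h : Switches R η ν m g n) :
    switchCount R η ν m g (n + 1) = switchCount R η ν m g n + 1 := by
  simp [switchCount, Finset.range_add_one, Finset.filter_insert, h]

lemma switchCount_succ_of_not_switches {n : ℕ} (h : ¬ Switches R η ν m g n) :
    switchCount R η ν m g (n + 1) = switchCount R η ν m g n := by
  simp [switchCount, Finset.range_add_one, Finset.filter_insert, h]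

open Classical in
lemma switchCount_le (n : ℕ) : switchCount R η ν m g n ≤ n :=
  (Finset.card_filter_le _ _).trans (Finset.card_range n).le

lemma decrementSeq_nonneg (t : ℕ) : 0 ≤ decrementSeq R η ν m g t := Real.sqrt_nonneg _

lemma residualSeq_nonneg : ∀ t, 0 ≤ residualSeq R η ν m g t
  | 0 => le_rfl
  | t + 1 => by have := decrementSeq_nonneg (R := R) (η := η) (ν := ν) (m := m) (g := g) t
                simp only [residualSeq]; positivity

/-- The invariants hold throughout, and all Newton decrements are small. -/
lemma onsSeq_invariant (hR : 0 < R) (hη : 0 ≤ η) (hν : 0 < ν) (hm : 4 ≤ m) {T : ℕ}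
    (hg : ∀ t < T, ‖g t‖ * R ≤ ν / 10) :
    ∀ t ≤ T, OnsInvariant R η ν (residualSeq R η ν m g t) (onsSeq R η ν m g t) ∧
      residualSeq R η ν m g t ≤ √ν / 55 ∧ (t < T →
        decrementSeq R η ν m g t ≤ residualSeq R η ν m g t + √(dualSqSeq R η ν m g t) ∧
        decrementSeq R η ν m g t ≤ √ν / 11) := by
  have hsν : 0 < √ν := Real.sqrt_pos.2 hν
  have hdec : ∀ t < T, OnsInvariant R η ν (residualSeq R η ν m g t) (onsSeq R η ν m g t) →
      residualSeq R η ν m g t ≤ √ν / 55 →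
        decrementSeq R η ν m g t ≤ residualSeq R η ν m g t + √(dualSqSeq R η ν m g t) ∧
        decrementSeq R η ν m g t ≤ √ν / 11 := by
    intro t ht hinv hres
    have h1 : decrementSeq R η ν m g t ≤ residualSeq R η ν m g t + √(dualSqSeq R η ν m g t) :=
      decrement_le hR hη hν (residualSeq_nonneg t) hinv (g t)
    refine ⟨h1, ?_⟩
    have h2 : √(dualSqSeq R η ν m g t) ≤ 7072 / 100000 * √ν := by
      refine Real.sqrt_le_iff.2 ⟨by positivity, ?_⟩
      rw [mul_pow, Real.sq_sqrt hν.le]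
      refine (dualSq_le hR hη hν _ (g t)).trans ?_
      have h3 : (‖g t‖ * R) ^ 2 ≤ (ν / 10) ^ 2 :=
        pow_le_pow_left₀ (by positivity) (hg t ht) 2
      have h4 : ‖g t‖ ^ 2 * (R ^ 2 / (2 * ν)) = (‖g t‖ * R) ^ 2 / (2 * ν) := by ring
      rw [h4, div_le_iff₀ (by positivity)]
      nlinarith [sq_nonneg ν]
    linarith
  intro t
  induction t with
  | zero =>
    intro _
    have hinv : OnsInvariant R η ν (residualSeq R η ν m g 0) (onsSeq R η ν m g 0) := by
      refine ⟨?_, ?_, ?_, ?_⟩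
      · simpa [onsSeq] using pow_pos hR 2
      · simpa [onsSeq] using pow_pos hR 2
      · simpa [onsSeq] using sq_nonneg R
      · intro x
        simp [onsSeq, objGrad, residualSeq]
    have hres : residualSeq R η ν m g 0 ≤ √ν / 55 := by simp only [residualSeq]; positivity
    exact ⟨hinv, hres, fun ht => hdec 0 ht hinv hres⟩
  | succ t ih =>
    intro ht
    obtain ⟨h1, -, h3⟩ := ih (by omega)
    obtain ⟨-, h4⟩ := h3 (by omega)
    have hinv := (ons_step hη hν h1 (g t) hm rfl h4).1
    have hres : residualSeq R η ν m g (t + 1) ≤ √ν / 55 := by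
      simp only [residualSeq]; linarith
    exact ⟨hinv, hres, fun ht' => hdec (t + 1) ht' hinv hres⟩

/-- Each residual is a fifth of the preceding decrement, and the first one vanishes. -/
lemma sum_residualSeq_sq_le (n : ℕ) :
    ∑ t ∈ Finset.range n, residualSeq R η ν m g t ^ 2
      ≤ (∑ t ∈ Finset.range n, decrementSeq R η ν m g t ^ 2) / 25 := by
  have h : ∀ n, ∑ t ∈ Finset.range (n + 1), residualSeq R η ν m g t ^ 2
      = (∑ t ∈ Finset.range n, decrementSeq R η ν m g t ^ 2) / 25 := by
    intro n
    rw [Finset.sum_range_succ', Finset.sum_div]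
    simp only [residualSeq, div_pow]
    norm_num
  cases n with
  | zero => simp
  | succ n =>
    rw [h, Finset.sum_range_succ]
    linarith [sq_nonneg (decrementSeq R η ν m g n)]

/-- The decrements are summable against the dual norms of the loss vectors, because the residuals
form a geometric series. -/
lemma sum_decrementSeq_sq_le (hR : 0 < R) (hη : 0 ≤ η) (hν : 0 < ν) (hm : 4 ≤ m) {T : ℕ}
    (hg : ∀ t < T, ‖g t‖ * R ≤ ν / 10) :
    ∑ t ∈ Finset.range T, decrementSeq R η ν m g t ^ 2
      ≤ 25 / 16 * ∑ t ∈ Finset.range T, dualSqSeq R η ν m g t := by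
  have h1 : ∀ t ∈ Finset.range T, decrementSeq R η ν m g t ^ 2
      ≤ 5 * residualSeq R η ν m g t ^ 2 + 5 / 4 * dualSqSeq R η ν m g t := by
    intro t ht
    rw [Finset.mem_range] at ht
    have h := ((onsSeq_invariant hR hη hν hm hg t ht.le).2.2 ht).1
    have h0 := decrementSeq_nonneg (R := R) (η := η) (ν := ν) (m := m) (g := g) t
    have h2 : √(dualSqSeq R η ν m g t) ^ 2 = dualSqSeq R η ν m g t :=
      Real.sq_sqrt (dualSq_nonneg hR hη hν _ _)
    have h3 := pow_le_pow_left₀ h0 h 2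
    nlinarith [sq_nonneg (4 * residualSeq R η ν m g t - √(dualSqSeq R η ν m g t))]
  have h2 := Finset.sum_le_sum h1
  rw [Finset.sum_add_distrib, ← Finset.mul_sum, ← Finset.mul_sum] at h2
  have h3 := sum_residualSeq_sq_le (R := R) (η := η) (ν := ν) (m := m) (g := g) T
  linarith

lemma gramMat_onsSeq (t : ℕ) : gramMat (onsSeq R η ν m g t).hist
    = ∑ s ∈ Finset.range t, Matrix.vecMulVec (g s).ofLp (g s).ofLp := by
  induction t with
  | zero => simp [onsSeq, gramMat]
  | succ t ih => rw [onsSeq_hist_succ, gramMat_append, ih, Finset.sum_range_succ]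

lemma sum_dualSqSeq_le (hd : 1 ≤ d) (hR : 0 < R) (hη : 0 < η) (hν : 0 < ν) {T : ℕ} {Γ : ℝ}
    (hg : ∀ t < T, ‖g t‖ ≤ Γ) :
    η * ∑ t ∈ Finset.range T, dualSqSeq R η ν m g t
      ≤ d * Real.log (1 + T * (η * Γ ^ 2 / (2 * ν / R ^ 2 * d))) := by
  have : Nonempty (Fin d) := ⟨⟨0, hd⟩⟩
  have h := sum_dual_norm_le (n := Fin d) (w := 2 * ν / R ^ 2) (γ := Γ ^ 2) (by positivity) hη
    (fun t => (g t).ofLp) T (by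
      intro t ht
      have h1 : (g t).ofLp ⬝ᵥ (g t).ofLp = ‖g t‖ ^ 2 := by
        rw [← real_inner_self_eq_norm_sq, EuclideanSpace.inner_eq_star_dotProduct]
        simp
      rw [h1]
      exact pow_le_pow_left₀ (norm_nonneg _) (hg t ht) 2)
  rw [Fintype.card_fin] at h
  refine le_trans (le_of_eq ?_) h
  congr 1
  refine Finset.sum_congr rfl fun t _ => ?_
  rw [dualSqSeq, dualSq, baseMat, gramMat_onsSeq, EuclideanSpace.inner_eq_star_dotProduct,
    dotProduct_comm]
  rfl

lemma objective_onsSeq (t : ℕ) (x : Vec d) :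
    objective R η ν (onsSeq R η ν m g t).hist x = -ν * Real.log (R ^ 2 - ‖x‖ ^ 2)
      + η / 2 * ∑ s ∈ Finset.range t, ⟪g s, x - (onsSeq R η ν m g s).u⟫ ^ 2
      + ∑ s ∈ Finset.range t, ⟪g s, x⟫ := by
  induction t with
  | zero => simp [onsSeq, objective]
  | succ t ih =>
    rw [onsSeq_hist_succ, objective_append, ih, Finset.sum_range_succ, Finset.sum_range_succ]
    ring

/-- The regret of Barrier-ONS for linear losses, up to a quadratic term. -/
theorem onsSeq_regret (hR : 0 < R) (hη : 0 ≤ η) (hν : 0 < ν) (hm : 4 ≤ m) {T : ℕ}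
    (hg : ∀ t < T, ‖g t‖ * R ≤ ν / 10) {x : Vec d} (hx : 0 < R ^ 2 - ‖x‖ ^ 2) :
    ∑ t ∈ Finset.range T, ⟪g t, (onsSeq R η ν m g t).u - x⟫
      ≤ ν * (Real.log (R ^ 2) - Real.log (R ^ 2 - ‖x‖ ^ 2))
        + η / 2 * ∑ t ∈ Finset.range T, ⟪g t, (onsSeq R η ν m g t).u - x⟫ ^ 2
        + 2 * ∑ t ∈ Finset.range T, dualSqSeq R η ν m g t := by
  have hinv := onsSeq_invariant hR hη hν hm hg
  have hpot : ∀ n ≤ T, -ν * Real.log (R ^ 2)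
      + ∑ t ∈ Finset.range n, ⟪g t, (onsSeq R η ν m g t).u⟫
      - 33 / 32 * ∑ t ∈ Finset.range n, decrementSeq R η ν m g t ^ 2
      ≤ objective R η ν (onsSeq R η ν m g n).hist (onsSeq R η ν m g n).u := by
    intro n
    induction n with
    | zero => intro _; simp [onsSeq, objective]
    | succ n ih =>
      intro hn
      obtain ⟨h1, -, h3⟩ := hinv n (by omega)
      have h2 := (ons_step hη hν h1 (g n) hm rfl (h3 (by omega)).2).2.1
      have h4 := ih (by omega)
      rw [Finset.sum_range_succ, Finset.sum_range_succ]
      change _ ≤ objective R η ν (onsSeq R η ν m g (n + 1)).hist (onsSeq R η ν m g (n + 1)).u at h2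
      change _ + _ - 33 / 32 * decrementSeq R η ν m g n ^ 2 ≤ _ at h2
      linarith
  obtain ⟨h1, h2, -⟩ := hinv T le_rfl
  have hres0 := residualSeq_nonneg (R := R) (η := η) (ν := ν) (m := m) (g := g) T
  have hlow := objective_lower hη hν h1.gap_u hx hres0
    (by linarith [Real.sqrt_nonneg ν]) h1.residual
  rw [objective_onsSeq T x] at hlow
  have hp := hpot T le_rfl
  have hres : residualSeq R η ν m g T ^ 2
      ≤ (∑ t ∈ Finset.range T, decrementSeq R η ν m g t ^ 2) / 25 := by
    cases T with
    | zero => simp [residualSeq]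
    | succ n =>
      rw [Finset.sum_range_succ]
      have : 0 ≤ ∑ t ∈ Finset.range n, decrementSeq R η ν m g t ^ 2 :=
        Finset.sum_nonneg fun _ _ => sq_nonneg _
      simp only [residualSeq, div_pow]
      linarith
  have hdec := sum_decrementSeq_sq_le hR hη hν hm hg
  have hdual : 0 ≤ ∑ t ∈ Finset.range T, dualSqSeq R η ν m g t :=
    Finset.sum_nonneg fun t _ => dualSq_nonneg hR hη hν _ _
  have e1 : ∑ t ∈ Finset.range T, ⟪g t, (onsSeq R η ν m g t).u - x⟫
      = ∑ t ∈ Finset.range T, ⟪g t, (onsSeq R η ν m g t).u⟫ - ∑ t ∈ Finset.range T, ⟪g t, x⟫ := by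
    rw [← Finset.sum_sub_distrib]
    exact Finset.sum_congr rfl fun t _ => inner_sub_right _ _ _
  have e2 : ∑ t ∈ Finset.range T, ⟪g t, (onsSeq R η ν m g t).u - x⟫ ^ 2
      = ∑ t ∈ Finset.range T, ⟪g t, x - (onsSeq R η ν m g t).u⟫ ^ 2 := by
    refine Finset.sum_congr rfl fun t _ => ?_
    rw [← neg_sub x, inner_neg_right, neg_sq]
  rw [e1, e2]
  linarith

/-- A failed test of the expansion point moves the logarithm of `R² - ‖z‖²` by at least `1 / 3`. -/
lemma one_third_le_abs_log_sub {x y : ℝ} (hx : 0 < x) (hy : 0 < y)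
    (h : 1 / 2 * y < |x - y|) : 1 / 3 ≤ |Real.log x - Real.log y| := by
  rw [← Real.log_div hx.ne' hy.ne']
  rcases lt_abs.1 h with h | h
  · have h1 := Real.one_sub_inv_le_log_of_pos (div_pos hx hy)
    have h2 : (x / y)⁻¹ ≤ 2 / 3 := by
      rw [inv_div, div_le_iff₀ hx]; linarith
    linarith [le_abs_self (Real.log (x / y))]
  · have h1 := Real.log_le_sub_one_of_pos (div_pos hx hy)
    have h2 : x / y ≤ 1 / 2 := by rw [div_le_iff₀ hy]; linarith
    linarith [neg_abs_le (Real.log (x / y))]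

/-- Between two replacements of the expansion point, the logarithm of `R² - ‖u‖²` has to move by a
constant, and each round moves it by a multiple of the decrement. -/
lemma switchCount_le_sum_decrement (hR : 0 < R) (hη : 0 ≤ η) (hν : 0 < ν) (hm : 4 ≤ m) {T : ℕ}
    (hg : ∀ t < T, ‖g t‖ * R ≤ ν / 10) :
    (switchCount R η ν m g T : ℝ)
      ≤ 21 / 5 * ∑ t ∈ Finset.range T, decrementSeq R η ν m g t / √ν := by
  have hinv := onsSeq_invariant hR hη hν hm hg
  have key : ∀ n ≤ T, 1 / 3 * (switchCount R η ν m g n : ℝ)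
      + |Real.log (R ^ 2 - ‖(onsSeq R η ν m g n).z‖ ^ 2)
        - Real.log (R ^ 2 - ‖(onsSeq R η ν m g n).u‖ ^ 2)|
      ≤ 7 / 5 * ∑ t ∈ Finset.range n, decrementSeq R η ν m g t / √ν := by
    intro n
    induction n with
    | zero => intro _; simp [switchCount, onsSeq]
    | succ n ih =>
      intro hn
      obtain ⟨h1, -, h3⟩ := hinv n (by omega)
      have h2 := (ons_step hη hν h1 (g n) hm rfl (h3 (by omega)).2).2.2
      change |Real.log (R ^ 2 - ‖(onsSeq R η ν m g (n + 1)).u‖ ^ 2) - _|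
        ≤ 7 / 5 * (decrementSeq R η ν m g n / √ν) at h2
      have h4 := ih (by omega)
      have hgap := (hinv (n + 1) hn).1.gap_u
      have htri := abs_sub_le (Real.log (R ^ 2 - ‖(onsSeq R η ν m g n).z‖ ^ 2))
        (Real.log (R ^ 2 - ‖(onsSeq R η ν m g n).u‖ ^ 2))
        (Real.log (R ^ 2 - ‖(onsSeq R η ν m g (n + 1)).u‖ ^ 2))
      rw [abs_sub_comm (Real.log (R ^ 2 - ‖(onsSeq R η ν m g n).u‖ ^ 2))] at htri
      rw [Finset.sum_range_succ]
      by_cases hs : Switches R η ν m g n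
      · have h5 := one_third_le_abs_log_sub h1.gap_z hgap (by
          have := not_le.1 hs
          rwa [(by ring : R ^ 2 - ‖(onsSeq R η ν m g n).z‖ ^ 2
            - (R ^ 2 - ‖(onsSeq R η ν m g (n + 1)).u‖ ^ 2)
            = ‖(onsSeq R η ν m g (n + 1)).u‖ ^ 2 - ‖(onsSeq R η ν m g n).z‖ ^ 2)])
        rw [onsSeq_z_of_switches hs, switchCount_succ_of_switches hs, sub_self, abs_zero]
        push_cast
        linarith
      · rw [onsSeq_z_of_not_switches hs, switchCount_succ_of_not_switches hs]
        linarith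
  have := key T le_rfl
  linarith [abs_nonneg (Real.log (R ^ 2 - ‖(onsSeq R η ν m g T).z‖ ^ 2)
        - Real.log (R ^ 2 - ‖(onsSeq R η ν m g T).u‖ ^ 2))]

/-- The number of replacements of the expansion point is of order `√T`. -/
theorem switchCount_sq_le (hd : 1 ≤ d) (hR : 0 < R) (hη : 0 < η) (hν : 0 < ν) (hm : 4 ≤ m) {T : ℕ}
    {Γ : ℝ} (hΓ : Γ * R ≤ ν / 10) (hg : ∀ t < T, ‖g t‖ ≤ Γ) :
    (switchCount R η ν m g T : ℝ) ^ 2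
      ≤ 29 * T * (d * Real.log (1 + T * (η * Γ ^ 2 / (2 * ν / R ^ 2 * d)))) / (η * ν) := by
  have hg' : ∀ t < T, ‖g t‖ * R ≤ ν / 10 := fun t ht =>
    (mul_le_mul_of_nonneg_right (hg t ht) hR.le).trans hΓ
  have h1 := switchCount_le_sum_decrement hR hη.le hν hm hg'
  have h2 := sum_decrementSeq_sq_le hR hη.le hν hm hg'
  have h3 := sum_dualSqSeq_le (m := m) hd hR hη hν hg
  have h4 := pow_le_pow_left₀ (Nat.cast_nonneg _) h1 2
  refine h4.trans ?_
  rw [← Finset.sum_div, mul_pow, div_pow _ (√ν), Real.sq_sqrt hν.le]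
  have h5 : (∑ t ∈ Finset.range T, decrementSeq R η ν m g t) ^ 2
      ≤ T * ∑ t ∈ Finset.range T, decrementSeq R η ν m g t ^ 2 := by
    simpa using sq_sum_le_card_mul_sum_sq (s := Finset.range T)
      (f := fun t => decrementSeq R η ν m g t)
  set D := d * Real.log (1 + T * (η * Γ ^ 2 / (2 * ν / R ^ 2 * d)))
  have h6 : η * (∑ t ∈ Finset.range T, decrementSeq R η ν m g t) ^ 2 ≤ 25 / 16 * T * D := by
    have hT : (0 : ℝ) ≤ T := Nat.cast_nonneg T
    have h7 := mul_le_mul_of_nonneg_left h5 hη.le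
    have h8 := mul_le_mul_of_nonneg_left (mul_le_mul_of_nonneg_left h2 hη.le) hT
    have h9 := mul_le_mul_of_nonneg_left h3 hT
    linarith
  have hD : 0 ≤ T * D := by
    have : 0 ≤ η * (∑ t ∈ Finset.range T, decrementSeq R η ν m g t) ^ 2 := by positivity
    linarith
  rw [le_div_iff₀ (by positivity)]
  have e : (21 / 5) ^ 2 * ((∑ t ∈ Finset.range T, decrementSeq R η ν m g t) ^ 2 / ν) * (η * ν)
      = (21 / 5) ^ 2 * (η * (∑ t ∈ Finset.range T, decrementSeq R η ν m g t) ^ 2) := by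
    field_simp
  rw [e]
  linarith

end Sequence

/-! ### Computations with a step count -/

section Costs

lemma bind_val {α β : Type} (x : Costed α) (f : α → Costed β) : (x >>= f).val = (f x.val).val := rfl
lemma bind_cost {α β : Type} (x : Costed α) (f : α → Costed β) :
    (x >>= f).cost = x.cost + (f x.val).cost := rfl
lemma pure_val {α : Type} (a : α) : (pure a : Costed α).val = a := rfl
lemma pure_cost {α : Type} (a : α) : (pure a : Costed α).cost = 0 := rfl

lemma ite_val {α : Type} (p : Prop) [Decidable p] (x y : Costed α) :
    (if p then x else y).val = if p then x.val else y.val := by split_ifs <;> rfl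
lemma ite_cost {α : Type} (p : Prop) [Decidable p] (x y : Costed α) :
    (if p then x else y).cost = if p then x.cost else y.cost := by split_ifs <;> rfl

lemma addC_val (x y : ℝ) : (addC x y).val = x + y := rfl
lemma subC_val (x y : ℝ) : (subC x y).val = x - y := rfl
lemma mulC_val (x y : ℝ) : (mulC x y).val = x * y := rfl
lemma divC_val (x y : ℝ) : (divC x y).val = x / y := rfl
lemma absC_val (x : ℝ) : (absC x).val = |x| := rfl
lemma ltC_val (x y : ℝ) : ((ltC x y).val = true) = (x < y) := by simp [ltC]
lemma addC_cost (x y : ℝ) : (addC x y).cost = 1 := rfl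
lemma subC_cost (x y : ℝ) : (subC x y).cost = 1 := rfl
lemma mulC_cost (x y : ℝ) : (mulC x y).cost = 1 := rfl
lemma divC_cost (x y : ℝ) : (divC x y).cost = 1 := rfl
lemma absC_cost (x : ℝ) : (absC x).cost = 1 := rfl
lemma leC_cost (x y : ℝ) : (leC x y).cost = 1 := rfl
lemma ltC_cost (x y : ℝ) : (ltC x y).cost = 1 := rfl

variable {d : ℕ}

lemma dotC_val (x y : Vec d) : (dotC x y).val = ⟪x, y⟫ := by
  simp [dotC, sumOf, mulC, EuclideanSpace.inner_eq_star_dotProduct, dotProduct, mul_comm]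
lemma addVecC_val (x y : Vec d) : (addVecC x y).val = x + y := by
  ext i; simp [addVecC, vecOf, addC]
lemma subVecC_val (x y : Vec d) : (subVecC x y).val = x - y := by
  ext i; simp [subVecC, vecOf, subC]
lemma smulVecC_val (a : ℝ) (x : Vec d) : (smulVecC a x).val = a • x := by
  ext i; simp [smulVecC, vecOf, mulC]
lemma divVecC_val (x : Vec d) (a : ℝ) : (divVecC x a).val = a⁻¹ • x := by
  ext i; simp [divVecC, vecOf, divC, div_eq_inv_mul]
lemma mulVecC_val (A : Mat d) (x : Vec d) : (mulVecC A x).val = Matrix.toEuclideanLin A x := by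
  ext i; simp [mulVecC, vecOf, sumOf, mulC, Matrix.mulVec, dotProduct]
lemma outerC_val (x y : Vec d) : (outerC x y).val = Matrix.vecMulVec x.ofLp y.ofLp := by
  ext i j; simp [outerC, matOf, mulC, Matrix.vecMulVec_apply]
lemma addMatC_val (A B : Mat d) : (addMatC A B).val = A + B := by
  ext i j; simp [addMatC, matOf, addC]
lemma subMatC_val (A B : Mat d) : (subMatC A B).val = A - B := by
  ext i j; simp [subMatC, matOf, subC]
lemma smulMatC_val (a : ℝ) (A : Mat d) : (smulMatC a A).val = a • A := by
  ext i j; simp [smulMatC, matOf, mulC]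
lemma scalarMatC_val (a : ℝ) : (scalarMatC a : Costed (Mat d)).val = a • (1 : Mat d) := by
  ext i j
  by_cases h : i = j <;> simp [scalarMatC, matOf, mulC, h]

lemma dotC_cost (x y : Vec d) : (dotC x y).cost = 2 * d := by
  simp [dotC, sumOf, mulC, mul_comm]
lemma addVecC_cost (x y : Vec d) : (addVecC x y).cost = d := by simp [addVecC, vecOf, addC]
lemma subVecC_cost (x y : Vec d) : (subVecC x y).cost = d := by simp [subVecC, vecOf, subC]
lemma smulVecC_cost (a : ℝ) (x : Vec d) : (smulVecC a x).cost = d := by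
  simp [smulVecC, vecOf, mulC]
lemma divVecC_cost (x : Vec d) (a : ℝ) : (divVecC x a).cost = d := by simp [divVecC, vecOf, divC]
lemma mulVecC_cost (A : Mat d) (x : Vec d) : (mulVecC A x).cost = 2 * d ^ 2 := by
  simp [mulVecC, vecOf, sumOf, mulC]; ring
lemma outerC_cost (x y : Vec d) : (outerC x y).cost = d ^ 2 := by
  simp [outerC, matOf, mulC, sq]
lemma addMatC_cost (A B : Mat d) : (addMatC A B).cost = d ^ 2 := by
  simp [addMatC, matOf, addC, sq]
lemma subMatC_cost (A B : Mat d) : (subMatC A B).cost = d ^ 2 := by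
  simp [subMatC, matOf, subC, sq]
lemma smulMatC_cost (a : ℝ) (A : Mat d) : (smulMatC a A).cost = d ^ 2 := by
  simp [smulMatC, matOf, mulC, sq]
lemma scalarMatC_cost (a : ℝ) : (scalarMatC a : Costed (Mat d)).cost = d ^ 2 := by
  have : ∀ i j : Fin d, (if i = j then mulC a 1 else mulC a 0).cost = 1 := by
    intro i j; split_ifs <;> rfl
  simp [scalarMatC, matOf, this, sq]

/-- A while loop runs until the guard fails for the first time, provided that it ever fails. -/
lemma whileC_spec {σ : Type} (guard : σ → Costed Bool) (body : σ → Costed σ) (s : σ)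
    (h : ∃ n, ¬ (guard ((fun x => (body x).val)^[n] s)).val = true) :
    ∃ n, ¬ (guard ((fun x => (body x).val)^[n] s)).val = true ∧
      (∀ k < n, (guard ((fun x => (body x).val)^[k] s)).val = true) ∧
      (whileC guard body s).val = (fun x => (body x).val)^[n] s ∧
      (whileC guard body s).cost
        = ∑ i ∈ Finset.range n, ((guard ((fun x => (body x).val)^[i] s)).cost
          + (body ((fun x => (body x).val)^[i] s)).cost)
          + (guard ((fun x => (body x).val)^[n] s)).cost := by
  set step : Costed σ → Costed σ := fun c =>
    ⟨(body c.val).val, c.cost + (guard c.val).cost + (body c.val).cost⟩ with hstep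
  set v : ℕ → σ := fun k => (fun x => (body x).val)^[k] s with hv
  have hiter : ∀ k, (step^[k] ⟨s, 0⟩).val = v k ∧
      (step^[k] ⟨s, 0⟩).cost = ∑ i ∈ Finset.range k, ((guard (v i)).cost + (body (v i)).cost) := by
    intro k
    induction k with
    | zero => simp [hv]
    | succ k ih =>
      rw [Function.iterate_succ_apply', Finset.sum_range_succ]
      have h2 : v (k + 1) = (body (v k)).val := Function.iterate_succ_apply' _ _ _
      rw [hstep]
      dsimp only
      rw [← hstep, ih.1, ih.2, h2]
      exact ⟨rfl, by ring⟩
  have h' : ∃ n, ¬ (fun c : Costed σ => (guard c.val).val = true) (step^[n] ⟨s, 0⟩) := by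
    obtain ⟨n, hn⟩ := h
    exact ⟨n, by simpa only [(hiter n).1] using hn⟩
  classical
  have hl : whileLoop (fun c : Costed σ => (guard c.val).val = true) step ⟨s, 0⟩
      = step^[Nat.find h'] ⟨s, 0⟩ := by
    rw [whileLoop, dif_pos h']
    congr!
  refine ⟨Nat.find h', ?_, ?_, ?_, ?_⟩
  · have := Nat.find_spec h'
    simpa only [(hiter _).1] using this
  · intro k hk
    have := Nat.find_min h' hk
    simpa only [(hiter _).1, not_not] using this
  · change (whileLoop _ step _).val = _
    rw [hl, (hiter _).1]
  · change (whileLoop _ step _).cost + (guard (whileLoop _ step _).val).cost = _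
    rw [hl, (hiter _).1, (hiter _).2]

end Costs

/-! ### Approximate gauge distances -/

section Gauge

variable {d : ℕ} {K : Set (Vec d)} {r R : ℝ} {sep : Vec d → Bool × Vec d}

lemma SetAssumption.zero_mem (h : SetAssumption K r R) : (0 : Vec d) ∈ K :=
  h.ball_subset (Metric.mem_closedBall_self h.r_pos.le)

lemma SetAssumption.norm_le (h : SetAssumption K r R) {x : Vec d} (hx : x ∈ K) : ‖x‖ ≤ R := by
  simpa using h.subset_ball hx

lemma SetAssumption.lt_norm (h : SetAssumption K r R) {x : Vec d} (hx : x ∉ K) : r < ‖x‖ := by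
  by_contra hc
  exact hx (h.ball_subset (by simpa using not_lt.1 hc))

lemma IsSeparationOracle.fst_eq_false_iff (hsep : IsSeparationOracle K sep) (w : Vec d) :
    (sep w).1 = false ↔ w ∈ K := by
  constructor
  · intro h
    by_contra hw
    rw [((hsep w).2.2 hw).1] at h
    exact Bool.noConfusion h
  · intro h
    rw [(hsep w).2.1 h]

/-- The state of the bisection after `k` steps. -/
structure BisectionInvariant (K : Set (Vec d)) (sep : Vec d → Bool × Vec d) (w : Vec d) (k : ℕ)
    (s : ℝ × ℝ × Vec d) : Prop where
  nonneg : 0 ≤ s.1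
  le_one : s.2.1 ≤ 1
  gap : s.2.1 - s.1 = (1 / 2) ^ k
  mem : s.1 • w ∈ K
  not_mem : s.2.1 • w ∉ K
  vec : s.2.2 = (sep (s.2.1 • w)).2

lemma gaugeDist_of_mem (hsep : IsSeparationOracle K sep) (Csep : ℕ) (ε : ℝ) {w : Vec d}
    (hw : w ∈ K) :
    (gaugeDist sep Csep ε r w).val = (0, 0) ∧ (gaugeDist sep Csep ε r w).cost = Csep := by
  have h := (hsep.fst_eq_false_iff w).2 hw
  unfold gaugeDist
  simp only [bind_val, bind_cost, h, if_true, pure_val, pure_cost]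
  exact ⟨trivial, rfl⟩

/-- What bisection returns at a point outside `K`: the gauge of `K` at `w` lies between `1 / β` and
`1 / α`, and the number `n` of steps is logarithmic. -/
lemma gaugeDist_of_notMem (hK : SetAssumption K r R) (hsep : IsSeparationOracle K sep) (Csep : ℕ)
    {ε : ℝ} (hε : 0 < ε) (hε1 : ε ≤ 1) {w : Vec d} (hw : w ∉ K) :
    ∃ (α β : ℝ) (n : ℕ), 0 < α ∧ α ≤ β ∧ β ≤ 1 ∧ β - α ≤ r ^ 2 * ε / (2 * ‖w‖ ^ 2) ∧
      α • w ∈ K ∧ β • w ∉ K ∧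
      (gaugeDist sep Csep ε r w).val
        = (1 / α - 1, (β * ⟪(sep (β • w)).2, w⟫)⁻¹ • (sep (β • w)).2) ∧
      (2 : ℝ) ^ n ≤ 4 * ‖w‖ ^ 2 / (r ^ 2 * ε) ∧
      (gaugeDist sep Csep ε r w).cost ≤ (n + 1) * (Csep + d + 4) + 5 * d + 7 := by
  have hr := hK.r_pos
  have hrw := hK.lt_norm hw
  have hw0 : 0 < ‖w‖ := hr.trans hrw
  have hfst : ¬ (sep w).1 = false := fun h => hw ((hsep.fst_eq_false_iff w).1 h)
  set τ : ℝ := r * r * ε / (2 * ⟪w, w⟫) with hτ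
  have hτ' : τ = r ^ 2 * ε / (2 * ‖w‖ ^ 2) := by rw [hτ, real_inner_self_eq_norm_sq]; ring
  have hτ0 : 0 < τ := by rw [hτ']; positivity
  set guard : ℝ × ℝ × Vec d → Costed Bool := fun s => do
    let gap ← subC s.2.1 s.1
    ltC τ gap with hguard
  set body : ℝ × ℝ × Vec d → Costed (ℝ × ℝ × Vec d) := fun s => do
    let sm ← addC s.1 s.2.1
    let μ ← divC sm 2
    let μw ← smulVecC μ w
    let b ← (⟨sep μw, Csep⟩ : Costed (Bool × Vec d))
    if b.1 = false then pure (μ, s.2.1, s.2.2) else pure (s.1, μ, b.2) with hbody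
  set s0 : ℝ × ℝ × Vec d := (0, 1, (sep w).2) with hs0
  have hgv : ∀ s, ((guard s).val = true) = (τ < s.2.1 - s.1) := by
    intro s
    simp only [hguard, bind_val, ltC_val, subC_val]
  have hgc : ∀ s, (guard s).cost = 2 := by
    intro s
    simp only [hguard, bind_cost, ltC_cost, subC_cost]
  have hbv : ∀ s, (body s).val = if (sep (((s.1 + s.2.1) / 2) • w)).1 = false
      then ((s.1 + s.2.1) / 2, s.2.1, s.2.2)
      else (s.1, (s.1 + s.2.1) / 2, (sep (((s.1 + s.2.1) / 2) • w)).2) := by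
    intro s
    simp only [hbody, bind_val, addC_val, divC_val, smulVecC_val, ite_val, pure_val]
  have hbc : ∀ s, (body s).cost = Csep + d + 2 := by
    intro s
    simp only [hbody, bind_cost, addC_cost, divC_cost, smulVecC_cost, ite_cost, pure_cost, ite_self]
    ring
  set v : ℕ → ℝ × ℝ × Vec d := fun k => (fun x => (body x).val)^[k] s0 with hv
  have hinv : ∀ k, BisectionInvariant K sep w k (v k) := by
    intro k
    induction k with
    | zero =>
      refine ⟨le_rfl, le_rfl, by simp [hv, hs0], ?_, ?_, ?_⟩
      · simpa [hv, hs0] using hK.zero_mem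
      · simpa [hv, hs0] using hw
      · simp [hv, hs0]
    | succ k ih =>
      have h2 : v (k + 1) = (body (v k)).val := Function.iterate_succ_apply' _ _ _
      have hg := ih.gap
      have hpos : (0 : ℝ) < (1 / 2) ^ k := by positivity
      have h0 := ih.nonneg
      have h1 := ih.le_one
      rw [h2, hbv]
      split_ifs with hm
      · exact ⟨by dsimp only; linarith, h1, by dsimp only; rw [pow_succ]; linarith,
          (hsep.fst_eq_false_iff _).1 hm, ih.not_mem, ih.vec⟩
      · exact ⟨h0, by dsimp only; linarith, by dsimp only; rw [pow_succ]; linarith, ih.mem,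
          fun h => hm ((hsep.fst_eq_false_iff _).2 h), rfl⟩
  have hterm : ∃ n, ¬ (guard (v n)).val = true := by
    obtain ⟨n, hn⟩ := exists_pow_lt_of_lt_one hτ0 (by norm_num : (1 / 2 : ℝ) < 1)
    refine ⟨n, ?_⟩
    rw [hgv, (hinv n).gap]
    exact not_lt.2 hn.le
  obtain ⟨n, hn1, hn2, hn3, hn4⟩ := whileC_spec guard body s0 hterm
  change ¬ (guard (v n)).val = true at hn1
  change _ = v n at hn3
  have hI := hinv n
  rw [hgv, not_lt] at hn1
  have hpos : (0 : ℝ) < (1 / 2) ^ n := by positivity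
  have hgap := hI.gap
  have hcost : (whileC guard body s0).cost = n * (Csep + d + 4) + 2 := by
    rw [hn4]
    simp only [hgc, hbc, Finset.sum_const, Finset.card_range, smul_eq_mul]
    ring
  -- if `α = 0` then `β w` would be in the ball of radius `r`
  have hα : 0 < (v n).1 := by
    rcases hI.nonneg.eq_or_lt with h | h
    · exfalso
      rw [← h, sub_zero] at hn1
      have h3 := hK.lt_norm hI.not_mem
      have hβ0 : 0 ≤ (v n).2.1 := by linarith
      rw [norm_smul, Real.norm_of_nonneg hβ0] at h3
      have h4 : (v n).2.1 * ‖w‖ ≤ τ * ‖w‖ := mul_le_mul_of_nonneg_right hn1 hw0.le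
      have h5 : τ * ‖w‖ ≤ r := by
        have : τ * ‖w‖ = r ^ 2 * ε / (2 * ‖w‖) := by rw [hτ']; field_simp
        rw [this, div_le_iff₀ (by positivity)]
        have h6 : r ^ 2 * ε ≤ r ^ 2 := by nlinarith [sq_nonneg r]
        nlinarith
      linarith
    · exact h
  refine ⟨(v n).1, (v n).2.1, n, hα, by linarith, hI.le_one, hτ' ▸ hn1, hI.mem, hI.not_mem, ?_, ?_,
    ?_⟩
  · unfold gaugeDist
    simp only [bind_val, hfst, mulC_val, dotC_val, divC_val, subC_val, divVecC_val,
      pure_val, ite_val]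
    change (1 / (whileC guard body s0).val.1 - 1,
      ((whileC guard body s0).val.2.1 * ⟪(whileC guard body s0).val.2.2, w⟫)⁻¹ •
        (whileC guard body s0).val.2.2) = _
    rw [hn3, ← hI.vec]
  · have h4 : 4 * ‖w‖ ^ 2 / (r ^ 2 * ε) = 2 / τ := by rw [hτ']; field_simp; norm_num
    rw [h4, le_div_iff₀ hτ0]
    rcases Nat.eq_zero_or_pos n with h0 | h0
    · rw [h0, pow_zero, one_mul, hτ', div_le_iff₀ (by positivity)]
      have h6 : r ^ 2 * ε ≤ r ^ 2 := by nlinarith [sq_nonneg r]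
      nlinarith
    · have h5 := hn2 (n - 1) (by omega)
      change (guard (v (n - 1))).val = true at h5
      rw [hgv, (hinv (n - 1)).gap] at h5
      obtain ⟨k, rfl⟩ : ∃ k, n = k + 1 := ⟨n - 1, by omega⟩
      rw [Nat.add_sub_cancel] at h5
      have h7 : (2 : ℝ) ^ k * (1 / 2) ^ k = 1 := by rw [← mul_pow]; norm_num
      have h8 := mul_lt_mul_of_pos_left h5 (by positivity : (0 : ℝ) < 2 ^ k)
      rw [pow_succ]
      linarith
  · unfold gaugeDist
    simp only [bind_cost, hfst, mulC_val, dotC_val, divC_val, mulC_cost,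
      dotC_cost, divC_cost, subC_cost, divVecC_cost, pure_cost, ite_cost]
    change Csep + (1 + (2 * d + (1 + (1 + ((whileC guard body s0).cost
      + (1 + (1 + (2 * d + (1 + (d + 0)))))))))) ≤ _
    rw [hcost]
    ring_nf
    omega

end Gauge

/-! ### One round of the reduction -/

section Round

variable {d : ℕ} {K : Set (Vec d)} {r R : ℝ} {sep : Vec d → Bool × Vec d}

/-- The point played by the reduction when the subroutine outputs `u`, with the vector `s`. -/
def gaugePlay (sep : Vec d → Bool × Vec d) (Csep : ℕ) (r : ℝ) (T : ℕ) (u : Vec d) :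
    Costed (Vec d × Vec d) := do
  let p ← gaugeDist sep Csep (1 / (T : ℝ)) r u
  let c ← addC 1 p.1
  let w ← divVecC u c
  pure (w, p.2)

/-- The loss vector sent to the subroutine. -/
def lossVec (sep : Vec d → Bool × Vec d) (Csep : ℕ) (r : ℝ) (T : ℕ) (u g : Vec d) : Vec d :=
  open Classical in
  if ⟪g, u⟫ < 0 then
    g - ⟪g, (gaugePlay sep Csep r T u).val.1⟫ • (gaugePlay sep Csep r T u).val.2
  else g

lemma reductionRound_val {σ : Type} (A : OnlineAlgorithm d σ) (Csep T : ℕ) (st : σ) (g : Vec d) :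
    (reductionRound A sep Csep r T st g).val
      = (A.update st (lossVec sep Csep r T (A.output st) g)).val := by
  have h : reductionPlay A sep Csep r T st = gaugePlay sep Csep r T (A.output st) := rfl
  unfold reductionRound lossVec
  rw [h]
  simp only [bind_val, ite_val, dotC_val, smulVecC_val, subVecC_val, ltC_val]
  split_ifs <;> rfl

lemma reductionRound_cost_le {σ : Type} (A : OnlineAlgorithm d σ) (Csep T : ℕ) (st : σ)
    (g : Vec d) :
    (reductionRound A sep Csep r T st g).cost ≤ (gaugePlay sep Csep r T (A.output st)).cost
      + 6 * d + 1 + (A.update st (lossVec sep Csep r T (A.output st) g)).cost := by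
  have h : reductionPlay A sep Csep r T st = gaugePlay sep Csep r T (A.output st) := rfl
  unfold reductionRound lossVec
  rw [h]
  simp only [bind_cost, ite_cost, dotC_val, smulVecC_val, subVecC_val, ltC_val,
    dotC_cost, smulVecC_cost, subVecC_cost, ltC_cost]
  split_ifs <;> omega

lemma gaugePlay_of_mem (hsep : IsSeparationOracle K sep) (Csep T : ℕ) {u : Vec d} (hu : u ∈ K) :
    (gaugePlay sep Csep r T u).val = (u, 0) := by
  unfold gaugePlay
  simp only [bind_val, (gaugeDist_of_mem hsep Csep _ hu).1, addC_val, divVecC_val, pure_val]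
  simp

/-- The play at a point outside `K`: the point `α u` and a vector `s` with `⟨s, ·⟩ ≤ 1` on `K`. -/
lemma gaugePlay_of_notMem (hK : SetAssumption K r R) (hsep : IsSeparationOracle K sep) (Csep : ℕ)
    {T : ℕ} (hT : 1 ≤ T) {u : Vec d} (hu : u ∉ K) :
    ∃ (α β : ℝ), 0 < α ∧ α ≤ β ∧ β ≤ 1 ∧ r < β * ‖u‖ ∧
      β - α ≤ r ^ 2 * (1 / T) / (2 * ‖u‖ ^ 2) ∧ α • u ∈ K ∧
      (gaugePlay sep Csep r T u).val.1 = α • u ∧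
      ⟪(gaugePlay sep Csep r T u).val.2, u⟫ = 1 / β ∧
      ‖(gaugePlay sep Csep r T u).val.2‖ ≤ 1 / r ∧
      ∀ x ∈ K, ⟪(gaugePlay sep Csep r T u).val.2, x⟫ ≤ 1 := by
  have hr := hK.r_pos
  have hT' : (1 : ℝ) ≤ T := by exact_mod_cast hT
  obtain ⟨α, β, n, hα, hαβ, hβ, hgap, hmem, hnm, hval, -, -⟩ :=
    gaugeDist_of_notMem hK hsep Csep (ε := 1 / T) (by positivity)
      (by rw [div_le_one (by positivity)]; exact hT') hu
  have hβ0 : 0 < β := hα.trans_le hαβ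
  have hs := ((hsep (β • u)).2.2 hnm).2
  have hval2 : (gaugePlay sep Csep r T u).val
      = (α • u, (β * ⟪(sep (β • u)).2, u⟫)⁻¹ • (sep (β • u)).2) := by
    unfold gaugePlay
    simp only [bind_val, hval, addC_val, divVecC_val, pure_val]
    simp
  set v := (sep (β • u)).2 with hv
  have h0 := hs 0 hK.zero_mem
  rw [inner_zero_right, inner_smul_right] at h0
  have hvu : 0 < ⟪v, u⟫ := pos_of_mul_pos_right h0 hβ0.le
  have hvn : 0 < ‖v‖ := by
    rw [norm_pos_iff]
    rintro h
    rw [h, inner_zero_left] at hvu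
    exact lt_irrefl _ hvu
  rw [hval2]
  refine ⟨α, β, hα, hαβ, hβ, ?_, hgap, hmem, rfl, ?_, ?_, ?_⟩
  · have := hK.lt_norm hnm
    rwa [norm_smul, Real.norm_of_nonneg hβ0.le] at this
  · dsimp only
    rw [inner_smul_left, conj_trivial]
    field_simp
  · dsimp only
    -- the separating inequality at the point `(r / ‖v‖) v` of `K`
    have h1 := hs ((r / ‖v‖) • v) (hK.ball_subset (by
      rw [mem_closedBall_zero_iff, norm_smul, Real.norm_of_nonneg (by positivity)]
      field_simp
      exact le_rfl))
    rw [inner_smul_right, inner_smul_right, real_inner_self_eq_norm_sq] at h1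
    have h2 : r / ‖v‖ * ‖v‖ ^ 2 = r * ‖v‖ := by field_simp
    rw [h2] at h1
    rw [norm_smul, norm_inv, Real.norm_of_nonneg h0.le, inv_mul_eq_div,
      div_le_div_iff₀ h0 hr]
    linarith
  · intro x hx
    have h1 := hs x hx
    rw [inner_smul_right] at h1
    dsimp only
    rw [inner_smul_left, conj_trivial, inv_mul_eq_div, div_le_one h0]
    exact h1.le

lemma gaugePlay_mem (hK : SetAssumption K r R) (hsep : IsSeparationOracle K sep) (Csep : ℕ)
    {T : ℕ} (hT : 1 ≤ T) (u : Vec d) : (gaugePlay sep Csep r T u).val.1 ∈ K := by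
  by_cases hu : u ∈ K
  · rw [gaugePlay_of_mem hsep Csep T hu]; exact hu
  · obtain ⟨α, β, -, -, -, -, -, hm, he, -⟩ := gaugePlay_of_notMem hK hsep Csep hT hu
    rw [he]; exact hm

lemma SetAssumption.r_le_R (hd : 1 ≤ d) (h : SetAssumption K r R) : r ≤ R := by
  have hr := h.r_pos
  have hm : (r • EuclideanSpace.single (⟨0, hd⟩ : Fin d) (1 : ℝ)) ∈ K :=
    h.ball_subset (by simp [norm_smul, abs_of_pos hr])
  simpa [norm_smul, abs_of_pos hr] using h.norm_le hm

lemma abs_inner_le_mul {x y : Vec d} {a b : ℝ} (hx : ‖x‖ ≤ a) (hy : ‖y‖ ≤ b) :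
    |⟪x, y⟫| ≤ a * b :=
  (abs_real_inner_le_norm x y).trans
    (mul_le_mul hx hy (norm_nonneg _) ((norm_nonneg _).trans hx))

lemma norm_lossVec_le (hd : 1 ≤ d) (hK : SetAssumption K r R) (hsep : IsSeparationOracle K sep)
    (Csep : ℕ) {T : ℕ} (hT : 1 ≤ T) {G : ℝ} (hG : 0 < G) (u : Vec d) {g : Vec d} (hg : ‖g‖ ≤ G) :
    ‖lossVec sep Csep r T u g‖ ≤ 2 * (R / r) * G := by
  have hr := hK.r_pos
  have hκ : 1 ≤ R / r := (one_le_div hr).2 (hK.r_le_R hd)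
  have hGκ : G ≤ (R / r) * G := by nlinarith
  unfold lossVec
  split_ifs with h
  · have hs : ‖(gaugePlay sep Csep r T u).val.2‖ ≤ 1 / r := by
      by_cases hu : u ∈ K
      · rw [gaugePlay_of_mem hsep Csep T hu]; simp [hr.le]
      · obtain ⟨α, β, -, -, -, -, -, -, -, -, h2, -⟩ := gaugePlay_of_notMem hK hsep Csep hT hu
        exact h2
    have hgw := abs_inner_le_mul hg (hK.norm_le (gaugePlay_mem hK hsep Csep hT u))
    refine (norm_sub_le _ _).trans ?_
    rw [norm_smul, Real.norm_eq_abs]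
    have := mul_le_mul hgw hs (norm_nonneg _) (by have := hK.R_pos; positivity)
    have e : G * R * (1 / r) = R / r * G := by ring
    linarith
  · linarith

/-- The regret of the played point is dominated by that of the subroutine for the surrogate loss, up
to the error `G R / (2 T)` of the bisection, and the difference is at most `2 κ G R`. -/
lemma lossVec_regret (hd : 1 ≤ d) (hK : SetAssumption K r R) (hsep : IsSeparationOracle K sep)
    (Csep : ℕ) {T : ℕ} (hT : 1 ≤ T) {G : ℝ} (hG : 0 < G) {u : Vec d} (hu : ‖u‖ ≤ R) {g : Vec d}
    (hg : ‖g‖ ≤ G) {x : Vec d} (hx : x ∈ K) :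
    -(G * R / (2 * T)) ≤ ⟪lossVec sep Csep r T u g, u - x⟫
        - ⟪g, (gaugePlay sep Csep r T u).val.1 - x⟫ ∧
      ⟪lossVec sep Csep r T u g, u - x⟫ - ⟪g, (gaugePlay sep Csep r T u).val.1 - x⟫
        ≤ 2 * (R / r) * (G * R) := by
  have hr := hK.r_pos
  have hR := hK.R_pos
  have hT' : (1 : ℝ) ≤ T := by exact_mod_cast hT
  have hκ : 1 ≤ R / r := (one_le_div hr).2 (hK.r_le_R hd)
  have hGR : 0 < G * R := by positivity
  have hκGR : G * R ≤ R / r * (G * R) := by nlinarith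
  have he0 : 0 ≤ G * R / (2 * T) := by positivity
  have hgu := abs_le.1 (abs_inner_le_mul hg hu)
  by_cases huK : u ∈ K
  · have h0 : lossVec sep Csep r T u g = g := by
      unfold lossVec
      rw [gaugePlay_of_mem hsep Csep T huK]
      simp
    rw [h0, gaugePlay_of_mem hsep Csep T huK, sub_self]
    exact ⟨by linarith, by positivity⟩
  · obtain ⟨α, β, hα, hαβ, hβ, hβu, hgap, hm, hw, hsu, hs, hsx⟩ :=
      gaugePlay_of_notMem hK hsep Csep hT huK
    have hwK := hK.norm_le (hw ▸ gaugePlay_mem hK hsep Csep hT u)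
    have hgw := abs_le.1 (abs_inner_le_mul hg hwK)
    unfold lossVec
    rw [hw]
    set s := (gaugePlay sep Csep r T u).val.2
    rw [inner_smul_right] at hgw
    have hβ0 : 0 < β := hα.trans_le hαβ
    split_ifs with hneg
    · have h1 := hsx x hx
      have h2 : -(R / r) ≤ ⟪s, x⟫ := by
        have := (abs_le.1 (abs_inner_le_mul hs (hK.norm_le hx))).1
        rwa [one_div_mul_eq_div] at this
      have e : ⟪g - ⟪g, α • u⟫ • s, u - x⟫ - ⟪g, α • u - x⟫
          = ⟪g, u⟫ * ((β - α) / β) + (-(α * ⟪g, u⟫)) * (1 - ⟪s, x⟫) := by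
        simp only [inner_sub_left, inner_sub_right, inner_smul_left, inner_smul_right,
          conj_trivial, hsu]
        field_simp
        ring
      rw [e]
      have h3 : 0 ≤ -(α * ⟪g, u⟫) := by nlinarith
      have h4 : 0 ≤ (β - α) / β := div_nonneg (by linarith) hβ0.le
      have h5 : -⟪g, u⟫ * ((β - α) / β) ≤ G * R / (2 * T) := by
        have hu0 : 0 < ‖u‖ := pos_of_mul_pos_right (hr.trans hβu) hβ0.le
        have h6 : -⟪g, u⟫ ≤ G * ‖u‖ := by
          have := (abs_le.1 (abs_inner_le_mul hg (le_refl ‖u‖))).1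
          linarith
        have h7 : (β - α) / β ≤ r ^ 2 * (1 / T) / (2 * ‖u‖ ^ 2) * (‖u‖ / r) := by
          rw [div_eq_mul_inv]
          refine mul_le_mul hgap ?_ (inv_nonneg.2 hβ0.le) (by positivity)
          rw [inv_le_comm₀ hβ0 (by positivity), inv_div, div_le_iff₀ hu0]
          exact hβu.le
        refine (mul_le_mul h6 h7 h4 (by positivity)).trans ?_
        have e2 : G * ‖u‖ * (r ^ 2 * (1 / T) / (2 * ‖u‖ ^ 2) * (‖u‖ / r)) = G * r / (2 * T) := by
          field_simp
        rw [e2]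
        have := hK.r_le_R hd
        gcongr
      have h8 : (-(α * ⟪g, u⟫)) * (1 - ⟪s, x⟫) ≤ G * R * (1 + R / r) :=
        mul_le_mul (by linarith [hgw.1]) (by linarith) (by linarith) hGR.le
      have h9 : 0 ≤ (-(α * ⟪g, u⟫)) * (1 - ⟪s, x⟫) := mul_nonneg h3 (by linarith)
      constructor
      · linarith
      · have h10 : ⟪g, u⟫ * ((β - α) / β) ≤ 0 := mul_nonpos_of_nonpos_of_nonneg hneg.le h4
        linarith
    · have e : ⟪g, u - x⟫ - ⟪g, α • u - x⟫ = (1 - α) * ⟪g, u⟫ := by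
        simp only [inner_sub_right, inner_smul_right]
        ring
      rw [e]
      rw [not_lt] at hneg
      have h1 : 0 ≤ (1 - α) * ⟪g, u⟫ := mul_nonneg (by linarith) hneg
      constructor
      · linarith
      · nlinarith

/-- The number `n` of bisection steps, each with one oracle call, is logarithmic: a step halves an
interval of initial length `1`, down to a width of order `1 / (κ ^ 2 T)`. -/
lemma gaugePlay_cost_le (hd : 1 ≤ d) (hK : SetAssumption K r R) (hsep : IsSeparationOracle K sep)
    (Csep : ℕ) {T : ℕ} (hT : 1 ≤ T) {u : Vec d} (hu : ‖u‖ ≤ R) :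
    ∃ n : ℕ, (2 : ℝ) ^ n ≤ 4 * (R / r) ^ 2 * T ∧
      (gaugePlay sep Csep r T u).cost ≤ (n + 1) * (Csep + d + 4) + 6 * d + 8 := by
  have hr := hK.r_pos
  have hT' : (1 : ℝ) ≤ T := by exact_mod_cast hT
  have hc : (gaugePlay sep Csep r T u).cost
      = (gaugeDist sep Csep (1 / (T : ℝ)) r u).cost + 1 + d := by
    unfold gaugePlay
    simp only [bind_cost, addC_cost, divVecC_cost, pure_cost]
    ring
  rw [hc]
  by_cases huK : u ∈ K
  · refine ⟨0, ?_, ?_⟩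
    · have hκ : 1 ≤ R / r := (one_le_div hr).2 (hK.r_le_R hd)
      nlinarith [mul_le_mul hκ hκ zero_le_one (by positivity)]
    · rw [(gaugeDist_of_mem hsep Csep _ huK).2]
      omega
  · obtain ⟨α, β, n, -, -, -, -, -, -, -, h1, h2⟩ :=
      gaugeDist_of_notMem hK hsep Csep (ε := 1 / T) (by positivity)
        (by rw [div_le_one (by positivity)]; exact hT') huK
    refine ⟨n, h1.trans ?_, by omega⟩
    have e : 4 * ‖u‖ ^ 2 / (r ^ 2 * (1 / T)) = 4 * (‖u‖ / r) ^ 2 * T := by field_simp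
    rw [e]
    gcongr

end Round

/-! ### The tuned parameters -/

section Parameters

/-- What the choice of the step sizes `η` and `ν` achieves, for `κ ≥ 1` and
`L = log (1 + T / d)`. -/
structure TunedBounds (d T : ℕ) (G R κ η ν L : ℝ) : Prop where
  eta_pos : 0 < η
  nu_pos : 0 < ν
  log_pos : 0 < L
  half_le : (T : ℝ) ≤ (d + T) * L
  eta_kappa : η * (κ * (G * R)) ≤ 1 / 10
  nu_kappa : 20 * κ * (G * R) ≤ ν
  eta_mul_nu : (d : ℝ) ≤ η * ν
  eta_sqrt : η * (G * R) * T ≤ √(2 * d * T * L)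
  nu_log : ν * L ≤ G * R * (20 * κ * d * L + 3 / 4 * √(2 * d * T * L))
  log_div_eta : d * L / η ≤ G * R * (10 * κ * d * L + 1 / 2 * √(2 * d * T * L))
  dual : d * Real.log (1 + T * (η * (2 * κ * G) ^ 2 / (2 * ν / R ^ 2 * d))) ≤ d * L

lemma tunedBounds {d T : ℕ} (hd : 1 ≤ d) (hT : 1 ≤ T) {G R κ : ℝ} (hG : 0 < G) (hR : 0 < R)
    (hκ : 1 ≤ κ) : TunedBounds d T G R κ (etaParam d T G R κ) (nuParam d T G R κ)
      (Real.log (1 + T / d)) := by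
  have hd0 : (1 : ℝ) ≤ d := by exact_mod_cast hd
  have hT0 : (1 : ℝ) ≤ T := by exact_mod_cast hT
  have hdp : (0 : ℝ) < d := by linarith
  have hTp : (0 : ℝ) < T := by linarith
  have hTd : (0 : ℝ) < T / d := by positivity
  have hL : 0 < Real.log (1 + T / d) := Real.log_pos (by linarith)
  have hhalf : (T : ℝ) ≤ (d + T) * Real.log (1 + T / d) := by
    have h1 := Real.one_sub_inv_le_log_of_pos (by linarith : 0 < 1 + (T : ℝ) / d)
    have h2 : 1 - (1 + (T : ℝ) / d)⁻¹ = T / (d + T) := by field_simp; ring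
    rw [h2, div_le_iff₀ (by positivity)] at h1
    linarith
  have hGR : 0 < G * R := by positivity
  unfold etaParam nuParam
  set L := Real.log (1 + T / d) with hLdef
  set X := √(2 * d * T * L) with hX
  set A := √(2 * d * L / T) with hA
  set B := √(d * T / L) with hB
  have hκ0 : 0 < κ := by linarith
  have hA0 : 0 < A := Real.sqrt_pos.2 (by positivity)
  have hB0 : 0 < B := Real.sqrt_pos.2 (by positivity)
  have hX0 : 0 < X := Real.sqrt_pos.2 (by positivity)
  have hX2 : X ^ 2 = 2 * d * T * L := Real.sq_sqrt (by positivity)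
  have hA2 : A ^ 2 = 2 * d * L / T := Real.sq_sqrt (by positivity)
  have hB2 : B ^ 2 = d * T / L := Real.sq_sqrt (by positivity)
  have hAT : A * T = X := by
    rw [← sq_eq_sq₀ (by positivity) hX0.le, mul_pow, hA2, hX2]; field_simp
  have hBL : B * L ≤ 3 / 4 * X := by
    rw [← sq_le_sq₀ (by positivity) (by positivity), mul_pow, mul_pow, hB2, hX2]
    have e : d * T / L * L ^ 2 = d * T * L := by field_simp
    rw [e]
    have : 0 < d * T * L := by positivity
    linarith
  have hAB : (d : ℝ) ≤ A * B := by
    rw [← sq_le_sq₀ hdp.le (by positivity), mul_pow, hA2, hB2]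
    have e : 2 * d * L / T * (d * T / L) = 2 * (d : ℝ) ^ 2 := by field_simp
    rw [e]
    nlinarith
  have hXA : d * L / A = 1 / 2 * X := by
    rw [div_eq_iff hA0.ne', ← hAT]
    have e : 1 / 2 * (A * T) * A = 1 / 2 * T * A ^ 2 := by ring
    rw [e, hA2]; field_simp
  set a := min (1 / (10 * κ)) A with ha
  set b := max (20 * κ * d) B with hb
  have ha0 : 0 < a := lt_min (by positivity) hA0
  have hb0 : 0 < b := lt_of_lt_of_le hB0 (le_max_right _ _)
  have haκ : a * κ ≤ 1 / 10 := by
    have := min_le_left (1 / (10 * κ)) A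
    calc a * κ ≤ 1 / (10 * κ) * κ := mul_le_mul_of_nonneg_right this hκ0.le
      _ = 1 / 10 := by field_simp
  have hbκ : 20 * κ * d ≤ b := le_max_left _ _
  have hκd : 20 * κ ≤ 20 * κ * d := le_mul_of_one_le_right (by positivity) hd0
  have heG : 1 / (G * R) * a * (G * R) = a := by field_simp
  have hkb : κ ^ 2 * a ≤ κ / 10 := by nlinarith
  refine ⟨by positivity, by positivity, hL, hhalf, ?_, ?_, ?_, ?_, ?_, ?_, ?_⟩
  · have e : 1 / (G * R) * a * (κ * (G * R)) = a * κ := by field_simp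
    rw [e]; exact haκ
  · rw [mul_comm (20 * κ)]
    exact mul_le_mul_of_nonneg_left (hκd.trans hbκ) hGR.le
  · have e : 1 / (G * R) * a * (G * R * b) = a * b := by field_simp
    rw [e]
    rcases le_total (1 / (10 * κ)) A with h | h
    · rw [ha, min_eq_left h]
      calc (d : ℝ) ≤ 1 / (10 * κ) * (20 * κ * d) := by field_simp; linarith
        _ ≤ 1 / (10 * κ) * b := mul_le_mul_of_nonneg_left hbκ (by positivity)
    · rw [ha, min_eq_right h]
      exact hAB.trans (mul_le_mul_of_nonneg_left (le_max_right _ _) hA0.le)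
  · rw [heG, ← hX, ← hAT]
    exact mul_le_mul_of_nonneg_right (min_le_right _ _) hTp.le
  · rw [mul_assoc]
    refine mul_le_mul_of_nonneg_left ?_ hGR.le
    have : b ≤ 20 * κ * d + B := max_le (by linarith) (by nlinarith)
    nlinarith
  · have e : d * L / (1 / (G * R) * a) = G * R * (d * L / a) := by field_simp
    rw [e]
    refine mul_le_mul_of_nonneg_left ?_ hGR.le
    have h1 : 1 / a ≤ 10 * κ + 1 / A := by
      rcases le_total (1 / (10 * κ)) A with h | h
      · rw [ha, min_eq_left h, one_div_one_div]
        have : 0 < 1 / A := by positivity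
        linarith
      · rw [ha, min_eq_right h]
        linarith
    have h2 := mul_le_mul_of_nonneg_left h1 (by positivity : 0 ≤ d * L)
    rw [← hXA]
    have e1 : d * L / a = d * L * (1 / a) := by ring
    have e2 : 10 * κ * d * L + d * L / A = d * L * (10 * κ + 1 / A) := by ring
    rw [e1, e2]
    exact h2
  · refine mul_le_mul_of_nonneg_left ?_ hdp.le
    rw [hLdef]
    refine Real.log_le_log (by positivity) ?_
    have e : 1 / (G * R) * a * (2 * κ * G) ^ 2 / (2 * (G * R * b) / R ^ 2 * d)
        = 2 * (κ ^ 2 * a) / (b * d) := by field_simp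
    have h1 : 2 * (κ ^ 2 * a) / (b * d) ≤ 1 / d := by
      rw [div_le_div_iff₀ (by positivity) hdp]
      have h3 : 2 * (κ ^ 2 * a) ≤ b := by linarith
      have h4 := mul_le_mul_of_nonneg_right h3 hdp.le
      linarith
    rw [e]
    have h2 := mul_le_mul_of_nonneg_left h1 hTp.le
    have e2 : (T : ℝ) * (1 / d) = T / d := by ring
    linarith

lemma four_le_taylorOrder {a : ℝ} (ha : 4 ≤ a) {d T : ℕ} (hdT : 2 ≤ d * T) :
    4 ≤ taylorOrder a (1 / 2) d T := by
  have h2 : (2 : ℝ) ≤ d * T := by exact_mod_cast hdT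
  have h1 : 1 ≤ Real.logb (1 / 2 : ℝ)⁻¹ (d * T) := by
    rw [Real.le_logb_iff_rpow_le (by norm_num) (by linarith)]
    norm_num
    exact h2
  have h3 : ((4 : ℕ) : ℝ) ≤ a * Real.logb (1 / 2 : ℝ)⁻¹ (d * T) := by
    push_cast
    nlinarith
  have h4 := h3.trans (Nat.le_ceil (a * Real.logb (1 / 2 : ℝ)⁻¹ (d * T)))
  unfold taylorOrder
  exact_mod_cast h4

end Parameters

/-! ### Regret of the reduction -/

section Regret

variable {d : ℕ} {K : Set (Vec d)} {r R G : ℝ} {sep : Vec d → Bool × Vec d} {Csep T : ℕ}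
  {a : ℝ} {g : ℕ → Vec d}

/-- The loss vectors sent to Barrier-ONS. -/
def surrogate (a : ℝ) (sep : Vec d → Bool × Vec d) (Csep : ℕ) (r R G : ℝ) (T : ℕ)
    (g : ℕ → Vec d) (t : ℕ) : Vec d :=
  lossVec sep Csep r T
    (reductionState (tunedONS a d T G R (R / r)) sep Csep r T g t).val.u (g t)

/-- The states of Barrier-ONS inside the reduction. -/
def tunedSeq (a : ℝ) (sep : Vec d → Bool × Vec d) (Csep : ℕ) (r R G : ℝ) (T : ℕ)
    (g : ℕ → Vec d) : ℕ → OnsState d :=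
  onsSeq R (etaParam d T G R (R / r)) (nuParam d T G R (R / r)) (taylorOrder a (1 / 2) d T)
    (surrogate a sep Csep r R G T g)

lemma reductionState_val (t : ℕ) :
    (reductionState (tunedONS a d T G R (R / r)) sep Csep r T g t).val
      = tunedSeq a sep Csep r R G T g t := by
  induction t with
  | zero => rfl
  | succ t ih =>
    change (reductionRound _ sep Csep r T
      (reductionState (tunedONS a d T G R (R / r)) sep Csep r T g t).val (g t)).val = _
    rw [reductionRound_val]
    change onsUpdate _ _ _ _ _ (reductionState (tunedONS a d T G R (R / r)) sep Csep r T g t).val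
      (surrogate a sep Csep r R G T g t) = _
    rw [ih]
    rfl

lemma surrogate_eq (t : ℕ) : surrogate a sep Csep r R G T g t
    = lossVec sep Csep r T (tunedSeq a sep Csep r R G T g t).u (g t) := by
  rw [surrogate, reductionState_val]

lemma play_eq (t : ℕ) : play (tunedONS a d T G R (R / r)) sep Csep r T g t
    = (gaugePlay sep Csep r T (tunedSeq a sep Csep r R G T g t).u).val.1 := by
  rw [← reductionState_val]
  rfl

lemma norm_surrogate_le (hd : 1 ≤ d) (hT : 1 ≤ T) (hK : SetAssumption K r R)
    (hsep : IsSeparationOracle K sep) (hG : 0 < G) (hg : ∀ t < T, ‖g t‖ ≤ G) :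
    ∀ t < T, ‖surrogate a sep Csep r R G T g t‖ ≤ 2 * (R / r) * G := fun t ht =>
  norm_lossVec_le hd hK hsep Csep hT hG _ (hg t ht)

lemma surrogate_mul_le (hd : 1 ≤ d) (hT : 1 ≤ T) (hK : SetAssumption K r R) (hG : 0 < G) :
    2 * (R / r) * G * R ≤ nuParam d T G R (R / r) / 10 := by
  have := (tunedBounds hd hT hG hK.R_pos ((one_le_div hK.r_pos).2 (hK.r_le_R hd))).nu_kappa
  linarith

/-- In the relevant range, the iterates of Barrier-ONS stay in the open ball. -/
lemma tunedSeq_invariant (ha : 4 ≤ a) (hd : 1 ≤ d) (hT : 2 ≤ T) (hK : SetAssumption K r R)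
    (hsep : IsSeparationOracle K sep) (hG : 0 < G) (hg : ∀ t < T, ‖g t‖ ≤ G) :
    ∀ t ≤ T, 0 < R ^ 2 - ‖(tunedSeq a sep Csep r R G T g t).u‖ ^ 2 ∧
      0 < R ^ 2 - ‖(tunedSeq a sep Csep r R G T g t).z‖ ^ 2 := by
  intro t ht
  have hR := hK.R_pos
  have hb := tunedBounds hd (by omega : 1 ≤ T) hG hR ((one_le_div hK.r_pos).2 (hK.r_le_R hd))
  have h := (onsSeq_invariant hR hb.eta_pos.le hb.nu_pos
    (four_le_taylorOrder ha (by nlinarith : 2 ≤ d * T)) (fun t ht =>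
      (mul_le_mul_of_nonneg_right (norm_surrogate_le (a := a) (Csep := Csep) hd (by omega) hK hsep
        hG hg t ht) hR.le).trans (surrogate_mul_le hd (by omega) hK hG)) t ht).1
  exact ⟨h.gap_u, h.gap_z⟩

lemma norm_le_of_gap_pos {u : Vec d} (hR : 0 < R) (h : 0 < R ^ 2 - ‖u‖ ^ 2) : ‖u‖ ≤ R :=
  (abs_le_of_sq_le_sq' (by linarith) hR.le).2

/-- The quadratic term of the regret of Barrier-ONS is absorbed by the excess `q` of the surrogate
regret over the true instantaneous regret `p`. -/
lemma absorb_quadratic {p q η M κ E : ℝ} (hη : 0 ≤ η) (hκ : 1 ≤ κ) (hM : 0 ≤ M)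
    (hE0 : 0 ≤ E) (hp : |p| ≤ 2 * M) (hE : E ≤ M) (hq1 : -(E / 2) ≤ q) (hq2 : q ≤ 2 * κ * M)
    (hηκ : η * (κ * M) ≤ 1 / 10) :
    p ≤ p + q - η / 2 * (p + q) ^ 2 + (5 / 2 * η * M ^ 2 + E) := by
  have hκM : M ≤ κ * M := le_mul_of_one_le_left hM hκ
  have h4 : p ^ 2 ≤ 4 * M ^ 2 := by
    have := pow_le_pow_left₀ (abs_nonneg p) hp 2
    rw [sq_abs] at this
    linarith
  have h5 : (p + q) ^ 2 ≤ 5 * M ^ 2 + 5 * q ^ 2 := by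
    linarith [sq_nonneg (p - 4 * q), (by ring : (p - 4 * q) ^ 2 = p ^ 2 - 8 * (p * q) + 16 * q ^ 2),
      (by ring : (p + q) ^ 2 = p ^ 2 + 2 * (p * q) + q ^ 2)]
  have h6 := mul_le_mul_of_nonneg_left h5 (by positivity : 0 ≤ η / 2)
  have h7 : 5 / 2 * (η * q ^ 2) ≤ q + E := by
    rcases le_total 0 q with hq | hq
    · have h8 := mul_le_mul_of_nonneg_left hq2 hη
      have h9 : η * q * q ≤ 1 / 5 * q := mul_le_mul_of_nonneg_right (by linarith) hq
      linarith [(by ring : η * q * q = η * q ^ 2)]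
    · have h8 := mul_le_mul_of_nonneg_left (by linarith : -q ≤ 2 * (κ * M)) hη
      have h9 : η * (-q) * (-q) ≤ 1 / 5 * (-q) :=
        mul_le_mul_of_nonneg_right (by linarith) (by linarith)
      linarith [(by ring : η * (-q) * (-q) = η * q ^ 2)]
  linarith

/-- A comparator moved into the interior of the ball, where the barrier is at most
`log (1 + T / d)` above its minimum. -/
lemma exists_interior_comparator (hd : 1 ≤ d) (hT : 1 ≤ T) (hK : SetAssumption K r R) {x : Vec d}
    (hx : x ∈ K) :
    ∃ x' ∈ K, 0 < R ^ 2 - ‖x'‖ ^ 2 ∧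
      Real.log (R ^ 2) - Real.log (R ^ 2 - ‖x'‖ ^ 2) ≤ Real.log (1 + T / d) ∧
      ∀ (G : ℝ) (v : Vec d), ‖v‖ ≤ G → ⟪v, x' - x⟫ ≤ d * (G * R) / T := by
  have hR := hK.R_pos
  have hd0 : (1 : ℝ) ≤ d := by exact_mod_cast hd
  have hT0 : (1 : ℝ) ≤ T := by exact_mod_cast hT
  set δ : ℝ := d / (d + T) with hδ
  have hδ0 : 0 < δ := by positivity
  have hδ1 : δ < 1 := by rw [hδ, div_lt_one (by positivity)]; linarith
  have hxn := hK.norm_le hx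
  have hgap : R ^ 2 * δ ≤ R ^ 2 - ‖(1 - δ) • x‖ ^ 2 := by
    rw [norm_smul, Real.norm_of_nonneg (by linarith), mul_pow]
    have h1 : ‖x‖ ^ 2 ≤ R ^ 2 := pow_le_pow_left₀ (norm_nonneg _) hxn 2
    nlinarith [mul_le_mul_of_nonneg_left h1 (sq_nonneg (1 - δ)),
      mul_nonneg (sq_nonneg R) (mul_nonneg hδ0.le (by linarith : 0 ≤ 1 - δ))]
  refine ⟨(1 - δ) • x, ?_, lt_of_lt_of_le (by positivity) hgap, ?_, ?_⟩
  · have := hK.convex hK.zero_mem hx hδ0.le (by linarith : 0 ≤ 1 - δ) (by ring)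
    simpa using this
  · have h1 := Real.log_le_log (by positivity) hgap
    rw [Real.log_mul (by positivity) hδ0.ne'] at h1
    have h2 : -Real.log δ = Real.log (1 + T / d) := by
      rw [← Real.log_inv, hδ, inv_div]
      congr 1
      field_simp
    linarith
  · intro G v hv
    have e : (1 - δ) • x - x = -(δ • x) := by rw [sub_smul, one_smul]; abel
    rw [e, inner_neg_right, inner_smul_right]
    have hGR : 0 ≤ G * R := mul_nonneg ((norm_nonneg _).trans hv) hR.le
    have h1 := mul_le_mul_of_nonneg_left (abs_le.1 (abs_inner_le_mul hv hxn)).1 hδ0.le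
    have h2 : δ ≤ d / T := div_le_div_of_nonneg_left (by linarith) (by linarith) (by linarith)
    have h3 := mul_le_mul_of_nonneg_right h2 hGR
    rw [div_mul_eq_mul_div (d : ℝ) T] at h3
    linarith

/-- The trivial regret bound suffices for `T ≤ d`. -/
lemma sum_inner_le_of_le_dim (hd : 1 ≤ d) (hT : 1 ≤ T) (hTd : T ≤ d) (hK : SetAssumption K r R)
    (hG : 0 < G) (hg : ∀ t < T, ‖g t‖ ≤ G) {w : ℕ → Vec d} (hw : ∀ t, w t ∈ K) {x : Vec d}
    (hx : x ∈ K) :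
    ∑ t ∈ Finset.range T, ⟪g t, w t - x⟫
      ≤ 5 * G * R * √(2 * d * T * Real.log (1 + T / d)) := by
  have hR := hK.R_pos
  have hb := tunedBounds hd hT hG hR ((one_le_div hK.r_pos).2 (hK.r_le_R hd))
  have hT0 : (1 : ℝ) ≤ T := by exact_mod_cast hT
  have hTd' : (T : ℝ) ≤ d := by exact_mod_cast hTd
  have hL := hb.log_pos
  have hGR : 0 < G * R := by positivity
  have h1 : ∑ t ∈ Finset.range T, ⟪g t, w t - x⟫ ≤ T * (G * (R + R)) := by
    have : ∀ t ∈ Finset.range T, ⟪g t, w t - x⟫ ≤ G * (R + R) := by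
      intro t ht
      exact (le_abs_self _).trans (abs_inner_le_mul (hg t (Finset.mem_range.1 ht))
        ((norm_sub_le _ _).trans (add_le_add (hK.norm_le (hw t)) (hK.norm_le hx))))
    refine (Finset.sum_le_sum this).trans ?_
    simp
  have h2 : (T : ℝ) ≤ √(2 * d * T * Real.log (1 + T / d)) := by
    refine Real.le_sqrt_of_sq_le ?_
    have h3 := hb.half_le
    have h4 : (T : ℝ) ≤ 2 * d * Real.log (1 + T / d) := by nlinarith
    nlinarith
  have h3 := mul_le_mul_of_nonneg_left h2 hGR.le
  linarith [mul_pos hGR (by linarith : (0 : ℝ) < T)]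

/-- The regret of the reduction. -/
theorem tuned_regret (ha : 4 ≤ a) (hd : 1 ≤ d) (hT : 1 ≤ T) (hK : SetAssumption K r R)
    (hsep : IsSeparationOracle K sep) (hG : 0 < G) (hg : ∀ t < T, ‖g t‖ ≤ G) {x : Vec d}
    (hx : x ∈ K) :
    ∑ t ∈ Finset.range T, ⟪g t, play (tunedONS a d T G R (R / r)) sep Csep r T g t - x⟫ ≤
      5 * G * R * √(2 * d * T * Real.log (1 + T / d))
        + 66 * G * R * (R / r) * d * Real.log (1 + T / d) := by
  have hR := hK.R_pos
  have hr := hK.r_pos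
  have hκ : 1 ≤ R / r := (one_le_div hr).2 (hK.r_le_R hd)
  have hb := tunedBounds hd hT hG hR hκ
  have hd0 : (1 : ℝ) ≤ d := by exact_mod_cast hd
  have hT0 : (1 : ℝ) ≤ T := by exact_mod_cast hT
  have hL := hb.log_pos
  have hGR : 0 < G * R := by positivity
  have hκdL : 0 < R / r * d * Real.log (1 + T / d) := by positivity
  have hplay : ∀ t, play (tunedONS a d T G R (R / r)) sep Csep r T g t ∈ K := fun t => by
    rw [play_eq]; exact gaugePlay_mem hK hsep Csep hT _
  rcases le_or_gt T d with hTd | hTd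
  · refine (sum_inner_le_of_le_dim hd hT hTd hK hG hg hplay hx).trans (le_add_of_nonneg_right ?_)
    positivity
  · have hT2 : 2 ≤ T := by omega
    have hTd' : (d : ℝ) < T := by exact_mod_cast hTd
    have hL2 : 1 / 2 ≤ Real.log (1 + T / d) := by
      have h3 := hb.half_le
      by_contra hc
      push Not at hc
      nlinarith
    set L := Real.log (1 + T / d) with hLdef
    set η := etaParam d T G R (R / r) with hη
    set ν := nuParam d T G R (R / r) with hν
    set X := √(2 * d * T * L) with hX
    have hX0 : 0 ≤ X := Real.sqrt_nonneg _
    set gt := surrogate a sep Csep r R G T g with hgt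
    set u : ℕ → Vec d := fun t => (tunedSeq a sep Csep r R G T g t).u with hu
    set w := play (tunedONS a d T G R (R / r)) sep Csep r T g with hw
    obtain ⟨x', hx'K, hgap0, hlog, hx'x⟩ := exists_interior_comparator hd hT hK hx
    have hΓ := norm_surrogate_le (a := a) (Csep := Csep) hd hT hK hsep hG hg
    have hΓν : ∀ t < T, ‖gt t‖ * R ≤ ν / 10 := fun t ht =>
      (mul_le_mul_of_nonneg_right (hΓ t ht) hR.le).trans (surrogate_mul_le hd hT hK hG)
    have hm : 4 ≤ taylorOrder a (1 / 2) d T := four_le_taylorOrder ha (by nlinarith)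
    have hreg := onsSeq_regret hR hb.eta_pos.le hb.nu_pos hm hΓν hgap0
    change ∑ t ∈ Finset.range T, ⟪gt t, u t - x'⟫ ≤ _ + η / 2 * ∑ t ∈ Finset.range T,
      ⟪gt t, u t - x'⟫ ^ 2 + _ at hreg
    have hdual := (sum_dualSqSeq_le (m := taylorOrder a (1 / 2) d T) hd hR hb.eta_pos hb.nu_pos
      hΓ).trans hb.dual
    set D := ∑ t ∈ Finset.range T, dualSqSeq R η ν (taylorOrder a (1 / 2) d T) gt t with hD
    change η * D ≤ d * L at hdual
    have hη0 : 0 < η := hb.eta_pos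
    have hD2 : D ≤ G * R * (10 * (R / r) * d * L + 1 / 2 * X) := by
      refine le_trans ?_ hb.log_div_eta
      rw [le_div_iff₀ hη0]
      linarith
    have hinv := tunedSeq_invariant (Csep := Csep) ha hd hT2 hK hsep hG hg
    -- the quadratic term is absorbed by the difference between surrogate and true regret
    have hround : ∀ t ∈ Finset.range T, ⟪g t, w t - x'⟫ ≤ ⟪gt t, u t - x'⟫
        - η / 2 * ⟪gt t, u t - x'⟫ ^ 2 + (5 / 2 * η * (G * R) ^ 2 + G * R / T) := by
      intro t ht
      rw [Finset.mem_range] at ht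
      obtain ⟨h1, h2⟩ := lossVec_regret hd hK hsep Csep hT hG
        (norm_le_of_gap_pos hR (hinv t ht.le).1) (hg t ht) hx'K
      rw [← surrogate_eq, ← play_eq] at h1 h2
      change -_ ≤ ⟪gt t, u t - x'⟫ - ⟪g t, w t - x'⟫ at h1
      change ⟪gt t, u t - x'⟫ - ⟪g t, w t - x'⟫ ≤ _ at h2
      have h3 : |⟪g t, w t - x'⟫| ≤ G * (R + R) := abs_inner_le_mul (hg t ht)
        ((norm_sub_le _ _).trans (add_le_add (hK.norm_le (hplay t)) (hK.norm_le hx'K)))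
      generalize ⟪gt t, u t - x'⟫ = y at *
      generalize ⟪g t, w t - x'⟫ = p at *
      obtain ⟨q, rfl⟩ : ∃ q, y = p + q := ⟨y - p, by ring⟩
      rw [add_sub_cancel_left] at h1 h2
      exact absorb_quadratic hη0.le hκ hGR.le (by positivity) (by linarith) (div_le_self hGR.le hT0)
        (by rwa [(by field_simp : G * R / T / 2 = G * R / (2 * T))]) h2 hb.eta_kappa
    have hsum := Finset.sum_le_sum hround
    rw [Finset.sum_add_distrib, Finset.sum_sub_distrib, ← Finset.mul_sum, Finset.sum_const,
      Finset.card_range, nsmul_eq_mul] at hsum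
    have e1 : (T : ℝ) * (5 / 2 * η * (G * R) ^ 2 + G * R / T)
        = 5 / 2 * (G * R) * (η * (G * R) * T) + G * R := by field_simp
    rw [e1] at hsum
    have h8 := mul_le_mul_of_nonneg_left hb.eta_sqrt hGR.le
    change G * R * (η * (G * R) * T) ≤ G * R * X at h8
    have h9 : ν * (Real.log (R ^ 2) - Real.log (R ^ 2 - ‖x'‖ ^ 2))
        ≤ G * R * (20 * (R / r) * d * L + 3 / 4 * X) :=
      (mul_le_mul_of_nonneg_left hlog hb.nu_pos.le).trans hb.nu_log
    have hshift : ∑ t ∈ Finset.range T, ⟪g t, w t - x⟫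
        ≤ ∑ t ∈ Finset.range T, ⟪g t, w t - x'⟫ + d * (G * R) := by
      have h10 : ∀ t ∈ Finset.range T, ⟪g t, w t - x⟫ ≤ ⟪g t, w t - x'⟫ + d * (G * R) / T := by
        intro t ht
        have := hx'x G (g t) (hg t (Finset.mem_range.1 ht))
        rw [← sub_add_sub_cancel (w t) x' x, inner_add_right]
        linarith
      refine (Finset.sum_le_sum h10).trans (le_of_eq ?_)
      rw [Finset.sum_add_distrib, Finset.sum_const, Finset.card_range, nsmul_eq_mul]
      field_simp
    have hdκ : (d : ℝ) ≤ 2 * (R / r * d * L) := by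
      have : (d : ℝ) * 1 ≤ d * (R / r * (2 * L)) := by
        refine mul_le_mul_of_nonneg_left ?_ (by linarith)
        nlinarith
      linarith
    have h12 : G * R * (1 + d) ≤ G * R * (4 * (R / r * d * L)) :=
      mul_le_mul_of_nonneg_left (by linarith) hGR.le
    have h13 : 0 ≤ G * R * X := by positivity
    have h14 : 0 ≤ G * R * (R / r * d * L) := by positivity
    linarith

end Regret

/-! ### Construction of straight-line programs -/

section Programs

variable {ι : Type}

lemma runInstrs_append (x : ι → ℝ) (L₁ L₂ : List (Instr ι)) (mem : List ℝ) :
    runInstrs x (L₁ ++ L₂) mem = (runInstrs x L₁ mem).bind (runInstrs x L₂) := by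
  induction L₁ generalizing mem with
  | nil => rfl
  | cons I L ih =>
    simp only [List.cons_append, runInstrs]
    cases I.eval x mem with
    | none => rfl
    | some v => simpa using ih _

lemma runInstrs_eq_append {x : ι → ℝ} {L : List (Instr ι)} {mem mem' : List ℝ}
    (h : runInstrs x L mem = some mem') : ∃ t, mem' = mem ++ t ∧ t.length = L.length := by
  induction L generalizing mem with
  | nil =>
    simp only [runInstrs, Option.some.injEq] at h
    exact ⟨[], by simp [h], rfl⟩
  | cons I L ih =>
    simp only [runInstrs] at h
    obtain ⟨v, -, h2⟩ := Option.bind_eq_some_iff.1 h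
    obtain ⟨t, rfl, ht⟩ := ih h2
    exact ⟨v :: t, by simp, by simp [ht]⟩

lemma Operand.read_append {o : Operand ι} {x : ι → ℝ} {mem : List ℝ} {v : ℝ}
    (h : o.read x mem = some v) (t : List ℝ) : o.read x (mem ++ t) = some v := by
  cases o with
  | input i => exact h
  | const c => exact h
  | step k =>
    simp only [Operand.read] at h ⊢
    rw [List.getElem?_append_left (List.getElem?_eq_some_iff.1 h).1]
    exact h

/-- The instructions `L` can be executed on all inputs in `D`. -/
def Runs (D : Set (ι → ℝ)) (L : List (Instr ι)) : Prop :=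
  ∀ x ∈ D, ∃ mem, runInstrs x L [] = some mem

/-- After execution of the instructions `L` on an input in `D`, some operand holds the value of
`f`. -/
def Avail (D : Set (ι → ℝ)) (L : List (Instr ι)) (f : (ι → ℝ) → ℝ) : Prop :=
  ∃ o : Operand ι, ∀ x ∈ D, ∃ mem, runInstrs x L [] = some mem ∧ o.read x mem = some (f x)

/-- All entries of a matrix are available. -/
def AvailMat {m n : Type*} (D : Set (ι → ℝ)) (L : List (Instr ι))
    (M : (ι → ℝ) → Matrix m n ℝ) : Prop :=
  ∀ i j, Avail D L fun x => M x i j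

/-- `L'` extends `L` by at most `n` further instructions. -/
structure Extends (D : Set (ι → ℝ)) (L : List (Instr ι)) (n : ℕ) (L' : List (Instr ι)) : Prop where
  pre : L <+: L'
  runs : Runs D L'
  length_le : L'.length ≤ L.length + n

variable {D : Set (ι → ℝ)} {L L' L'' : List (Instr ι)}

lemma Extends.refl (h : Runs D L) : Extends D L 0 L := ⟨List.prefix_rfl, h, le_rfl⟩

lemma Extends.trans {m n : ℕ} (h : Extends D L n L') (h' : Extends D L' m L'') :
    Extends D L (n + m) L'' :=
  ⟨h.pre.trans h'.pre, h'.runs, by have := h.length_le; have := h'.length_le; omega⟩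

lemma Avail.mono {n : ℕ} {f : (ι → ℝ) → ℝ} (hf : Avail D L f) (h : Extends D L n L') :
    Avail D L' f := by
  obtain ⟨o, ho⟩ := hf
  obtain ⟨t, rfl⟩ := h.pre
  refine ⟨o, fun x hx => ?_⟩
  obtain ⟨mem, h1, h2⟩ := ho x hx
  obtain ⟨mem', h3⟩ := h.runs x hx
  refine ⟨mem', h3, ?_⟩
  rw [runInstrs_append, h1] at h3
  obtain ⟨u, rfl, -⟩ := runInstrs_eq_append h3
  exact Operand.read_append h2 u

lemma AvailMat.mono {m n : Type*} {k : ℕ} {M : (ι → ℝ) → Matrix m n ℝ} (hf : AvailMat D L M)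
    (h : Extends D L k L') : AvailMat D L' M := fun i j => (hf i j).mono h

lemma avail_const (h : Runs D L) (c : ℝ) : Avail D L fun _ => c :=
  ⟨.const c, fun x hx => by obtain ⟨mem, hm⟩ := h x hx; exact ⟨mem, hm, rfl⟩⟩

/-- One more arithmetic operation. -/
lemma exists_extends_op (op : ArithOp) {f g F : (ι → ℝ) → ℝ} (hf : Avail D L f)
    (hg : Avail D L g) (hF : ∀ x ∈ D, op.eval (f x) (g x) = some (F x)) :
    ∃ L', Extends D L 1 L' ∧ Avail D L' F := by
  obtain ⟨o₁, h₁⟩ := hf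
  obtain ⟨o₂, h₂⟩ := hg
  have key : ∀ x ∈ D, ∃ mem, mem.length = L.length ∧
      runInstrs x (L ++ [⟨op, o₁, o₂⟩]) [] = some (mem ++ [F x]) := by
    intro x hx
    obtain ⟨mem, hm, hr⟩ := h₁ x hx
    obtain ⟨mem', hm', hr'⟩ := h₂ x hx
    obtain rfl : mem = mem' := by rw [hm] at hm'; exact Option.some.inj hm'
    refine ⟨mem, ?_, ?_⟩
    · obtain ⟨t, rfl, ht⟩ := runInstrs_eq_append hm
      simpa using ht
    · rw [runInstrs_append, hm]
      simp [runInstrs, Instr.eval, hr, hr', hF x hx]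
  refine ⟨L ++ [⟨op, o₁, o₂⟩], ⟨List.prefix_append _ _, ?_, by simp⟩, .step L.length, ?_⟩
  · intro x hx
    obtain ⟨mem, -, h2⟩ := key x hx
    exact ⟨_, h2⟩
  · intro x hx
    obtain ⟨mem, h1, h2⟩ := key x hx
    exact ⟨_, h2, by simp [Operand.read, ← h1]⟩

/-- Values that can each be computed with `n` operations can be computed together. -/
lemma exists_extends_forall {κ : Type*} [Fintype κ] {n : ℕ} {F : κ → (ι → ℝ) → ℝ} (h : Runs D L)
    (hF : ∀ k L₁ N, Extends D L N L₁ → ∃ L', Extends D L₁ n L' ∧ Avail D L' (F k)) :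
    ∃ L', Extends D L (Fintype.card κ * n) L' ∧ ∀ k, Avail D L' (F k) := by
  classical
  have key : ∀ s : Finset κ, ∃ L', Extends D L (s.card * n) L' ∧ ∀ k ∈ s, Avail D L' (F k) := by
    intro s
    induction s using Finset.induction_on with
    | empty => exact ⟨L, by simpa using Extends.refl h, by simp⟩
    | insert k s hk ih =>
      obtain ⟨L₁, h1, h2⟩ := ih
      obtain ⟨L₂, h3, h4⟩ := hF k L₁ _ h1
      refine ⟨L₂, ?_, ?_⟩
      · rw [Finset.card_insert_of_notMem hk, add_mul, one_mul]
        exact h1.trans h3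
      · intro j hj
        rcases Finset.mem_insert.1 hj with rfl | hj
        · exact h4
        · exact (h2 j hj).mono h3
  obtain ⟨L', h1, h2⟩ := key Finset.univ
  exact ⟨L', h1, fun k => h2 k (Finset.mem_univ k)⟩

/-- Entrywise operations on matrices. -/
lemma exists_extends_matOp {m n : Type*} [Fintype m] [Fintype n] (h : Runs D L) (op : ArithOp)
    {A B M : (ι → ℝ) → Matrix m n ℝ} (hA : AvailMat D L A) (hB : AvailMat D L B)
    (hM : ∀ x ∈ D, ∀ i j, op.eval (A x i j) (B x i j) = some (M x i j)) :
    ∃ L', Extends D L (Fintype.card m * Fintype.card n) L' ∧ AvailMat D L' M := by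
  obtain ⟨L', h1, h2⟩ := exists_extends_forall (κ := m × n) (n := 1)
    (F := fun k x => M x k.1 k.2) h (fun k L₁ N hL => exists_extends_op op
      ((hA k.1 k.2).mono hL) ((hB k.1 k.2).mono hL) (fun x hx => hM x hx k.1 k.2))
  rw [Fintype.card_prod, mul_one] at h1
  exact ⟨L', h1, fun i j => h2 (i, j)⟩

lemma exists_extends_neg {m n : Type*} [Fintype m] [Fintype n] (h : Runs D L)
    {A : (ι → ℝ) → Matrix m n ℝ} (hA : AvailMat D L A) :
    ∃ L', Extends D L (Fintype.card m * Fintype.card n) L' ∧ AvailMat D L' fun x => -A x :=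
  exists_extends_matOp (A := fun _ => 0) h .sub (fun _ _ => avail_const h 0) hA
    (fun x _ i j => by simp [ArithOp.eval])

/-- Inline an operand of a subroutine whose inputs are the operands `o`, and whose memory starts at
address `n`. -/
def Operand.inline {ι' : Type} (o : ι' → Operand ι) (n : ℕ) : Operand ι' → Operand ι
  | .input i => o i
  | .const c => .const c
  | .step k => .step (n + k)

/-- Inline an instruction of a subroutine. -/
def Instr.inline {ι' : Type} (o : ι' → Operand ι) (n : ℕ) (I : Instr ι') : Instr ι :=
  ⟨I.op, I.lhs.inline o n, I.rhs.inline o n⟩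

lemma read_inline {ι' : Type} {o : ι' → Operand ι} {x : ι → ℝ} {y : ι' → ℝ} {mem₀ : List ℝ}
    (ho : ∀ i, (o i).read x mem₀ = some (y i)) {p : Operand ι'} {mem : List ℝ} {v : ℝ}
    (h : p.read y mem = some v) : (p.inline o mem₀.length).read x (mem₀ ++ mem) = some v := by
  cases p with
  | input i =>
    simp only [Operand.read] at h
    exact h ▸ Operand.read_append (ho i) mem
  | const c => exact h
  | step k =>
    simp only [Operand.read, Operand.inline] at h ⊢
    rw [List.getElem?_append_right (by omega), Nat.add_sub_cancel_left]
    exact h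

lemma runInstrs_inline {ι' : Type} {o : ι' → Operand ι} {x : ι → ℝ} {y : ι' → ℝ} {mem₀ : List ℝ}
    (ho : ∀ i, (o i).read x mem₀ = some (y i)) {P : List (Instr ι')} {mem mem' : List ℝ}
    (h : runInstrs y P mem = some mem') :
    runInstrs x (P.map (Instr.inline o mem₀.length)) (mem₀ ++ mem) = some (mem₀ ++ mem') := by
  induction P generalizing mem with
  | nil =>
    simp only [runInstrs, Option.some.injEq] at h
    simp [runInstrs, h]
  | cons I P ih =>
    simp only [runInstrs, List.map_cons] at h ⊢
    obtain ⟨v, h1, h2⟩ := Option.bind_eq_some_iff.1 h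
    have h3 : (I.inline o mem₀.length).eval x (mem₀ ++ mem) = some v := by
      unfold Instr.eval at h1 ⊢
      obtain ⟨a, ha, h4⟩ := Option.bind_eq_some_iff.1 h1
      obtain ⟨b, hb, h5⟩ := Option.bind_eq_some_iff.1 h4
      simp only [Instr.inline]
      rw [read_inline ho ha, read_inline ho hb]
      exact h5
    rw [h3, Option.bind_some, List.append_assoc]
    exact ih h2

/-- Call of a subroutine. -/
lemma exists_extends_call {ι' κ' : Type} [Nonempty κ'] (h : Runs D L) (P : ArithProg ι' κ')
    {y : (ι → ℝ) → ι' → ℝ} {F : κ' → (ι → ℝ) → ℝ} (hy : ∀ i, Avail D L fun x => y x i)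
    (hP : ∀ x ∈ D, ∀ k, P.output (y x) k = some (F k x)) :
    ∃ L', Extends D L P.size L' ∧ ∀ k, Avail D L' (F k) := by
  choose o ho using hy
  set Q := P.instrs.map (Instr.inline o L.length) with hQ
  have key : ∀ x ∈ D, ∃ mem₀ mem', mem₀.length = L.length ∧
      runInstrs (y x) P.instrs [] = some mem' ∧
      runInstrs x (L ++ Q) [] = some (mem₀ ++ mem') ∧
      ∀ i, (o i).read x mem₀ = some (y x i) := by
    intro x hx
    obtain ⟨mem₀, hm⟩ := h x hx
    have hlen : mem₀.length = L.length := by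
      obtain ⟨t, rfl, ht⟩ := runInstrs_eq_append hm
      simpa using ht
    have hread : ∀ i, (o i).read x mem₀ = some (y x i) := by
      intro i
      obtain ⟨mem, h1, h2⟩ := ho i x hx
      obtain rfl : mem₀ = mem := by rw [hm] at h1; exact Option.some.inj h1
      exact h2
    obtain ⟨mem', h1, -⟩ := Option.bind_eq_some_iff.1 (hP x hx (Classical.arbitrary κ'))
    refine ⟨mem₀, mem', hlen, h1, ?_, hread⟩
    have := runInstrs_inline hread h1
    rw [List.append_nil, hlen] at this
    rw [runInstrs_append, hm]
    exact this
  refine ⟨L ++ Q, ⟨List.prefix_append _ _, ?_, ?_⟩, fun k => ⟨(P.out k).inline o L.length, ?_⟩⟩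
  · intro x hx
    obtain ⟨mem₀, mem', -, -, h1, -⟩ := key x hx
    exact ⟨_, h1⟩
  · simp [hQ, ArithProg.size]
  · intro x hx
    obtain ⟨mem₀, mem', h0, h1, h2, h3⟩ := key x hx
    refine ⟨_, h2, ?_⟩
    have h4 := hP x hx k
    rw [ArithProg.output, h1, Option.bind_some] at h4
    rw [← h0]
    exact read_inline h3 h4

/-- Products of square matrices. -/
lemma exists_extends_mul {N c : ℕ} (hN : 0 < N)
    (hP : ∃ P : ArithProg ((Fin N × Fin N) ⊕ (Fin N × Fin N)) (Fin N × Fin N),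
      P.Multiplies ∧ P.size ≤ c)
    (h : Runs D L) {A B : (ι → ℝ) → Mat N} (hA : AvailMat D L A) (hB : AvailMat D L B) :
    ∃ L', Extends D L c L' ∧ AvailMat D L' fun x => A x * B x := by
  obtain ⟨P, hmul, hsize⟩ := hP
  have : Nonempty (Fin N × Fin N) := ⟨(⟨0, hN⟩, ⟨0, hN⟩)⟩
  obtain ⟨L', h1, h2⟩ := exists_extends_call h P
    (y := fun x => Sum.elim (fun p => A x p.1 p.2) (fun p => B x p.1 p.2))
    (F := fun k x => (A x * B x) k.1 k.2)
    (fun i => by rcases i with p | p; exacts [hA p.1 p.2, hB p.1 p.2])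
    (fun x _ k => hmul (A x) (B x) k)
  exact ⟨L', ⟨h1.pre, h1.runs, h1.length_le.trans (by omega)⟩, fun i j => h2 (i, j)⟩

end Programs

/-! ### Inversion of positive definite matrices by block elimination -/

section Inversion

lemma inv_fromBlocks {m n : Type*} [Fintype m] [DecidableEq m] [Fintype n] [DecidableEq n]
    {A : Matrix m m ℝ} {B : Matrix m n ℝ} {C : Matrix n m ℝ} {D : Matrix n n ℝ} (hA : IsUnit A)
    (hS : IsUnit (D - C * (A⁻¹ * B))) :
    (Matrix.fromBlocks A B C D)⁻¹ = Matrix.fromBlocks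
      (A⁻¹ + A⁻¹ * B * (D - C * (A⁻¹ * B))⁻¹ * (C * A⁻¹))
      (-(A⁻¹ * B * (D - C * (A⁻¹ * B))⁻¹)) (-((D - C * (A⁻¹ * B))⁻¹ * (C * A⁻¹)))
      (D - C * (A⁻¹ * B))⁻¹ := by
  let _ := hA.invertible
  have e : D - C * (A⁻¹ * B) = D - C * ⅟A * B := by
    rw [Matrix.invOf_eq_nonsing_inv, Matrix.mul_assoc]
  rw [e] at hS ⊢
  let _ := hS.invertible
  let _ := Matrix.fromBlocks₁₁Invertible A B C D
  rw [← Matrix.invOf_eq_nonsing_inv, Matrix.invOf_fromBlocks₁₁_eq, ← Matrix.invOf_eq_nonsing_inv,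
    ← Matrix.invOf_eq_nonsing_inv]
  simp only [Matrix.mul_assoc]

/-- The Schur complement of a positive definite block matrix is positive definite. -/
lemma schur_posDef {m n : Type*} [Fintype m] [DecidableEq m] [Fintype n] [DecidableEq n]
    {A : Matrix m m ℝ} {B : Matrix m n ℝ} {C : Matrix n m ℝ} {D : Matrix n n ℝ}
    (h : (Matrix.fromBlocks A B C D).PosDef) : A.PosDef ∧ (D - C * (A⁻¹ * B)).PosDef := by
  have hA : A.PosDef := h.submatrix (e := Sum.inl) Sum.inl_injective
  have hC : C = B.conjTranspose := by
    have := h.1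
    rw [Matrix.isHermitian_fromBlocks_iff] at this
    exact this.2.1.symm
  refine ⟨hA, ?_⟩
  let _ := hA.isUnit.invertible
  have h1 := h.det_pos
  rw [Matrix.det_fromBlocks₁₁, Matrix.invOf_eq_nonsing_inv, Matrix.mul_assoc] at h1
  subst hC
  have h2 := (Matrix.PosDef.fromBlocks₁₁ B D hA).1 h.posSemidef
  rw [Matrix.mul_assoc] at h2
  exact h2.posDef_iff_det_ne_zero.2 (right_ne_zero_of_mul h1.ne')

/-- The number of operations of the inversion of `2 ^ k × 2 ^ k` matrices, when `μ N` operations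
multiply `N × N` matrices. -/
def invCost (μ : ℕ → ℕ) : ℕ → ℕ
  | 0 => 1
  | k + 1 => 2 * invCost μ k + 6 * μ (2 ^ k) + 4 * (2 ^ k * 2 ^ k)

variable {ι : Type} {D : Set (ι → ℝ)} {L : List (Instr ι)}

lemma AvailMat.submatrix {m n m' n' : Type*} {M : (ι → ℝ) → Matrix m n ℝ} (h : AvailMat D L M)
    (e : m' → m) (f : n' → n) : AvailMat D L fun x => (M x).submatrix e f :=
  fun i j => h (e i) (f j)

lemma AvailMat.congr {m n : Type*} {M M' : (ι → ℝ) → Matrix m n ℝ} (h : AvailMat D L M)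
    (hM : ∀ x ∈ D, M x = M' x) : AvailMat D L M' := by
  intro i j
  obtain ⟨o, ho⟩ := h i j
  refine ⟨o, fun x hx => ?_⟩
  have := ho x hx
  dsimp only at this ⊢
  rwa [hM x hx] at this

lemma AvailMat.fromBlocks {m n m' n' : Type*} {A : (ι → ℝ) → Matrix m m' ℝ}
    {B : (ι → ℝ) → Matrix m n' ℝ} {C : (ι → ℝ) → Matrix n m' ℝ} {E : (ι → ℝ) → Matrix n n' ℝ}
    (hA : AvailMat D L A) (hB : AvailMat D L B) (hC : AvailMat D L C) (hE : AvailMat D L E) :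
    AvailMat D L fun x => Matrix.fromBlocks (A x) (B x) (C x) (E x) := by
  rintro (i | i) (j | j)
  exacts [hA i j, hB i j, hC i j, hE i j]

/-- Block elimination: two inversions and six products of blocks. -/
lemma exists_extends_inv_fromBlocks {N c μ : ℕ} (hN : 0 < N)
    (hμ : ∃ P : ArithProg ((Fin N × Fin N) ⊕ (Fin N × Fin N)) (Fin N × Fin N),
      P.Multiplies ∧ P.size ≤ μ)
    (hinv : ∀ (L : List (Instr ι)) (M : (ι → ℝ) → Mat N), Runs D L → AvailMat D L M →
      (∀ x ∈ D, (M x).PosDef) → ∃ L', Extends D L c L' ∧ AvailMat D L' fun x => (M x)⁻¹)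
    (hL : Runs D L) {A B C E : (ι → ℝ) → Mat N} (hA : AvailMat D L A) (hB : AvailMat D L B)
    (hC : AvailMat D L C) (hE : AvailMat D L E)
    (hpos : ∀ x ∈ D, (Matrix.fromBlocks (A x) (B x) (C x) (E x)).PosDef) :
    ∃ L', Extends D L (2 * c + 6 * μ + 4 * (N * N)) L' ∧
      AvailMat D L' fun x => (Matrix.fromBlocks (A x) (B x) (C x) (E x))⁻¹ := by
  obtain ⟨L₁, e₁, hA'⟩ := hinv L A hL hA fun x hx => (schur_posDef (hpos x hx)).1
  obtain ⟨L₂, e₂, hX⟩ := exists_extends_mul hN hμ e₁.runs hA' (hB.mono e₁)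
  obtain ⟨L₃, e₃, hY⟩ := exists_extends_mul hN hμ e₂.runs (hC.mono (e₁.trans e₂)) (hA'.mono e₂)
  obtain ⟨L₄, e₄, hZ⟩ := exists_extends_mul hN hμ e₃.runs (hC.mono ((e₁.trans e₂).trans e₃))
    (hX.mono e₃)
  obtain ⟨L₅, e₅, hS⟩ := exists_extends_matOp (M := fun x => E x - C x * ((A x)⁻¹ * B x)) e₄.runs
    .sub (hE.mono (((e₁.trans e₂).trans e₃).trans e₄)) hZ (fun _ _ _ _ => rfl)
  obtain ⟨L₆, e₆, hS'⟩ := hinv L₅ _ e₅.runs hS fun x hx => (schur_posDef (hpos x hx)).2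
  obtain ⟨L₇, e₇, hU⟩ := exists_extends_mul hN hμ e₆.runs
    (hX.mono (((e₃.trans e₄).trans e₅).trans e₆)) hS'
  obtain ⟨L₈, e₈, hW⟩ := exists_extends_mul hN hμ e₇.runs (hS'.mono e₇)
    (hY.mono (((e₄.trans e₅).trans e₆).trans e₇))
  obtain ⟨L₉, e₉, hV⟩ := exists_extends_mul hN hμ e₈.runs (hU.mono e₈)
    (hY.mono ((((e₄.trans e₅).trans e₆).trans e₇).trans e₈))
  obtain ⟨L₁₀, e₁₀, hTL⟩ := exists_extends_matOp (M := fun x => (A x)⁻¹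
      + (A x)⁻¹ * B x * (E x - C x * ((A x)⁻¹ * B x))⁻¹ * (C x * (A x)⁻¹)) e₉.runs .add
    (hA'.mono (((((((e₂.trans e₃).trans e₄).trans e₅).trans e₆).trans e₇).trans e₈).trans e₉)) hV
    (fun _ _ _ _ => rfl)
  obtain ⟨L₁₁, e₁₁, hTR⟩ := exists_extends_neg e₁₀.runs (hU.mono ((e₈.trans e₉).trans e₁₀))
  obtain ⟨L₁₂, e₁₂, hBL⟩ := exists_extends_neg e₁₁.runs (hW.mono ((e₉.trans e₁₀).trans e₁₁))
  have e : Extends D L _ L₁₂ := ((((((((((e₁.trans e₂).trans e₃).trans e₄).trans e₅).trans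
    e₆).trans e₇).trans e₈).trans e₉).trans e₁₀).trans e₁₁).trans e₁₂
  refine ⟨L₁₂, ⟨e.pre, e.runs, e.length_le.trans (le_of_eq ?_)⟩, ?_⟩
  · simp only [Fintype.card_fin]
    ring
  · refine (AvailMat.fromBlocks (hTL.mono (e₁₁.trans e₁₂)) (hTR.mono e₁₂) hBL (hS'.mono
      (((((e₇.trans e₈).trans e₉).trans e₁₀).trans e₁₁).trans e₁₂))).congr fun x hx => ?_
    have h := schur_posDef (hpos x hx)
    rw [inv_fromBlocks h.1.isUnit h.2.isUnit]

/-- Recursive inversion of matrices whose size is a power of two. -/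
lemma exists_extends_inv {μ : ℕ → ℕ}
    (hμ : ∀ N, 0 < N → ∃ P : ArithProg ((Fin N × Fin N) ⊕ (Fin N × Fin N)) (Fin N × Fin N),
      P.Multiplies ∧ P.size ≤ μ N) (k : ℕ) :
    ∀ (L : List (Instr ι)) (M : (ι → ℝ) → Mat (2 ^ k)), Runs D L → AvailMat D L M →
      (∀ x ∈ D, (M x).PosDef) →
      ∃ L', Extends D L (invCost μ k) L' ∧ AvailMat D L' fun x => (M x)⁻¹ := by
  induction k with
  | zero =>
    intro L M hL hM hpos
    have : Subsingleton (Fin (2 ^ 0)) := inferInstanceAs (Subsingleton (Fin 1))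
    obtain ⟨L', h1, h2⟩ := exists_extends_matOp (A := fun _ => (1 : Mat (2 ^ 0)))
      (M := fun x => (M x)⁻¹) hL .div (fun i j => avail_const hL _) hM (by
        intro x hx i j
        obtain rfl : i = j := Subsingleton.elim _ _
        have h3 : M x i i ≠ 0 := (hpos x hx).diag_pos.ne'
        simp [ArithOp.eval, h3, Matrix.inv_subsingleton, Ring.inverse_eq_inv'])
    refine ⟨L', ⟨h1.pre, h1.runs, ?_⟩, h2⟩
    simpa [invCost] using h1.length_le
  | succ k ih =>
    intro L M hL hM hpos
    let e : Fin (2 ^ (k + 1)) ≃ Fin (2 ^ k) ⊕ Fin (2 ^ k) :=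
      (finCongr (by rw [pow_succ]; omega)).trans finSumFinEquiv.symm
    let M' : (ι → ℝ) → Matrix (Fin (2 ^ k) ⊕ Fin (2 ^ k)) (Fin (2 ^ k) ⊕ Fin (2 ^ k)) ℝ :=
      fun x => (M x).submatrix e.symm e.symm
    have hM' : AvailMat D L M' := hM.submatrix _ _
    obtain ⟨L', h1, h2⟩ := exists_extends_inv_fromBlocks (by positivity)
      (hμ (2 ^ k) (by positivity)) ih hL
      (A := fun x => (M' x).toBlocks₁₁) (B := fun x => (M' x).toBlocks₁₂)
      (C := fun x => (M' x).toBlocks₂₁) (E := fun x => (M' x).toBlocks₂₂)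
      (hM'.submatrix Sum.inl Sum.inl) (hM'.submatrix Sum.inl Sum.inr)
      (hM'.submatrix Sum.inr Sum.inl) (hM'.submatrix Sum.inr Sum.inr) (fun x hx => by
        rw [Matrix.fromBlocks_toBlocks]
        exact (hpos x hx).submatrix e.symm.injective)
    refine ⟨L', h1, (h2.submatrix e e).congr fun x _ => ?_⟩
    simp only [Matrix.fromBlocks_toBlocks, M', Matrix.inv_submatrix_equiv,
      Matrix.submatrix_submatrix, Equiv.symm_comp_self, Matrix.submatrix_id_id]

lemma fromBlocks_one_posDef {m n : Type*} [Fintype m] [DecidableEq m] [Fintype n] [DecidableEq n]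
    {A : Matrix m m ℝ} (hA : A.PosDef) :
    (Matrix.fromBlocks A 0 0 (1 : Matrix n n ℝ)).PosDef := by
  let _ := hA.isUnit.invertible
  have h := (Matrix.PosDef.fromBlocks₁₁ (0 : Matrix m n ℝ) 1 hA).2
    (by simpa using Matrix.PosSemidef.one)
  rw [Matrix.conjTranspose_zero] at h
  exact h.posDef_iff_det_ne_zero.2 (by simpa using hA.det_pos.ne')

/-- Matrices of size `d ≤ 2 ^ k` are padded with an identity block before inversion. -/
lemma exists_invertsPosDef {μ : ℕ → ℕ}
    (hμ : ∀ N, 0 < N → ∃ P : ArithProg ((Fin N × Fin N) ⊕ (Fin N × Fin N)) (Fin N × Fin N),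
      P.Multiplies ∧ P.size ≤ μ N) {d k : ℕ} (hdk : d ≤ 2 ^ k) :
    ∃ P : ArithProg (Fin d × Fin d) (Fin d × Fin d), P.InvertsPosDef ∧ P.size ≤ invCost μ k := by
  let e : Fin (2 ^ k) ≃ Fin d ⊕ Fin (2 ^ k - d) :=
    (finCongr (by omega)).trans finSumFinEquiv.symm
  let A : (Fin d × Fin d → ℝ) → Mat d := fun x => Matrix.of fun i j => x (i, j)
  let D : Set (Fin d × Fin d → ℝ) := {x | (A x).PosDef}
  have hL : Runs D [] := fun x _ => ⟨[], rfl⟩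
  have hA : AvailMat D [] A := fun i j => ⟨.input (i, j), fun x _ => ⟨[], rfl, rfl⟩⟩
  have hM : AvailMat D [] fun x => Matrix.fromBlocks (A x) 0 0 (1 : Mat (2 ^ k - d)) :=
    hA.fromBlocks (fun _ _ => avail_const hL _) (fun _ _ => avail_const hL _)
      (fun _ _ => avail_const hL _)
  obtain ⟨L', h1, h2⟩ := exists_extends_inv hμ k []
    (fun x => (Matrix.fromBlocks (A x) 0 0 (1 : Mat (2 ^ k - d))).submatrix e e) hL
    (hM.submatrix e e)
    (fun x hx => (fromBlocks_one_posDef hx).submatrix e.injective)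
  have h3 : AvailMat D L' fun x => (A x)⁻¹ := by
    refine (h2.submatrix (fun i => e.symm (Sum.inl i)) (fun i => e.symm (Sum.inl i))).congr
      fun x hx => ?_
    have hx' : IsUnit (A x) := Matrix.PosDef.isUnit hx
    rw [Matrix.inv_submatrix_equiv, inv_fromBlocks hx' (by simp)]
    ext i j
    simp
  choose o ho using h3
  refine ⟨⟨L', fun p => o p.1 p.2⟩, fun M hM p => ?_, by simpa [ArithProg.size] using h1.length_le⟩
  obtain ⟨mem, h4, h5⟩ := ho p.1 p.2 (fun q => M q.1 q.2) hM
  change (runInstrs _ L' []).bind _ = _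
  rw [h4]
  exact h5

lemma invCost_le {ω C : ℝ} (hω : 2 ≤ ω) (hC : 0 ≤ C) {μ : ℕ → ℕ}
    (hμ : ∀ N : ℕ, 0 < N → (μ N : ℝ) ≤ C * (N : ℝ) ^ ω) (k : ℕ) :
    (invCost μ k : ℝ) ≤ (3 * C + 2) * ((2 : ℝ) ^ k) ^ ω := by
  induction k with
  | zero => simp [invCost]; linarith
  | succ k ih =>
    have h1 := hμ (2 ^ k) (by positivity)
    push_cast at h1
    have h2 : (1 : ℝ) ≤ 2 ^ k := one_le_pow₀ (by norm_num)
    have h3 : (2 : ℝ) ^ k * 2 ^ k ≤ ((2 : ℝ) ^ k) ^ ω := by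
      rw [← sq, ← Real.rpow_natCast ((2 : ℝ) ^ k) 2]
      exact Real.rpow_le_rpow_of_exponent_le h2 (by exact_mod_cast hω)
    have h4 : (4 : ℝ) ≤ 2 ^ ω := by
      have := Real.rpow_le_rpow_of_exponent_le (by norm_num : (1 : ℝ) ≤ 2) hω
      norm_num at this
      exact this
    have h5 : ((2 : ℝ) ^ (k + 1)) ^ ω = ((2 : ℝ) ^ k) ^ ω * 2 ^ ω := by
      rw [pow_succ, Real.mul_rpow (by positivity) (by norm_num)]
    rw [h5]
    set x := ((2 : ℝ) ^ k) ^ ω with hx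
    have hx0 : 0 ≤ x := by positivity
    have h6 : (3 * C + 2) * (x * 4) ≤ (3 * C + 2) * (x * 2 ^ ω) := by gcongr
    simp only [invCost]
    push_cast
    linarith

/-- Inversion is not harder than multiplication. -/
theorem exists_inversion_program {ω : ℝ} (h : IsMatMulExponent ω) :
    ∃ C : ℝ, 0 ≤ C ∧ ∀ d : ℕ, 1 ≤ d → ∃ inv : ArithProg (Fin d × Fin d) (Fin d × Fin d),
      inv.InvertsPosDef ∧ (inv.size : ℝ) ≤ C * (d : ℝ) ^ ω := by
  obtain ⟨hω, C, hC⟩ := h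
  have hC' : ∀ N : ℕ, ∃ m : ℕ, 0 < N → (∃ P : ArithProg ((Fin N × Fin N) ⊕ (Fin N × Fin N))
      (Fin N × Fin N), P.Multiplies ∧ P.size ≤ m) ∧ (m : ℝ) ≤ max C 0 * (N : ℝ) ^ ω := by
    intro N
    rcases Nat.eq_zero_or_pos N with rfl | hN
    · exact ⟨0, fun h => absurd h (lt_irrefl _)⟩
    · obtain ⟨P, h1, h2⟩ := hC N hN
      exact ⟨P.size, fun _ => ⟨⟨P, h1, le_rfl⟩,
        h2.trans (mul_le_mul_of_nonneg_right (le_max_left _ _) (by positivity))⟩⟩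
  choose μ hμ using hC'
  refine ⟨(3 * max C 0 + 2) * 2 ^ ω, by positivity, fun d hd => ?_⟩
  obtain ⟨P, h1, h2⟩ := exists_invertsPosDef (fun N hN => (hμ N hN).1)
    (Nat.le_pow_clog one_lt_two d)
  refine ⟨P, h1, ?_⟩
  have h3 := invCost_le hω (le_max_right C 0) (fun N hN => (hμ N hN).2) (Nat.clog 2 d)
  have h4 : (2 : ℝ) ^ Nat.clog 2 d ≤ 2 * d := by
    rcases hd.eq_or_lt with rfl | hd
    · simp
    · have h5 : 2 ^ (Nat.clog 2 d - 1) < d := Nat.pow_pred_clog_lt_self one_lt_two hd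
      have h6 : 2 ^ Nat.clog 2 d = 2 * 2 ^ (Nat.clog 2 d - 1) := by
        rw [← pow_succ', Nat.sub_add_cancel (Nat.clog_pos one_lt_two hd)]
      have h7 : 2 ^ Nat.clog 2 d ≤ 2 * d := by omega
      exact_mod_cast h7
  have h5 := Real.rpow_le_rpow (by positivity) h4 (by linarith : 0 ≤ ω)
  rw [Real.mul_rpow (by norm_num) (by positivity)] at h5
  have h6 : (P.size : ℝ) ≤ invCost μ (Nat.clog 2 d) := by exact_mod_cast h2
  have h7 : 0 ≤ 3 * max C 0 + 2 := by positivity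
  calc (P.size : ℝ) ≤ _ := h6.trans h3
    _ ≤ (3 * max C 0 + 2) * (2 ^ ω * (d : ℝ) ^ ω) := mul_le_mul_of_nonneg_left h5 h7
    _ = _ := by ring

end Inversion

/-! ### The implementation of Barrier-ONS -/

section Implementation

variable {d : ℕ} {R η ν c : ℝ} {m : ℕ}

lemma forC_val {σ : Type} (body : σ → Costed σ) (n : ℕ) (s : σ) :
    (forC body n s).val = (fun s => (body s).val)^[n] s := by
  induction n generalizing s with
  | zero => rfl
  | succ n ih => exact ih _

lemma forC_cost {σ : Type} {body : σ → Costed σ} {k : ℕ} (h : ∀ s, (body s).cost = k) (n : ℕ)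
    (s : σ) : (forC body n s).cost = n * k := by
  induction n generalizing s with
  | zero => simp [forC, pure_cost]
  | succ n ih =>
    rw [forC, bind_cost, h, ih]
    ring

lemma rankOneC_cost (A : Mat d) (x : Vec d) (a b : ℝ) :
    (rankOneC A x a b).cost = 5 * d ^ 2 + 2 * d + 3 := by
  simp only [rankOneC, bind_cost, mulVecC_cost, dotC_cost, mulC_cost, addC_cost, divC_cost,
    outerC_cost, smulMatC_cost, subMatC_cost]
  ring

/-- The Sherman–Morrison formula. -/
lemma rankOneC_val {M : Mat d} (hM : M.PosDef) (x : Vec d) {a b : ℝ} (ha : 0 ≤ a) (hb : 0 < b) :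
    (rankOneC M⁻¹ x a b).val = (M + (a / b) • Matrix.vecMulVec x.ofLp x.ofLp)⁻¹ := by
  simp only [rankOneC, bind_val, mulVecC_val, dotC_val, mulC_val, addC_val, divC_val,
    outerC_val, smulMatC_val, subMatC_val]
  have hq : 0 ≤ ⟪x, Matrix.toEuclideanLin M⁻¹ x⟫ := by
    rw [real_inner_comm]
    exact inner_toEuclideanLin_self_nonneg hM.inv x
  have hq' : ⟪x, Matrix.toEuclideanLin M⁻¹ x⟫ = x.ofLp ⬝ᵥ M⁻¹.mulVec x.ofLp := by
    simp [EuclideanSpace.inner_eq_star_dotProduct, dotProduct_comm]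
  have hy : (Matrix.toEuclideanLin M⁻¹ x).ofLp = M⁻¹.mulVec x.ofLp := rfl
  set q := ⟪x, Matrix.toEuclideanLin M⁻¹ x⟫ with hqdef
  have hden : b + a * q ≠ 0 := by positivity
  have hu : IsUnit M.det := (Matrix.isUnit_iff_isUnit_det _).1 hM.isUnit
  have hT : Matrix.vecMul x.ofLp M⁻¹ = M⁻¹.mulVec x.ofLp := by
    have h1 : (M⁻¹).transpose = M⁻¹ := by
      rw [← Matrix.conjTranspose_eq_transpose_of_trivial]
      exact hM.inv.1
    conv_lhs => rw [← h1, Matrix.vecMul_transpose]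
  symm
  apply Matrix.inv_eq_right_inv
  rw [hy]
  set y := M⁻¹.mulVec x.ofLp with hydef
  have hMy : M.mulVec y = x.ofLp := by
    rw [hydef, Matrix.mulVec_mulVec, Matrix.mul_nonsing_inv _ hu, Matrix.one_mulVec]
  rw [add_mul, mul_sub, mul_sub, Matrix.mul_nonsing_inv _ hu, Matrix.mul_smul,
    Matrix.mul_vecMulVec, hMy, Matrix.smul_mul, Matrix.vecMulVec_mul, hT, Matrix.smul_mul,
    Matrix.mul_smul, Matrix.vecMulVec_mul_vecMulVec, ← hq', Matrix.vecMulVec_smul, smul_smul,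
    smul_smul, ← sub_smul, sub_add, ← sub_smul]
  have e : a / (b + a * q) - (a / b - a / b * (a / (b + a * q)) * q) = 0 := by
    field_simp
    ring
  rw [e, zero_smul, sub_zero]

/-- The matrix `2ν/(R² - ‖z‖²) I + η ∑ g_s g_sᵀ`, whose inverse is maintained. -/
def keptMat (R η ν : ℝ) (z : Vec d) (hist : List (Vec d × Vec d)) : Mat d :=
  (2 * ν / (R ^ 2 - ‖z‖ ^ 2)) • (1 : Mat d) + η • gramMat hist

lemma keptMat_posDef (hη : 0 ≤ η) (hν : 0 < ν) {z : Vec d} (hz : 0 < R ^ 2 - ‖z‖ ^ 2)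
    (hist : List (Vec d × Vec d)) : (keptMat R η ν z hist).PosDef :=
  (Matrix.PosDef.one.smul (by positivity)).add_posSemidef ((gramMat_posSemidef hist).smul hη)

lemma rankOneC_keptMat (hη : 0 ≤ η) (hν : 0 < ν) {z : Vec d} (hz : 0 < R ^ 2 - ‖z‖ ^ 2)
    (hist : List (Vec d × Vec d)) (u g : Vec d) :
    (rankOneC (keptMat R η ν z hist)⁻¹ g η 1).val = (keptMat R η ν z (hist ++ [(u, g)]))⁻¹ := by
  rw [rankOneC_val (keptMat_posDef hη hν hz hist) g hη one_pos, div_one, keptMat, keptMat,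
    gramMat_append, smul_add, add_assoc]

lemma rankOneC_sigmaMat (hη : 0 ≤ η) (hν : 0 < ν) {u z : Vec d} (hu : 0 < R ^ 2 - ‖u‖ ^ 2)
    (hz : 0 < R ^ 2 - ‖z‖ ^ 2) (hist : List (Vec d × Vec d)) :
    (rankOneC (keptMat R η ν z hist)⁻¹ u (4 * ν)
      ((R ^ 2 - ‖u‖ ^ 2) * (R ^ 2 - ‖u‖ ^ 2))).val = sigmaMat R η ν u z hist := by
  rw [rankOneC_val (keptMat_posDef hη hν hz hist) u (by positivity) (by positivity), ← sq,
    keptMat, sigmaMat, add_right_comm]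
  rfl

/-- The implementation state `fs` stores the data of the state `st`. -/
structure Represents (R η ν : ℝ) (fs : FastState d) (st : OnsState d) : Prop where
  u : fs.u = st.u
  z : fs.z = st.z
  sig : fs.sig = (keptMat R η ν st.z st.hist)⁻¹
  V : fs.V = gramMat st.hist
  S : fs.S = (st.hist.map fun p => ⟪p.2, p.1⟫ • p.2).sum
  G : fs.G = (st.hist.map Prod.snd).sum

lemma objGrad_eq (hist : List (Vec d × Vec d)) (u : Vec d) :
    objGrad R η ν hist u = (2 * ν / (R ^ 2 - ‖u‖ ^ 2)) • u
      + η • (Matrix.toEuclideanLin (gramMat hist) u - (hist.map fun p => ⟪p.2, p.1⟫ • p.2).sum)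
      + (hist.map Prod.snd).sum := by
  have h : (hist.map fun p => ⟪p.2, u - p.1⟫ • p.2).sum = Matrix.toEuclideanLin (gramMat hist) u
      - (hist.map fun p => ⟪p.2, p.1⟫ • p.2).sum := by
    refine ext_inner_right ℝ fun x => ?_
    rw [inner_sub_left, inner_gramMat, inner_list_sum, inner_list_sum, List.map_map, List.map_map,
      histForm, eq_sub_iff_add_eq, ← List.sum_map_add]
    simp [inner_sub_right, inner_smul_left, sub_mul]
  rw [objGrad, h]

lemma forC_taylor (A : Mat d) (γ : ℝ) (n : Vec d) (m : ℕ) :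
    (forC (fun p : Vec d × Vec d => do
        let y ← mulVecC A p.1
        let y' ← smulVecC γ y
        let s ← addVecC p.2 y'
        pure (y', s)) m (Matrix.toEuclideanLin A n, Matrix.toEuclideanLin A n)).val.2
      = ∑ k ∈ Finset.range (m + 1), γ ^ k • (Matrix.toEuclideanLin A ^ (k + 1)) n := by
  rw [forC_val]
  simp only [bind_val, mulVecC_val, smulVecC_val, addVecC_val, pure_val]
  suffices h : ∀ j, (fun p : Vec d × Vec d => (γ • Matrix.toEuclideanLin A p.1,
      p.2 + γ • Matrix.toEuclideanLin A p.1))^[j]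
        (Matrix.toEuclideanLin A n, Matrix.toEuclideanLin A n)
      = (γ ^ j • (Matrix.toEuclideanLin A ^ (j + 1)) n,
        ∑ k ∈ Finset.range (j + 1), γ ^ k • (Matrix.toEuclideanLin A ^ (k + 1)) n) by
    rw [h]
  intro j
  induction j with
  | zero => simp
  | succ j ih =>
    have e : γ • Matrix.toEuclideanLin A (γ ^ j • (Matrix.toEuclideanLin A ^ (j + 1)) n)
        = γ ^ (j + 1) • (Matrix.toEuclideanLin A ^ (j + 1 + 1)) n := by
      rw [map_smul, smul_smul, ← pow_succ', pow_succ' _ (j + 1)]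
      rfl
    rw [Function.iterate_succ_apply', ih, Finset.sum_range_succ _ (j + 1)]
    simp only [e]

open Classical in
lemma ite_leC_val {α : Type} (x y : ℝ) (a b : Costed α) :
    (if (leC x y).val = true then a else b).val = if x ≤ y then a.val else b.val := by
  by_cases h : x ≤ y <;> simp [leC, h]

open Classical in
lemma ite_leC_cost {α : Type} (x y : ℝ) (a b : Costed α) :
    (if (leC x y).val = true then a else b).cost = if x ≤ y then a.cost else b.cost := by
  by_cases h : x ≤ y <;> simp [leC, h]

open Classical in
/-- One round of the implementation, in terms of the state that it represents. -/
lemma fastUpdate_val (hη : 0 ≤ η) (hν : 0 < ν) (inv : ArithProg (Fin d × Fin d) (Fin d × Fin d))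
    {fs : FastState d} {st : OnsState d} (h : Represents R η ν fs st)
    (hu : 0 < R ^ 2 - ‖st.u‖ ^ 2) (hz : 0 < R ^ 2 - ‖st.z‖ ^ 2) (g : Vec d) :
    (fastUpdate R η ν c m inv fs g).val =
      let st' := onsUpdate R η ν c m st g
      let S' := (st'.hist.map fun p => ⟪p.2, p.1⟫ • p.2).sum
      let G' := (st'.hist.map Prod.snd).sum
      if |‖st'.u‖ ^ 2 - ‖st.z‖ ^ 2| ≤ c * (R ^ 2 - ‖st'.u‖ ^ 2) then
        ⟨st'.u, st.z, (keptMat R η ν st.z st'.hist)⁻¹, gramMat st'.hist, S', G'⟩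
      else
        ⟨st'.u, st'.u, (execC inv (keptMat R η ν st'.u st'.hist)).val, gramMat st'.hist,
          S', G'⟩ := by
  obtain ⟨u, z, sig, V, S, G⟩ := fs
  obtain ⟨h1, h2, h3, h4, h5, h6⟩ := h
  dsimp only at h1 h2 h3 h4 h5 h6
  subst h1 h2 h3 h4 h5 h6
  set hist' := st.hist ++ [(st.u, g)] with hh
  have hS : (st.hist.map fun p => ⟪p.2, p.1⟫ • p.2).sum + ⟪g, st.u⟫ • g
      = (hist'.map fun p => ⟪p.2, p.1⟫ • p.2).sum := by simp [hh]
  have hG : (st.hist.map Prod.snd).sum + g = (hist'.map Prod.snd).sum := by simp [hh]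
  have hV := (gramMat_append st.hist st.u g).symm
  rw [← hh] at hV
  have hgrad := objGrad_eq (R := R) (η := η) (ν := ν) hist' st.u
  have hs1 := rankOneC_keptMat hη hν hz st.hist st.u g
  rw [← hh] at hs1
  have hs2 := rankOneC_sigmaMat hη hν hu hz hist'
  have hu' : (onsUpdate R η ν c m st g).u = st.u - ∑ k ∈ Finset.range (m + 1),
      gammaOf R ν st.u st.z ^ k • (Matrix.toEuclideanLin (sigmaMat R η ν st.u st.z hist') ^ (k + 1))
        (objGrad R η ν hist' st.u) := by
    rw [← toEuclideanLin_taylorMat, ← gradient_objective hist' hu]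
    rfl
  have hh' : (onsUpdate R η ν c m st g).hist = hist' := rfl
  have hγ : 2 * ν / (R ^ 2 - ‖st.z‖ ^ 2) - 2 * ν / (R ^ 2 - ‖st.u‖ ^ 2)
      = gammaOf R ν st.u st.z := rfl
  have hinner : ∀ x : Vec d, ⟪x, x⟫ = ‖x‖ ^ 2 := fun x => real_inner_self_eq_norm_sq x
  unfold fastUpdate
  simp only [bind_val, ite_leC_val, pure_val, addVecC_val, dotC_val, smulVecC_val, outerC_val,
    addMatC_val, mulC_val, subC_val, divC_val, mulVecC_val, subVecC_val, absC_val,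
    scalarMatC_val, smulMatC_val, hinner, ← sq R, hS, hG, hV, ← hgrad, hs1, hs2,
    hγ, forC_taylor, ← hu', hh']
  rfl

open Classical in
lemma fastUpdate_cost (hη : 0 ≤ η) (hν : 0 < ν) (inv : ArithProg (Fin d × Fin d) (Fin d × Fin d))
    {fs : FastState d} {st : OnsState d} (h : Represents R η ν fs st)
    (hu : 0 < R ^ 2 - ‖st.u‖ ^ 2) (hz : 0 < R ^ 2 - ‖st.z‖ ^ 2) (g : Vec d) :
    (fastUpdate R η ν c m inv fs g).cost =
      let u' := (onsUpdate R η ν c m st g).u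
      16 * d ^ 2 + 21 * d + 20 + m * (2 * d ^ 2 + 2 * d)
        + if |‖u'‖ ^ 2 - ‖st.z‖ ^ 2| ≤ c * (R ^ 2 - ‖u'‖ ^ 2) then 0
          else 3 * d ^ 2 + 1 + inv.size := by
  obtain ⟨u, z, sig, V, S, G⟩ := fs
  obtain ⟨h1, h2, h3, h4, h5, h6⟩ := h
  dsimp only at h1 h2 h3 h4 h5 h6
  subst h1 h2 h3 h4 h5 h6
  set hist' := st.hist ++ [(st.u, g)] with hh
  have hS : (st.hist.map fun p => ⟪p.2, p.1⟫ • p.2).sum + ⟪g, st.u⟫ • g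
      = (hist'.map fun p => ⟪p.2, p.1⟫ • p.2).sum := by simp [hh]
  have hG : (st.hist.map Prod.snd).sum + g = (hist'.map Prod.snd).sum := by simp [hh]
  have hV := (gramMat_append st.hist st.u g).symm
  rw [← hh] at hV
  have hgrad := objGrad_eq (R := R) (η := η) (ν := ν) hist' st.u
  have hs1 := rankOneC_keptMat hη hν hz st.hist st.u g
  rw [← hh] at hs1
  have hs2 := rankOneC_sigmaMat hη hν hu hz hist'
  have hu' : (onsUpdate R η ν c m st g).u = st.u - ∑ k ∈ Finset.range (m + 1),
      gammaOf R ν st.u st.z ^ k • (Matrix.toEuclideanLin (sigmaMat R η ν st.u st.z hist') ^ (k + 1))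
        (objGrad R η ν hist' st.u) := by
    rw [← toEuclideanLin_taylorMat, ← gradient_objective hist' hu]
    rfl
  have hh' : (onsUpdate R η ν c m st g).hist = hist' := rfl
  have hγ : 2 * ν / (R ^ 2 - ‖st.z‖ ^ 2) - 2 * ν / (R ^ 2 - ‖st.u‖ ^ 2)
      = gammaOf R ν st.u st.z := rfl
  have hloop : ∀ (A : Mat d) (γ : ℝ) (s : Vec d × Vec d), (forC (fun p : Vec d × Vec d => do
      let y ← mulVecC A p.1
      let y' ← smulVecC γ y
      let s ← addVecC p.2 y'
      pure (y', s)) m s).cost = m * (2 * d ^ 2 + 2 * d) := fun A γ s => forC_cost (fun s => by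
    simp only [bind_cost, mulVecC_cost, smulVecC_cost, addVecC_cost, pure_cost]
    ring) m s
  have hexec : ∀ A : Mat d, (execC inv A).cost = inv.size := fun _ => rfl
  have hinner : ∀ x : Vec d, ⟪x, x⟫ = ‖x‖ ^ 2 := fun x => real_inner_self_eq_norm_sq x
  unfold fastUpdate
  simp only [ite_leC_cost, bind_cost, pure_cost, addVecC_val, dotC_val, smulVecC_val,
    outerC_val, addMatC_val, mulC_val, subC_val, divC_val, mulVecC_val, subVecC_val, absC_val,
    smulMatC_val, hinner, ← sq R, hS, hG, hV, ← hgrad,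
    hs1, hs2, hγ, forC_taylor, ← hu', addVecC_cost, dotC_cost, smulVecC_cost, outerC_cost,
    addMatC_cost, mulC_cost, subC_cost, divC_cost, mulVecC_cost, subVecC_cost, absC_cost, leC_cost,
    scalarMatC_cost, smulMatC_cost, rankOneC_cost, hloop, hexec]
  by_cases hc : |‖(onsUpdate R η ν c m st g).u‖ ^ 2 - ‖st.z‖ ^ 2|
      ≤ c * (R ^ 2 - ‖(onsUpdate R η ν c m st g).u‖ ^ 2)
  · simp only [if_pos hc]
    ring
  · simp only [if_neg hc]
    ring

lemma execC_val {inv : ArithProg (Fin d × Fin d) (Fin d × Fin d)} (hinv : inv.InvertsPosDef)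
    {A : Mat d} (hA : A.PosDef) : (execC inv A).val = A⁻¹ := by
  ext i j
  simp [execC, hinv A hA (i, j)]

lemma fastUpdate_represents (hη : 0 ≤ η) (hν : 0 < ν)
    {inv : ArithProg (Fin d × Fin d) (Fin d × Fin d)} (hinv : inv.InvertsPosDef)
    {fs : FastState d} {st : OnsState d} (h : Represents R η ν fs st)
    (hu : 0 < R ^ 2 - ‖st.u‖ ^ 2) (hz : 0 < R ^ 2 - ‖st.z‖ ^ 2) (g : Vec d)
    (hu' : 0 < R ^ 2 - ‖(onsUpdate R η ν c m st g).u‖ ^ 2) :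
    Represents R η ν (fastUpdate R η ν c m inv fs g).val (onsUpdate R η ν c m st g) := by
  have hz' : (onsUpdate R η ν c m st g).z
      = if |‖(onsUpdate R η ν c m st g).u‖ ^ 2 - ‖st.z‖ ^ 2|
          ≤ c * (R ^ 2 - ‖(onsUpdate R η ν c m st g).u‖ ^ 2) then st.z
        else (onsUpdate R η ν c m st g).u := rfl
  rw [fastUpdate_val hη hν inv h hu hz]
  dsimp only
  split_ifs at hz' ⊢
  · exact ⟨rfl, hz'.symm, by rw [hz'], rfl, rfl, rfl⟩
  · exact ⟨rfl, hz'.symm, by rw [execC_val hinv (keptMat_posDef hη hν hu' _), hz'], rfl, rfl, rfl⟩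

lemma fastBarrierONS_init_represents (hR : 0 < R) (hν : 0 < ν)
    (inv : ArithProg (Fin d × Fin d) (Fin d × Fin d)) :
    Represents R η ν (fastBarrierONS R η ν c m inv).init.val ⟨0, 0, []⟩ := by
  refine ⟨rfl, rfl, ?_, rfl, rfl, rfl⟩
  change (scalarMatC (R * R / (2 * ν)) : Costed (Mat d)).val = _
  rw [scalarMatC_val]
  symm
  apply Matrix.inv_eq_right_inv
  have h : R * R / (2 * ν) * (2 * ν / R ^ 2) = 1 := by field_simp
  simp [keptMat, gramMat, smul_smul, h]

lemma fastBarrierONS_init_cost (inv : ArithProg (Fin d × Fin d) (Fin d × Fin d)) :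
    (fastBarrierONS R η ν c m inv).init.cost = d ^ 2 + 3 := by
  simp only [fastBarrierONS, bind_cost, mulC_cost, divC_cost, scalarMatC_cost, pure_cost]
  ring

end Implementation

/-! ### The implementation inside the reduction -/

section Total

variable {d : ℕ} {K : Set (Vec d)} {r R G : ℝ} {sep : Vec d → Bool × Vec d} {Csep T : ℕ}
  {a : ℝ} {g : ℕ → Vec d} {inv : ArithProg (Fin d × Fin d) (Fin d × Fin d)}

lemma tunedSeq_gap (ha : 4 ≤ a) (hd : 1 ≤ d) (hK : SetAssumption K r R)
    (hsep : IsSeparationOracle K sep) (hG : 0 < G) (hg : ∀ t < T, ‖g t‖ ≤ G) :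
    ∀ t < T, 0 < R ^ 2 - ‖(tunedSeq a sep Csep r R G T g t).u‖ ^ 2 ∧
      0 < R ^ 2 - ‖(tunedSeq a sep Csep r R G T g t).z‖ ^ 2 := by
  intro t ht
  rcases Nat.lt_or_ge T 2 with hT | hT
  · obtain rfl : t = 0 := by omega
    have hR := hK.R_pos
    have hR2 : 0 < R ^ 2 - ‖(0 : Vec d)‖ ^ 2 := by
      rw [norm_zero]
      norm_num
      positivity
    exact ⟨hR2, hR2⟩
  · exact tunedSeq_invariant ha hd hT hK hsep hG hg t ht.le

/-- The implementation goes through the states of Barrier-ONS. -/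
lemma fast_represents (ha : 4 ≤ a) (hd : 1 ≤ d) (hK : SetAssumption K r R)
    (hsep : IsSeparationOracle K sep) (hG : 0 < G) (hg : ∀ t < T, ‖g t‖ ≤ G)
    (hinv : inv.InvertsPosDef) : ∀ t < T,
      Represents R (etaParam d T G R (R / r)) (nuParam d T G R (R / r))
        (reductionState (tunedFastONS a T G R (R / r) inv) sep Csep r T g t).val
        (tunedSeq a sep Csep r R G T g t) := by
  intro t ht
  have hb := tunedBounds hd (by omega : 1 ≤ T) hG hK.R_pos
    ((one_le_div hK.r_pos).2 (hK.r_le_R hd))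
  have hgap := tunedSeq_gap (Csep := Csep) ha hd hK hsep hG hg
  induction t with
  | zero => exact fastBarrierONS_init_represents hK.R_pos hb.nu_pos inv
  | succ t ih =>
    have h := ih (by omega)
    change Represents _ _ _ (reductionRound _ sep Csep r T
      (reductionState (tunedFastONS a T G R (R / r) inv) sep Csep r T g t).val (g t)).val _
    rw [reductionRound_val]
    have hu : (tunedFastONS a T G R (R / r) inv).output
        (reductionState (tunedFastONS a T G R (R / r) inv) sep Csep r T g t).val
        = (tunedSeq a sep Csep r R G T g t).u := h.u
    rw [hu, ← surrogate_eq]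
    exact fastUpdate_represents hb.eta_pos.le hb.nu_pos hinv h (hgap t (by omega)).1
      (hgap t (by omega)).2 _ (hgap (t + 1) ht).1

lemma fast_play_eq (ha : 4 ≤ a) (hd : 1 ≤ d) (hK : SetAssumption K r R)
    (hsep : IsSeparationOracle K sep) (hG : 0 < G) (hg : ∀ t < T, ‖g t‖ ≤ G)
    (hinv : inv.InvertsPosDef) {t : ℕ} (ht : t < T) :
    play (tunedFastONS a T G R (R / r) inv) sep Csep r T g t
      = play (tunedONS a d T G R (R / r)) sep Csep r T g t := by
  have h := (fast_represents (Csep := Csep) ha hd hK hsep hG hg hinv t ht).u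
  rw [play_eq, ← h]
  rfl

/-- The steps of one round, apart from those of a change of the expansion point. -/
lemma fast_round_cost (ha : 4 ≤ a) (hd : 1 ≤ d) (hK : SetAssumption K r R)
    (hsep : IsSeparationOracle K sep) (hG : 0 < G) (hg : ∀ t < T, ‖g t‖ ≤ G)
    (hinv : inv.InvertsPosDef) {t : ℕ} (ht : t < T) :
    ∃ n : ℕ, (2 : ℝ) ^ n ≤ 4 * (R / r) ^ 2 * T ∧
      (reductionState (tunedFastONS a T G R (R / r) inv) sep Csep r T g (t + 1)).cost
        + switchCount R (etaParam d T G R (R / r)) (nuParam d T G R (R / r))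
            (taylorOrder a (1 / 2) d T) (surrogate a sep Csep r R G T g) t
          * (3 * d ^ 2 + 1 + inv.size)
      ≤ (reductionState (tunedFastONS a T G R (R / r) inv) sep Csep r T g t).cost
        + switchCount R (etaParam d T G R (R / r)) (nuParam d T G R (R / r))
            (taylorOrder a (1 / 2) d T) (surrogate a sep Csep r R G T g) (t + 1)
          * (3 * d ^ 2 + 1 + inv.size)
        + (n + 1) * (Csep + d + 4) + 16 * d ^ 2 + 33 * d + 29
        + taylorOrder a (1 / 2) d T * (2 * d ^ 2 + 2 * d) := by
  have hT : 1 ≤ T := by omega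
  have hb := tunedBounds hd hT hG hK.R_pos ((one_le_div hK.r_pos).2 (hK.r_le_R hd))
  have hgap := tunedSeq_gap (Csep := Csep) ha hd hK hsep hG hg t ht
  obtain ⟨n, hn, hcost⟩ := gaugePlay_cost_le hd hK hsep Csep hT
    (norm_le_of_gap_pos hK.R_pos hgap.1)
  refine ⟨n, hn, ?_⟩
  have h := fast_represents (Csep := Csep) ha hd hK hsep hG hg hinv t ht
  have hu : (tunedFastONS a T G R (R / r) inv).output
      (reductionState (tunedFastONS a T G R (R / r) inv) sep Csep r T g t).val
      = (tunedSeq a sep Csep r R G T g t).u := h.u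
  have h1 := reductionRound_cost_le (sep := sep) (r := r) (tunedFastONS a T G R (R / r) inv) Csep T
    (reductionState (tunedFastONS a T G R (R / r) inv) sep Csep r T g t).val (g t)
  rw [hu, ← surrogate_eq] at h1
  have h2 := fastUpdate_cost (c := 1 / 2) (m := taylorOrder a (1 / 2) d T) hb.eta_pos.le hb.nu_pos
    inv h hgap.1 hgap.2 (surrogate a sep Csep r R G T g t)
  have h3 : (reductionState (tunedFastONS a T G R (R / r) inv) sep Csep r T g (t + 1)).cost
      = (reductionState (tunedFastONS a T G R (R / r) inv) sep Csep r T g t).cost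
        + (reductionRound (tunedFastONS a T G R (R / r) inv) sep Csep r T
          (reductionState (tunedFastONS a T G R (R / r) inv) sep Csep r T g t).val
          (g t)).cost := rfl
  change ((tunedFastONS a T G R (R / r) inv).update _ _).cost = _ at h2
  dsimp only at h2
  rw [h2] at h1
  rw [h3]
  split_ifs at h1 with hs
  · rw [switchCount_succ_of_not_switches fun h => h hs]
    omega
  · rw [switchCount_succ_of_switches hs, add_mul, one_mul]
    omega

end Total

/-! ### The total number of steps -/

section TotalCost

variable {d : ℕ} {K : Set (Vec d)} {r R G : ℝ} {sep : Vec d → Bool × Vec d} {Csep T : ℕ}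
  {a : ℝ} {g : ℕ → Vec d} {inv : ArithProg (Fin d × Fin d) (Fin d × Fin d)}

/-- The number of bisection steps is logarithmic. -/
lemma bisection_steps_le {n : ℕ} {κ : ℝ} (hd : 1 ≤ d) (hT : 1 ≤ T) (hκ : 1 ≤ κ)
    (hn : (2 : ℝ) ^ n ≤ 4 * κ ^ 2 * T) : (n : ℝ) ≤ 3 * (1 + Real.log (d * T * κ)) := by
  have hd0 : (1 : ℝ) ≤ d := by exact_mod_cast hd
  have hT0 : (1 : ℝ) ≤ T := by exact_mod_cast hT
  have h1 := Real.log_le_log (by positivity) hn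
  rw [Real.log_pow, Real.log_mul (by positivity) (by positivity),
    Real.log_mul (by norm_num) (by positivity), Real.log_pow,
    (by norm_num : (4 : ℝ) = 2 ^ 2), Real.log_pow] at h1
  rw [Real.log_mul (by positivity) (by positivity), Real.log_mul (by positivity) (by positivity)]
  push_cast at h1
  have h2 := Real.log_two_gt_d9
  have h3 := Real.log_nonneg hd0
  have h4 := Real.log_nonneg hT0
  have h5 := Real.log_nonneg hκ
  by_contra hc
  push Not at hc
  nlinarith

/-- The order of the Taylor expansion is logarithmic. -/
lemma taylorOrder_le {κ : ℝ} (ha : 0 ≤ a) (hd : 1 ≤ d) (hT : 1 ≤ T) (hκ : 1 ≤ κ) :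
    (taylorOrder a (1 / 2) d T : ℝ) ≤ (2 * a + 1) * (1 + Real.log (d * T * κ)) := by
  have hd0 : (1 : ℝ) ≤ d := by exact_mod_cast hd
  have hT0 : (1 : ℝ) ≤ T := by exact_mod_cast hT
  have hdT : (1 : ℝ) ≤ d * T := one_le_mul_of_one_le_of_one_le hd0 hT0
  have h0 := Real.log_nonneg hdT
  have h1 : Real.logb (1 / 2 : ℝ)⁻¹ (d * T) ≤ 2 * Real.log (d * T) := by
    rw [Real.logb, div_le_iff₀ (by rw [one_div, inv_inv]; exact Real.log_pos (by norm_num)),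
      one_div, inv_inv]
    nlinarith [Real.log_two_gt_d9]
  have h2 : 0 ≤ Real.logb (1 / 2 : ℝ)⁻¹ (d * T) := Real.logb_nonneg (by norm_num) hdT
  have h3 := Nat.ceil_lt_add_one (mul_nonneg ha h2)
  have h4 : Real.log (d * T) ≤ Real.log (d * T * κ) :=
    Real.log_le_log (by positivity) (le_mul_of_one_le_right (by positivity) hκ)
  have h5 := mul_le_mul_of_nonneg_left h1 ha
  have h6 := mul_le_mul_of_nonneg_left h4 ha
  unfold taylorOrder
  linarith

lemma log_one_add_div_le {κ : ℝ} (hd : 1 ≤ d) (hT : 1 ≤ T) (hκ : 1 ≤ κ) :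
    Real.log (1 + T / d) ≤ 1 + Real.log (d * T * κ) := by
  have hd0 : (1 : ℝ) ≤ d := by exact_mod_cast hd
  have hT0 : (1 : ℝ) ≤ T := by exact_mod_cast hT
  have h1 : (1 : ℝ) + T / d ≤ 2 * (d * T * κ) := by
    have h2 : (T : ℝ) / d ≤ T := div_le_self (by linarith) hd0
    have h3 : (T : ℝ) ≤ d * T * κ := by
      have h4 : (T : ℝ) ≤ d * T := le_mul_of_one_le_left (by linarith) hd0
      exact h4.trans (le_mul_of_one_le_right (by positivity) hκ)
    linarith
  have h2 := Real.log_le_log (by positivity) h1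
  rw [Real.log_mul (by norm_num) (by positivity)] at h2
  linarith [Real.log_two_lt_d9]

/-- The number of changes of the expansion point is of order `√T`, up to a logarithm. -/
lemma tuned_switchCount_le (ha : 4 ≤ a) (hd : 1 ≤ d) (hT : 1 ≤ T) (hK : SetAssumption K r R)
    (hsep : IsSeparationOracle K sep) (hG : 0 < G) (hg : ∀ t < T, ‖g t‖ ≤ G) :
    (switchCount R (etaParam d T G R (R / r)) (nuParam d T G R (R / r))
        (taylorOrder a (1 / 2) d T) (surrogate a sep Csep r R G T g) T : ℝ)
      ≤ 6 * √T * (1 + Real.log (d * T * (R / r))) := by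
  have hκ : 1 ≤ R / r := (one_le_div hK.r_pos).2 (hK.r_le_R hd)
  have hd0 : (1 : ℝ) ≤ d := by exact_mod_cast hd
  have hT0 : (1 : ℝ) ≤ T := by exact_mod_cast hT
  set N := switchCount R (etaParam d T G R (R / r)) (nuParam d T G R (R / r))
    (taylorOrder a (1 / 2) d T) (surrogate a sep Csep r R G T g) T with hN
  have hℓ : 1 ≤ 1 + Real.log (d * T * (R / r)) := by
    have := Real.log_nonneg (one_le_mul_of_one_le_of_one_le
      (one_le_mul_of_one_le_of_one_le hd0 hT0) hκ)
    linarith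
  have hL := log_one_add_div_le hd hT hκ
  set ℓ := 1 + Real.log (d * T * (R / r)) with hℓdef
  have hs : 1 ≤ √(T : ℝ) := Real.one_le_sqrt.2 hT0
  rcases Nat.lt_or_ge T 2 with hT2 | hT2
  · have h1 : (N : ℝ) ≤ 1 := by
      have h2 : N ≤ 1 := (switchCount_le T).trans (by omega)
      exact_mod_cast h2
    nlinarith
  · have hb := tunedBounds hd hT hG hK.R_pos hκ
    have h1 := switchCount_sq_le hd hK.R_pos hb.eta_pos hb.nu_pos
      (four_le_taylorOrder ha (by nlinarith : 2 ≤ d * T)) (surrogate_mul_le hd hT hK hG)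
      (norm_surrogate_le (a := a) (Csep := Csep) hd hT hK hsep hG hg)
    change (N : ℝ) ^ 2 ≤ _ at h1
    have h2 : (N : ℝ) ^ 2 ≤ 29 * T * ℓ := by
      refine h1.trans ?_
      rw [div_le_iff₀ (mul_pos hb.eta_pos hb.nu_pos)]
      have h3 := mul_le_mul_of_nonneg_left hb.dual (by positivity : (0 : ℝ) ≤ 29 * T)
      have h4 : (d : ℝ) * Real.log (1 + T / d)
          ≤ (etaParam d T G R (R / r) * nuParam d T G R (R / r)) * ℓ :=
        mul_le_mul hb.eta_mul_nu hL hb.log_pos.le (by linarith [hb.eta_mul_nu])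
      have h5 := mul_le_mul_of_nonneg_left h4 (by positivity : (0 : ℝ) ≤ 29 * T)
      linarith
    have h6 : (N : ℝ) ^ 2 ≤ (6 * √T * ℓ) ^ 2 := by
      rw [mul_pow, mul_pow, Real.sq_sqrt (by linarith)]
      have h7 : ℓ ≤ ℓ ^ 2 := by nlinarith
      have h8 := mul_le_mul_of_nonneg_left h7 (by positivity : (0 : ℝ) ≤ 29 * T)
      have h9 : 0 ≤ (T : ℝ) * ℓ ^ 2 := by positivity
      linarith
    exact (abs_le_of_sq_le_sq' h6 (by positivity)).2

/-- The bound for the cost of one round, with the logarithmic factors collected. -/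
lemma round_cost_le {n m : ℕ} {ℓ : ℝ} (ha : 0 ≤ a) (hd : 1 ≤ d) (hℓ : 1 ≤ ℓ) (hn : (n : ℝ) ≤ 3 * ℓ)
    (hm : (m : ℝ) ≤ (2 * a + 1) * ℓ) :
    (((n + 1) * (Csep + d + 4) + 16 * d ^ 2 + 33 * d + 29 + m * (2 * d ^ 2 + 2 * d) : ℕ) : ℝ)
      ≤ ℓ * (4 * Csep + (102 + 8 * a) * d ^ 2) := by
  have hd0 : (1 : ℝ) ≤ d := by exact_mod_cast hd
  have hd2 : (d : ℝ) ≤ d ^ 2 := by nlinarith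
  have hC : (0 : ℝ) ≤ Csep := Nat.cast_nonneg _
  have h1 : ((n : ℝ) + 1) * (Csep + d + 4) ≤ (4 * ℓ) * (Csep + 5 * d ^ 2) :=
    mul_le_mul (by linarith) (by linarith) (by linarith) (by linarith)
  have h2 : (m : ℝ) * (2 * d ^ 2 + 2 * d) ≤ ((2 * a + 1) * ℓ) * (4 * d ^ 2) :=
    mul_le_mul hm (by linarith) (by positivity) (by positivity)
  have h3 : (78 : ℝ) * d ^ 2 ≤ ℓ * (78 * d ^ 2) := le_mul_of_one_le_left (by positivity) hℓ
  push_cast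
  linarith

/-- The total number of steps of the implementation. -/
theorem fast_totalCost_le (ha : 4 ≤ a) (hd : 1 ≤ d) (hT : 1 ≤ T) (hK : SetAssumption K r R)
    (hsep : IsSeparationOracle K sep) (hG : 0 < G) (hg : ∀ t < T, ‖g t‖ ≤ G)
    (hinv : inv.InvertsPosDef) {B : ℝ} (hB : 0 ≤ B) {X : ℝ} (hX : 0 ≤ X)
    (hsize : (inv.size : ℝ) ≤ B * X) :
    (totalCost (tunedFastONS a T G R (R / r) inv) sep Csep r T g : ℝ)
      ≤ (110 + 8 * a + 6 * B) * (1 + Real.log (d * T * (R / r)))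
        * (Csep * T + (d : ℝ) ^ 2 * T + X * √T) := by
  have hκ : 1 ≤ R / r := (one_le_div hK.r_pos).2 (hK.r_le_R hd)
  have hd0 : (1 : ℝ) ≤ d := by exact_mod_cast hd
  have hT0 : (1 : ℝ) ≤ T := by exact_mod_cast hT
  have hC : (0 : ℝ) ≤ Csep := Nat.cast_nonneg _
  have hℓ : 1 ≤ 1 + Real.log (d * T * (R / r)) := by
    have := Real.log_nonneg (one_le_mul_of_one_le_of_one_le
      (one_le_mul_of_one_le_of_one_le hd0 hT0) hκ)
    linarith
  have hN := tuned_switchCount_le (Csep := Csep) ha hd hT hK hsep hG hg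
  have hN' : (switchCount R (etaParam d T G R (R / r)) (nuParam d T G R (R / r))
      (taylorOrder a (1 / 2) d T) (surrogate a sep Csep r R G T g) T : ℝ) ≤ T := by
    exact_mod_cast switchCount_le T
  have key : ∀ t ≤ T,
      ((reductionState (tunedFastONS a T G R (R / r) inv) sep Csep r T g t).cost : ℝ)
      ≤ (d ^ 2 + 3) + t * ((1 + Real.log (d * T * (R / r))) * (4 * Csep + (102 + 8 * a) * d ^ 2))
        + (switchCount R (etaParam d T G R (R / r)) (nuParam d T G R (R / r))
            (taylorOrder a (1 / 2) d T) (surrogate a sep Csep r R G T g) t : ℝ)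
          * (3 * d ^ 2 + 1 + inv.size) := by
    intro t
    induction t with
    | zero =>
      intro _
      have h1 : (reductionState (tunedFastONS a T G R (R / r) inv) sep Csep r T g 0).cost
          = d ^ 2 + 3 := fastBarrierONS_init_cost inv
      rw [h1]
      simp [switchCount]
    | succ t ih =>
      intro ht
      obtain ⟨n, hn, h1⟩ := fast_round_cost (Csep := Csep) ha hd hK hsep hG hg hinv ht
      have h2 := round_cost_le (Csep := Csep) (by linarith) hd hℓ (bisection_steps_le hd hT hκ hn)
        (taylorOrder_le (a := a) (by linarith) hd hT hκ)
      have h3 := ih (by omega)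
      have h4 := Nat.cast_le (α := ℝ).2 h1
      push_cast at h2 h4 ⊢
      linarith
  have h1 := key T le_rfl
  set ℓ := 1 + Real.log (d * T * (R / r))
  set N := switchCount R (etaParam d T G R (R / r)) (nuParam d T G R (R / r))
    (taylorOrder a (1 / 2) d T) (surrogate a sep Csep r R G T g) T
  have hd2 : (1 : ℝ) ≤ d ^ 2 := one_le_pow₀ hd0
  have h2 : (N : ℝ) * (3 * d ^ 2 + 1 + inv.size) ≤ T * (4 * d ^ 2) + 6 * √T * ℓ * (B * X) := by
    have h3 : (N : ℝ) * (3 * d ^ 2 + 1) ≤ T * (4 * d ^ 2) :=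
      mul_le_mul hN' (by linarith) (by positivity) (by positivity)
    have h4 : (N : ℝ) * inv.size ≤ 6 * √T * ℓ * (B * X) :=
      mul_le_mul hN hsize (Nat.cast_nonneg _) (by positivity)
    linarith
  have h5 : (d : ℝ) ^ 2 + 3 ≤ ℓ * (T * (4 * d ^ 2)) := by
    have h6 : (4 : ℝ) * d ^ 2 ≤ T * (4 * d ^ 2) := le_mul_of_one_le_left (by positivity) hT0
    have h7 := le_mul_of_one_le_left (by positivity : (0 : ℝ) ≤ T * (4 * d ^ 2)) hℓ
    linarith
  have h8 : (T : ℝ) * (4 * d ^ 2) ≤ ℓ * (T * (4 * d ^ 2)) :=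
    le_mul_of_one_le_left (by positivity) hℓ
  have e1 : 0 ≤ ℓ * (Csep * T) := by positivity
  have e2 : 0 ≤ ℓ * (X * √T) := by positivity
  have e3 : 0 ≤ ℓ * ((d : ℝ) ^ 2 * T) := by positivity
  have e4 := mul_nonneg (by linarith : 0 ≤ a) e1
  have e5 := mul_nonneg (by linarith : 0 ≤ a) e2
  have e6 := mul_nonneg hB e1
  have e7 := mul_nonneg hB e3
  change ((reductionState (tunedFastONS a T G R (R / r) inv) sep Csep r T g T).cost : ℝ) ≤ _
  linarith

end TotalCost

end GaugeOCO

end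

theorem mainTheorem1 :
    ∃ a₀ : ℝ, ∀ a : ℝ, a₀ ≤ a →
      -- feasibility and regret
      (∀ (d T : ℕ), 1 ≤ d → 1 ≤ T → ∀ (K : Set (GaugeOCO.Vec d)) (r R G : ℝ)
        (sep : GaugeOCO.Vec d → Bool × GaugeOCO.Vec d) (Csep : ℕ)
        (f : ℕ → GaugeOCO.Vec d → ℝ) (w g : ℕ → GaugeOCO.Vec d),
        GaugeOCO.SetAssumption K r R →
        GaugeOCO.IsSeparationOracle K sep →
        w = GaugeOCO.play (GaugeOCO.tunedONS a d T G R (R / r)) sep Csep r T g →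
        GaugeOCO.LossAssumption K G T f w g →
        (∀ t < T, w t ∈ K) ∧
        ∀ x ∈ K, ∑ t ∈ Finset.range T, inner ℝ (g t) (w t - x) ≤
          5 * G * R * √(2 * d * T * Real.log (1 + T / d))
            + 66 * G * R * (R / r) * d * Real.log (1 + T / d)) ∧
      -- computational cost
      (∀ ω : ℝ, GaugeOCO.IsMatMulExponent ω →
        ∃ (C : ℝ) (p : ℕ), ∀ d : ℕ, 1 ≤ d →
          ∃ inv : GaugeOCO.ArithProg (Fin d × Fin d) (Fin d × Fin d), inv.InvertsPosDef ∧
            ∀ (T : ℕ), 1 ≤ T → ∀ (K : Set (GaugeOCO.Vec d)) (r R G : ℝ)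
              (sep : GaugeOCO.Vec d → Bool × GaugeOCO.Vec d) (Csep : ℕ)
              (f : ℕ → GaugeOCO.Vec d → ℝ) (w g : ℕ → GaugeOCO.Vec d),
              GaugeOCO.SetAssumption K r R →
              GaugeOCO.IsSeparationOracle K sep →
              w = GaugeOCO.play (GaugeOCO.tunedONS a d T G R (R / r)) sep Csep r T g →
              GaugeOCO.LossAssumption K G T f w g →
              (∀ t < T,
                GaugeOCO.play (GaugeOCO.tunedFastONS a T G R (R / r) inv) sep Csep r T g t = w t) ∧
              (GaugeOCO.totalCost (GaugeOCO.tunedFastONS a T G R (R / r) inv) sep Csep r T g : ℝ) ≤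
                C * (1 + Real.log (d * T * (R / r))) ^ p *
                  (Csep * T + (d : ℝ) ^ 2 * T + (d : ℝ) ^ ω * √(T : ℝ))) := by
  refine ⟨4, fun a ha => ⟨?_, ?_⟩⟩
  · intro d T hd hT K r R G sep Csep f w g hK hsep hw hf
    subst hw
    refine ⟨fun t _ => ?_, fun x hx =>
      GaugeOCO.tuned_regret ha hd hT hK hsep hf.G_pos hf.norm_le hx⟩
    rw [GaugeOCO.play_eq]
    exact GaugeOCO.gaugePlay_mem hK hsep Csep hT _
  · intro ω hω
    obtain ⟨B, hB, hprog⟩ := GaugeOCO.exists_inversion_program hω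
    refine ⟨110 + 8 * a + 6 * B, 1, fun d hd => ?_⟩
    obtain ⟨inv, hinv, hsize⟩ := hprog d hd
    refine ⟨inv, hinv, ?_⟩
    intro T hT K r R G sep Csep f w g hK hsep hw hf
    subst hw
    refine ⟨fun t ht =>
      GaugeOCO.fast_play_eq ha hd hK hsep hf.G_pos hf.norm_le hinv ht, ?_⟩
    rw [pow_one]
    exact GaugeOCO.fast_totalCost_le ha hd hT hK hsep hf.G_pos hf.norm_le hinv hB (by positivity)
      hsize
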